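/- **Theorem 4.5 (triangle inequality for (upper) angles, mixed time orientation).** *Setting.* A Lorentzian pre-length space $(X,d,\ll,\leq,\tau)$ is a metric space $(X,d)$ with transitive relations $\ll\,\subseteq\,\leq$, $\leq$ reflexive, and a lower semicontinuous $\tau:X\times X\to[0,\infty]$ such that $\tau(p,r)\ge\tau(p,q)+\tau(q,r)$ for $p\le q\le r$, and $\tau(p,q)>0\Leftrightarrow p\ll q$. It is *strongly causal* if the sets $\{z: p\ll z\ll q\}$ form a subbase of the metric topology; $\tau$ is *locally finite-valued* (*locally continuous*) if every point has a neighborhood $U$ with $\tau<\infty$ (with $\tau$ continuous) on $U\times U$. $X$ is *locally causally closed* if every point has a neighborhood $U$ such that $p_n,q_n\in U$, $p_n\le q_n$, $p_n\to p\in\bar U$, $q_n\to q\in\bar U$ imply $p\le q$. A *future directed causal (timelike) curve* is a locally Lipschitz curve $c:I\to X$ on an interval, not constant on any nontrivial subinterval, with $c(s)\le c(t)$ ($c(s)\ll c(t)$) for $s<t$; past directed curves are defined by reversing the relation. The length of a future directed causal curve on $[a,b]$ is $L_\tau(c)=\inf\sum_i\tau(c(t_i),c(t_{i+1}))$ over partitions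 of $[a,b]$; it is a *distance realizer* if $L_\tau(c)=\tau(c(a),c(b))$, and a future directed causal curve on $I$ is a *geodesic* if every $t\in I$ has a neighborhood $[a,b]$ in $I$ on which the curve is a distance realizer (past directed: by parameter reversal). $X$ satisfies *geodesic prolongation* if every causal geodesic defined on a compact interval $[b,c]$, $b<c$, extends to a causal geodesic on some open interval $(a,e)$ with $a<b<c<e$. Let $\mathbb L_K$ be the simply connected, complete Lorentzian plane of constant curvature $K$ (Minkowski plane for $K=0$, universal cover of scaled de Sitter, resp. anti-de Sitter space for $K>0$, resp. $K<0$), with time separation $\bar\tau$, and $D_K=\pi/\sqrt{-K}$ for $K<0$, $D_K=\infty$ otherwise. $X$ has *timelike curvature bounded below* if for some $K\in\mathbb R$ it is covered by open sets $U$ such that: $\tau$ is finite and continuous on $U\times U$; any $p\ll q$ in $U$ are joined by a future directed distance realizer in $U$, and every such realizer in $U$ is timelike; and for all $p_1\ll p_2\ll p_3$ in $U$ with $\tau(p_1,p_3)<D_K$, all distance realizing sides $\alpha_{ij}$ in $U$ from $p_i$ to $p_j$ ($i<j$), all points $q_1,q_2$ on sides, all comparison triangles in $\mathbb L_K$ with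 the same side-lengths, and all corresponding points $\bar q_1,\bar q_2$ on the corresponding sides (same time separations to the endpoints of the side), one has $\tau(q_1,q_2)\le\bar\tau(\bar q_1,\bar q_2)$. For future or past directed timelike curves $\alpha,\beta:[0,B)\to X$ with $\alpha(0)=\beta(0)=x$, let $A_0$ be the set of $(s,t)\in(0,B)^2$ such that $\alpha(s)\le\beta(t)$ or $\beta(t)\le\alpha(s)$ and the time separations between $x,\alpha(s),\beta(t)$ are finite. For $(s,t)\in A_0$ let $\tilde\measuredangle_x(\alpha(s),\beta(t))$ be the hyperbolic angle $\operatorname{arcosh}\frac{|\langle v,w\rangle|}{|v||w|}$ at $\bar x$ between the sides $v=\bar y-\bar x$, $w=\bar z-\bar x$ of a comparison triangle $\bar x,\bar y,\bar z$ of $x,\alpha(s),\beta(t)$ in the Minkowski plane (same causal order and time separations). The *upper angle* is $$\measuredangle_x(\alpha,\beta)=\limsup_{(s,t)\in A_0;\ s,t\searrow0}\tilde\measuredangle_x(\alpha(s),\beta(t))\in[0,\infty],$$ and *the angle exists* if this limit superior is a limit and finite. *Statement.* Let $X$ be a strongly causal Lorentzian pre-length space with $\tau$ locally finite-valued and locally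 continuous, and let $\alpha,\beta,\gamma:[0,B)\to X$, $B>0$, be timelike curves (each future or past directed) with $x:=\alpha(0)=\beta(0)=\gamma(0)$. (i) If $\alpha,\beta$ are future directed, $\gamma$ is past directed and the angle $\measuredangle_x(\alpha,\gamma)$ exists, then $\measuredangle_x(\alpha,\gamma)\le\measuredangle_x(\alpha,\beta)+\measuredangle_x(\beta,\gamma)$. (ii) If moreover $X$ is locally causally closed, has timelike curvature bounded below and satisfies geodesic prolongation, and if $\alpha,\gamma$ are future directed timelike curves and $\beta$ is a past directed timelike geodesic, then $\measuredangle_x(\alpha,\gamma)\le\measuredangle_x(\alpha,\beta)+\measuredangle_x(\beta,\gamma)$. -/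

import Mathlib

open Set Filter Topology
open scoped ENNReal

noncomputable section

/-- A Lorentzian pre-length space: a causal space (`chron` is the timelike relation, `causal` the
causal relation) on a metric space, with a lower semicontinuous time separation function `tau`. -/
structure LorentzianPreLengthSpace (X : Type*) [MetricSpace X] where
  chron : X → X → Prop
  causal : X → X → Prop
  tau : X → X → ℝ≥0∞
  chron_trans : ∀ p q r, chron p q → chron q r → chron p r
  causal_trans : ∀ p q r, causal p q → causal q r → causal p r
  causal_refl : ∀ p, causal p p
  causal_of_chron : ∀ p q, chron p q → causal p q
  lowerSemicontinuous_tau : LowerSemicontinuous (fun z : X × X => tau z.1 z.2)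
  reverse_triangle : ∀ p q r, causal p q → causal q r → tau p q + tau q r ≤ tau p r
  tau_pos_iff : ∀ p q, 0 < tau p q ↔ chron p q

/-! ### The Lorentzian planes of constant curvature

The simply connected Lorentzian plane of constant curvature `K` is `ℝ × ℝ`, a point being a pair
(time coordinate, space coordinate), with the metric
`-cosh (√(-K) x) ^ 2 dt ^ 2 + cosh (√K t) ^ 2 dx ^ 2`. As `Real.sqrt` vanishes on negative numbers,
this is the Minkowski metric `-dt ^ 2 + dx ^ 2` for `K = 0`, the universal cover of de Sitter space
with `-dt ^ 2 + cosh (√K t) ^ 2 dx ^ 2` for `K > 0`, and the universal cover of anti-de Sitter space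
with `-cosh (√(-K) x) ^ 2 dt ^ 2 + dx ^ 2` for `K < 0`, in global coordinates. -/

namespace KPlane

/-- The Lorentzian metric of the plane of curvature `K`, at the point `p`. -/
def metric (K : ℝ) (p v w : ℝ × ℝ) : ℝ :=
  -(Real.cosh (√(-K) * p.2) ^ 2 * (v.1 * w.1)) + Real.cosh (√K * p.1) ^ 2 * (v.2 * w.2)

/-- Continuously differentiable future directed causal curves from `p` to `q`, on `[0, 1]`:
every velocity is causal and points towards increasing time. -/
def IsCausalCurve (K : ℝ) (c : ℝ → ℝ × ℝ) (p q : ℝ × ℝ) : Prop :=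
  ContDiff ℝ 1 c ∧ c 0 = p ∧ c 1 = q ∧
    ∀ u ∈ Icc (0 : ℝ) 1, 0 < (deriv c u).1 ∧ metric K (c u) (deriv c u) (deriv c u) ≤ 0

/-- The causal relation of the plane of curvature `K`. -/
def Causal (K : ℝ) (p q : ℝ × ℝ) : Prop :=
  p = q ∨ ∃ c, IsCausalCurve K c p q

/-- The Lorentzian length of a curve on `[0, 1]`. -/
def length (K : ℝ) (c : ℝ → ℝ × ℝ) : ℝ :=
  ∫ u in (0 : ℝ)..1, √(-metric K (c u) (deriv c u) (deriv c u))

/-- The time separation of the plane of curvature `K`: the supremum of the lengths of the future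
directed causal curves from `p` to `q`, and `0` if there are none. -/
def tau (K : ℝ) (p q : ℝ × ℝ) : ℝ≥0∞ :=
  ⨆ (c : ℝ → ℝ × ℝ) (_ : IsCausalCurve K c p q), ENNReal.ofReal (length K c)

/-- The timelike diameter of the plane of curvature `K`. -/
def diam (K : ℝ) : ℝ≥0∞ :=
  if K < 0 then ENNReal.ofReal (Real.pi / √(-K)) else ⊤

/-- The hyperbolic angle at `x` in the Minkowski plane between the straight segments from `x` to
`y` and to `z`, for `y` and `z` timelike related to `x`. -/
def flatAngle (x y z : ℝ × ℝ) : ℝ :=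
  Real.arcosh (|metric 0 x (y - x) (z - x)| /
    (√|metric 0 x (y - x) (y - x)| * √|metric 0 x (z - x) (z - x)|))

end KPlane

namespace LorentzianPreLengthSpace

variable {X : Type*} [MetricSpace X] (L : LorentzianPreLengthSpace X)

/-! ### Local and causal conditions on the space -/

/-- Strong causality: the Alexandrov topology, generated by the timelike diamonds, is the metric
topology. -/
def StronglyCausal : Prop :=
  TopologicalSpace.generateFrom {D : Set X | ∃ p q, D = {z | L.chron p z ∧ L.chron z q}} =
    (inferInstance : TopologicalSpace X)

def LocallyFiniteValued : Prop :=
  ∀ x, ∃ U ∈ 𝓝 x, ∀ p ∈ U, ∀ q ∈ U, L.tau p q < ⊤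

def LocallyContinuous : Prop :=
  ∀ x, ∃ U ∈ 𝓝 x, ContinuousOn (fun z : X × X => L.tau z.1 z.2) (U ×ˢ U)

def LocallyCausallyClosed : Prop :=
  ∀ x, ∃ U ∈ 𝓝 x, ∀ (p q : ℕ → X), (∀ n, p n ∈ U) → (∀ n, q n ∈ U) → (∀ n, L.causal (p n) (q n)) →
    ∀ a ∈ closure U, ∀ b ∈ closure U, Tendsto p atTop (𝓝 a) → Tendsto q atTop (𝓝 b) →
      L.causal a b

/-! ### Curves -/

/-- A locally Lipschitz curve on the interval `I` that is not constant on any nontrivial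
subinterval. -/
def IsCurveOn (c : ℝ → X) (I : Set ℝ) : Prop :=
  LocallyLipschitzOn I c ∧ ∀ s ∈ I, ∀ t ∈ I, s < t → ∃ u ∈ Icc s t, c u ≠ c s

def IsFutureCausal (c : ℝ → X) (I : Set ℝ) : Prop :=
  IsCurveOn c I ∧ ∀ s ∈ I, ∀ t ∈ I, s < t → L.causal (c s) (c t)

def IsFutureTimelike (c : ℝ → X) (I : Set ℝ) : Prop :=
  IsCurveOn c I ∧ ∀ s ∈ I, ∀ t ∈ I, s < t → L.chron (c s) (c t)

def IsPastTimelike (c : ℝ → X) (I : Set ℝ) : Prop :=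
  IsCurveOn c I ∧ ∀ s ∈ I, ∀ t ∈ I, s < t → L.chron (c t) (c s)

/-- The `tau`-length of a future directed causal curve on `[a, b]`: the infimum over all partitions
of the sums of the time separations of consecutive points. -/
def length (c : ℝ → X) (a b : ℝ) : ℝ≥0∞ :=
  ⨅ (n : ℕ) (t : Fin (n + 1) → ℝ) (_ : StrictMono t ∧ t 0 = a ∧ t (Fin.last n) = b),
    ∑ i : Fin n, L.tau (c (t i.castSucc)) (c (t i.succ))

/-- A future directed causal curve on `[a, b]` that realizes the time separation of its
endpoints. -/
def IsRealizer (c : ℝ → X) (a b : ℝ) : Prop :=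
  L.IsFutureCausal c (Icc a b) ∧ L.tau (c a) (c b) = L.length c a b

/-- Future directed geodesics on an interval `I`: causal curves that realize the time separation on
some compact neighbourhood in `I` of each parameter. -/
def IsFutureGeodesic (c : ℝ → X) (I : Set ℝ) : Prop :=
  L.IsFutureCausal c I ∧
    ∀ t ∈ I, ∃ a b : ℝ, Icc a b ⊆ I ∧ Icc a b ∈ 𝓝[I] t ∧ L.IsRealizer c a b

/-- Past directed geodesics: those that become future directed geodesics under `t ↦ -t`. -/
def IsPastGeodesic (c : ℝ → X) (I : Set ℝ) : Prop :=
  L.IsFutureGeodesic (fun t => c (-t)) {t | -t ∈ I}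

/-- Every causal geodesic on a compact interval extends to a causal geodesic on an open interval
around it. (For past directed geodesics this follows by parameter reversal.) -/
def GeodesicProlongation : Prop :=
  ∀ (b d : ℝ) (c : ℝ → X), b < d → L.IsFutureGeodesic c (Icc b d) →
    ∃ (a e : ℝ) (c₁ : ℝ → X), a < b ∧ d < e ∧ L.IsFutureGeodesic c₁ (Ioo a e) ∧
      EqOn c₁ c (Icc b d)

/-! ### Timelike curvature bounded below -/

/-- Any two timelike related points of the open set `U` are joined by a distance realizer in `U`,
and all such realizers are timelike. -/
def StrictlyTimelikeGeodesicallyConnected (U : Set X) : Prop :=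
  ∀ p ∈ U, ∀ q ∈ U, L.chron p q →
    (∃ (a b : ℝ) (c : ℝ → X), a < b ∧ L.IsRealizer c a b ∧ MapsTo c (Icc a b) U ∧
      c a = p ∧ c b = q) ∧
    ∀ (a b : ℝ) (c : ℝ → X), a < b → L.IsRealizer c a b → MapsTo c (Icc a b) U →
      c a = p → c b = q → L.IsFutureTimelike c (Icc a b)

/-- A timelike geodesic triangle in `U` with vertices `p 0`, `p 1`, `p 2` in this causal order; the
side from `p i` to `p j` is `side i j`, for `i < j`, parametrized on `[0, 1]`. -/
def IsTimelikeTriangle (U : Set X) (p : Fin 3 → X) (side : Fin 3 → Fin 3 → ℝ → X) : Prop :=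
  ∀ i j, i < j → L.chron (p i) (p j) ∧ L.tau (p i) (p j) < ⊤ ∧
    L.IsRealizer (side i j) 0 1 ∧ side i j 0 = p i ∧ side i j 1 = p j ∧
    MapsTo (side i j) (Icc 0 1) U

/-- `m` is the vertex triple of a comparison triangle of `p` in the plane of curvature `K`. -/
def IsComparisonTriangle (K : ℝ) (p : Fin 3 → X) (m : Fin 3 → ℝ × ℝ) : Prop :=
  ∀ i j, i < j → KPlane.tau K (m i) (m j) = L.tau (p i) (p j)

/-- `n` is a point of the segment from `a` to `b` in the plane of curvature `K` that corresponds to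
the point `q` of a side from `p` to `r`: it lies causally between `a` and `b`, and has the same time
separations to the endpoints as `q`. -/
def IsComparisonPoint (K : ℝ) (p r q : X) (a b n : ℝ × ℝ) : Prop :=
  KPlane.Causal K a n ∧ KPlane.Causal K n b ∧
    KPlane.tau K a n = L.tau p q ∧ KPlane.tau K n b = L.tau q r

/-- Timelike comparison neighbourhoods for the lower curvature bound `K`. -/
def IsLowerComparisonNhd (K : ℝ) (U : Set X) : Prop :=
  IsOpen U ∧ (∀ p ∈ U, ∀ q ∈ U, L.tau p q < ⊤) ∧
  ContinuousOn (fun z : X × X => L.tau z.1 z.2) (U ×ˢ U) ∧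
  L.StrictlyTimelikeGeodesicallyConnected U ∧
  ∀ (p : Fin 3 → X) (side : Fin 3 → Fin 3 → ℝ → X), L.IsTimelikeTriangle U p side →
    L.tau (p 0) (p 2) < KPlane.diam K →
    ∀ m : Fin 3 → ℝ × ℝ, L.IsComparisonTriangle K p m →
    ∀ i j k l : Fin 3, i < j → k < l →
    ∀ q₁ ∈ side i j '' Icc 0 1, ∀ q₂ ∈ side k l '' Icc 0 1, ∀ n₁ n₂ : ℝ × ℝ,
      L.IsComparisonPoint K (p i) (p j) q₁ (m i) (m j) n₁ →
      L.IsComparisonPoint K (p k) (p l) q₂ (m k) (m l) n₂ →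
      L.tau q₁ q₂ ≤ KPlane.tau K n₁ n₂

/-- Timelike curvature bounded below, by some real number `K`. -/
def TimelikeCurvatureBoundedBelow : Prop :=
  ∃ K : ℝ, ∀ x, ∃ U, x ∈ U ∧ L.IsLowerComparisonNhd K U

/-! ### Angles -/

/-- The causal relation of `p` and `q` in `X` is reflected by `a` and `b` in the Minkowski plane,
with equal time separation. -/
def Corresponds (p q : X) (a b : ℝ × ℝ) : Prop :=
  L.causal p q → KPlane.Causal 0 a b ∧ KPlane.tau 0 a b = L.tau p q

/-- `ω` is the angle at the vertex corresponding to `x` in some comparison triangle in the Minkowski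
plane of the causal triangle with vertices `x`, `y`, `z`, in whichever causal order these are. -/
def IsComparisonAngle (x y z : X) (ω : ℝ) : Prop :=
  ∃ a b c : ℝ × ℝ, L.Corresponds x y a b ∧ L.Corresponds y x b a ∧
    L.Corresponds x z a c ∧ L.Corresponds z x c a ∧
    L.Corresponds y z b c ∧ L.Corresponds z y c b ∧ ω = KPlane.flatAngle a b c

open Classical in
/-- The comparison angle at `x` between `y` and `z`. It does not depend on the comparison
triangle. -/
def comparisonAngle (x y z : X) : ℝ :=
  if h : ∃ ω, L.IsComparisonAngle x y z ω then h.choose else 0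

/-- The parameters `(s, t)` at which the comparison angle of `α s` and `β t` at `x` is defined:
`α s` and `β t` are causally related, and the time separations in the triangle are finite. -/
def angleDomain (x : X) (α β : ℝ → X) : Set (ℝ × ℝ) :=
  {z | (L.causal (α z.1) (β z.2) ∨ L.causal (β z.2) (α z.1)) ∧
    ∀ p ∈ ({x, α z.1, β z.2} : Set X), ∀ q ∈ ({x, α z.1, β z.2} : Set X), L.tau p q < ⊤}

/-- The filter of parameters `(s, t)` in the domain of the comparison angle with `s, t ↘ 0`. -/
def angleFilter (x : X) (α β : ℝ → X) : Filter (ℝ × ℝ) :=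
  (𝓝[>] (0 : ℝ) ×ˢ 𝓝[>] (0 : ℝ)) ⊓ 𝓟 (L.angleDomain x α β)

/-- The upper angle at `x` between the curves `α` and `β`, a number in `[0, ∞]`. -/
def upperAngle (x : X) (α β : ℝ → X) : ℝ≥0∞ :=
  limsup (fun z : ℝ × ℝ => ENNReal.ofReal (L.comparisonAngle x (α z.1) (β z.2)))
    (L.angleFilter x α β)

/-- The angle between `α` and `β` at `x` exists: the comparison angles have a finite limit. -/
def AngleExists (x : X) (α β : ℝ → X) : Prop :=
  ∃ ω : ℝ, Tendsto (fun z : ℝ × ℝ => L.comparisonAngle x (α z.1) (β z.2))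
    (L.angleFilter x α β) (𝓝 ω)

end LorentzianPreLengthSpace

end

/-! Both parts are proved by contradiction, by comparison with the Minkowski plane. If the
inequality fails, there are φ and ψ above the two angles on the right and a slack e > 0 such that φ
+ ψ + 2e is still below the angle on the left. By the law of cosines, a bound for a comparison angle
is a bound for a squared time separation. These bounds are tested on points whose planar models are
collinear, where the reverse triangle inequality is sharp.

In part (i) the points α s, β r, γ t are taken at distances A, AR, AM from x for which the planar
model of α s is the midpoint of the other two (`exists_collinear_of_past`). With d the planar
half-length, the angle bounds give τ(γ t, α s) > d, τ(α s, β r) ≥ d and τ(γ t, β r) ≤ 2d, which is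
impossible. The pair (s, t) is prescribed here, so the lower angle bound is needed at all small
parameters; this is the role of the existence of the angle.

In part (ii) the geodesic β is prolonged beyond x to a realizer c, whose future half serves as a
curve between α and γ. Under the lower curvature bound its angle with α exceeds the angle of β with
α by at most e, and likewise for γ (`exists_hinge_bound`). Indeed, in a comparison triangle over a
segment of c through x, the point corresponding to x is at least as far from the third vertex as x
is, and Stewart's theorem turns this into an inequality between the two hinges at x. In the plane of
curvature K Stewart's theorem becomes the flat one up to a factor 1 + ε at small scales
(`hingeComparison`). This rests on explicit time separations: calibrations bound them above,
explicit geodesics below, and dilations reduce to K = -1, 0, 1. Finally the planar segment between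
the models of α s and γ t crosses the middle ray (`exists_collinear_of_future`), and the point of c
at that distance from x shows that α s and γ t are as far apart as an angle φ + ψ + 2e requires
(`IsSmall.le_sq_of_hinges`). Any pair (s, t) will do, so a limit superior suffices.

A comparison angle gives no information on points that are not causally related. That the relevant
points are timelike related comes from `le_sq_of_continuousOn_hinge`: moving away from x along a
curve, the time separation to a fixed point starts positive and, while positive, stays above a
positive constant, so by continuity it never vanishes. -/

namespace KPlane

/-! ### Causal curves in the Lorentzian planes -/

theorem metric_smul (K a : ℝ) (p v : ℝ × ℝ) :
    metric K p (a • v) (a • v) = a ^ 2 * metric K p v v := by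
  simp only [metric, Prod.smul_fst, Prod.smul_snd, smul_eq_mul]; ring

/-- Dilations multiply the curvature by a square. Hence explicit computations are needed for the
curvatures `-1`, `0` and `1` only. -/
theorem metric_scale (K : ℝ) {k : ℝ} (hk : 0 ≤ k) (p v w : ℝ × ℝ) :
    metric (k ^ 2 * K) p v w = metric K (k • p) v w := by
  have h1 : √(k ^ 2 * K) = k * √K := by
    rw [Real.sqrt_mul (sq_nonneg k), Real.sqrt_sq hk]
  have h2 : √(-(k ^ 2 * K)) = k * √(-K) := by
    rw [← mul_neg, Real.sqrt_mul (sq_nonneg k), Real.sqrt_sq hk]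
  simp only [metric, Prod.smul_fst, Prod.smul_snd, smul_eq_mul, h1, h2]
  ring_nf

theorem metric_neg (K : ℝ) (p v w : ℝ × ℝ) : metric K (-p) v w = metric K p v w := by
  simp [metric]

section Curve

variable {K : ℝ} {c : ℝ → ℝ × ℝ} {p q : ℝ × ℝ}

theorem IsCausalCurve.hasDerivAt (h : IsCausalCurve K c p q) (u : ℝ) :
    HasDerivAt c (deriv c u) u :=
  (h.1.differentiable one_ne_zero u).hasDerivAt

theorem IsCausalCurve.hasDerivAt_fst (h : IsCausalCurve K c p q) (u : ℝ) :
    HasDerivAt (fun u => (c u).1) (deriv c u).1 u :=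
  (hasFDerivAt_fst (𝕜 := ℝ) (p := c u)).comp_hasDerivAt u (h.hasDerivAt u)

theorem IsCausalCurve.hasDerivAt_snd (h : IsCausalCurve K c p q) (u : ℝ) :
    HasDerivAt (fun u => (c u).2) (deriv c u).2 u :=
  (hasFDerivAt_snd (𝕜 := ℝ) (p := c u)).comp_hasDerivAt u (h.hasDerivAt u)

theorem IsCausalCurve.continuous_speed (h : IsCausalCurve K c p q) :
    Continuous fun u => √(-metric K (c u) (deriv c u) (deriv c u)) := by
  have h1 := h.1.continuous
  have h2 := h.1.continuous_deriv le_rfl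
  unfold metric
  fun_prop

/-- Calibration: a function that grows along the curve at least as fast as proper time bounds the
length. The upper bounds for the model time separations all arise this way. -/
theorem IsCausalCurve.length_le (h : IsCausalCurve K c p q) {g g' : ℝ → ℝ}
    (hg : ∀ u ∈ Icc (0 : ℝ) 1, HasDerivAt g (g' u) u)
    (hle : ∀ u ∈ Icc (0 : ℝ) 1, √(-metric K (c u) (deriv c u) (deriv c u)) ≤ g' u) :
    length K c ≤ g 1 - g 0 := by
  apply intervalIntegral.integral_le_sub_of_hasDeriv_right_of_le zero_le_one
    (fun u hu => (hg u hu).continuousAt.continuousWithinAt)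
    (fun u hu => (hg u (Ioo_subset_Icc_self hu)).hasDerivWithinAt)
    h.continuous_speed.continuousOn.integrableOn_Icc
    (fun u hu => hle u (Ioo_subset_Icc_self hu))

/-- A function whose derivative along a causal curve is nonnegative increases along it. -/
theorem monotoneOn_unitInterval {g g' : ℝ → ℝ}
    (hg : ∀ u ∈ Icc (0 : ℝ) 1, HasDerivAt g (g' u) u)
    (hle : ∀ u ∈ Icc (0 : ℝ) 1, 0 ≤ g' u) : MonotoneOn g (Icc 0 1) := by
  apply monotoneOn_of_deriv_nonneg (convex_Icc 0 1)
    (fun u hu => (hg u hu).continuousAt.continuousWithinAt)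
  · intro u hu
    exact (hg u (interior_subset hu)).differentiableAt.differentiableWithinAt
  · intro u hu
    rw [(hg u (interior_subset hu)).deriv]
    exact hle u (interior_subset hu)

theorem IsCausalCurve.monotoneOn_fst (h : IsCausalCurve K c p q) :
    MonotoneOn (fun u => (c u).1) (Icc 0 1) :=
  monotoneOn_unitInterval (fun u _ => h.hasDerivAt_fst u) fun u hu => (h.2.2.2 u hu).1.le

theorem IsCausalCurve.fst_lt (h : IsCausalCurve K c p q) : p.1 < q.1 := by
  have : StrictMonoOn (fun u => (c u).1) (Icc (0 : ℝ) 1) := by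
    apply strictMonoOn_of_deriv_pos (convex_Icc 0 1)
      (fun u _ => (h.hasDerivAt_fst u).continuousAt.continuousWithinAt)
    intro u hu
    rw [(h.hasDerivAt_fst u).deriv]
    exact (h.2.2.2 u (interior_subset hu)).1
  have := this (by simp) (by simp) (zero_lt_one (α := ℝ))
  simpa [h.2.1, h.2.2.1] using this

theorem tau_le {B : ℝ} (h : ∀ c, IsCausalCurve K c p q → length K c ≤ B) :
    tau K p q ≤ ENNReal.ofReal B :=
  iSup₂_le fun c hc => ENNReal.ofReal_le_ofReal (h c hc)

theorem IsCausalCurve.le_tau (h : IsCausalCurve K c p q) :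
    ENNReal.ofReal (length K c) ≤ tau K p q :=
  le_iSup₂ (f := fun c (_ : IsCausalCurve K c p q) => ENNReal.ofReal (length K c)) c h

theorem tau_self (K : ℝ) (p : ℝ × ℝ) : tau K p p = 0 := by
  apply le_antisymm _ bot_le
  exact iSup₂_le fun c hc => absurd hc.fst_lt (lt_irrefl _)

theorem IsCausalCurve.scale (h : IsCausalCurve K c p q) {k J : ℝ} (hk : 0 < k)
    (hJ : K = k ^ 2 * J) : IsCausalCurve J (fun u => k • c u) (k • p) (k • q) ∧
      length J (fun u => k • c u) = k * length K c := by
  have hd : ∀ u, deriv (fun u => k • c u) u = k • deriv c u := fun u =>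
    ((h.hasDerivAt u).const_smul k).deriv
  have hm : ∀ u, metric J (k • c u) (k • deriv c u) (k • deriv c u) =
      k ^ 2 * metric K (c u) (deriv c u) (deriv c u) := fun u => by
    rw [metric_smul, hJ, metric_scale _ hk.le]
  refine ⟨⟨h.1.const_smul k, by simp [h.2.1], by simp [h.2.2.1], fun u hu => ?_⟩, ?_⟩
  · have := h.2.2.2 u hu
    rw [hd, hm]
    exact ⟨mul_pos hk this.1, mul_nonpos_of_nonneg_of_nonpos (by positivity) this.2⟩
  · simp only [length, hd, hm, ← mul_neg, Real.sqrt_mul (sq_nonneg k), Real.sqrt_sq hk.le,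
      intervalIntegral.integral_const_mul]

theorem IsCausalCurve.reflect (h : IsCausalCurve K c p q) :
    IsCausalCurve K (fun u => -c (1 - u)) (-q) (-p) ∧
      length K (fun u => -c (1 - u)) = length K c := by
  have hd : ∀ u, deriv (fun u => -c (1 - u)) u = deriv c (1 - u) := fun u => by
    have h1 : HasDerivAt (fun u : ℝ => 1 - u) (-1) u := by
      simpa using (hasDerivAt_id u).const_sub 1
    have := ((h.hasDerivAt (1 - u)).scomp u h1).fun_neg
    simpa using this.deriv
  refine ⟨⟨(h.1.comp (contDiff_const.sub contDiff_id)).neg, by simp [h.2.2.1], by simp [h.2.1],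
    fun u hu => ?_⟩, ?_⟩
  · rw [hd, metric_neg]
    exact h.2.2.2 (1 - u) ⟨by linarith [hu.2], by linarith [hu.1]⟩
  · simp only [length, hd, metric_neg]
    have := intervalIntegral.integral_comp_sub_left
      (fun u => √(-metric K (c u) (deriv c u) (deriv c u))) (a := 0) (b := 1) (1 : ℝ)
    simpa using this

end Curve

theorem tau_scale_le {K J k : ℝ} (hk : 0 < k) (hJ : K = k ^ 2 * J) (p q : ℝ × ℝ) :
    ENNReal.ofReal k * tau K p q ≤ tau J (k • p) (k • q) := by
  simp only [tau, ENNReal.mul_iSup]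
  refine iSup₂_le fun c hc => ?_
  obtain ⟨h1, h2⟩ := hc.scale hk hJ
  have := h1.le_tau
  rwa [h2, ENNReal.ofReal_mul hk.le] at this

theorem tau_scale {K J k : ℝ} (hk : 0 < k) (hJ : K = k ^ 2 * J) (p q : ℝ × ℝ) :
    tau J (k • p) (k • q) = ENNReal.ofReal k * tau K p q := by
  apply le_antisymm _ (tau_scale_le hk hJ p q)
  have h := tau_scale_le (K := J) (J := K) (inv_pos.2 hk) (by rw [hJ]; field_simp)
    (k • p) (k • q)
  rw [inv_smul_smul₀ hk.ne', inv_smul_smul₀ hk.ne'] at h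
  calc _ = ENNReal.ofReal k * (ENNReal.ofReal k⁻¹ * tau J (k • p) (k • q)) := by
        rw [← mul_assoc, ← ENNReal.ofReal_mul hk.le, mul_inv_cancel₀ hk.ne']; simp
    _ ≤ _ := by gcongr

theorem tau_neg_le (K : ℝ) (p q : ℝ × ℝ) : tau K p q ≤ tau K (-q) (-p) := by
  refine iSup₂_le fun c hc => ?_
  obtain ⟨h1, h2⟩ := hc.reflect
  exact h2 ▸ h1.le_tau

/-- The formulas for curvature `-1` and `1` have their first point on the time axis. The point
reflection reverses time, so it covers a second point on the axis as well. -/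
theorem tau_neg (K : ℝ) (p q : ℝ × ℝ) : tau K (-q) (-p) = tau K p q := by
  apply le_antisymm _ (tau_neg_le K p q)
  simpa using tau_neg_le K (-q) (-p)

/-- The graph of a function `ξ` of the time coordinate, as a causal curve, bounds the time
separation of its endpoints below. -/
theorem graph_le_tau {K a b : ℝ} (hab : a < b) {ξ ξ' g g' : ℝ → ℝ}
    (hξ : ∀ t, HasDerivAt ξ (ξ' t) t) (hξ' : Continuous ξ')
    (hg : ∀ t ∈ Icc a b, HasDerivAt g (g' t) t) (hg0 : ∀ t ∈ Icc a b, 0 ≤ g' t)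
    (hm : ∀ t ∈ Icc a b, metric K (t, ξ t) (1, ξ' t) (1, ξ' t) = -(g' t) ^ 2) :
    Causal K (a, ξ a) (b, ξ b) ∧
      ENNReal.ofReal (g b - g a) ≤ tau K (a, ξ a) (b, ξ b) := by
  set σ : ℝ → ℝ := fun u => a + (b - a) * u with hσ
  have hσd : ∀ u, HasDerivAt σ (b - a) u := fun u => by
    have := ((hasDerivAt_id' u).const_mul (b - a)).const_add a
    rwa [mul_one] at this
  have hσI : ∀ u ∈ Icc (0 : ℝ) 1, σ u ∈ Icc a b := fun u hu => by
    constructor <;> simp only [hσ] <;> nlinarith [hu.1, hu.2]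
  set c : ℝ → ℝ × ℝ := fun u => (σ u, ξ (σ u)) with hc
  have hcd : ∀ u, HasDerivAt c ((b - a) • ((1 : ℝ), ξ' (σ u))) u := fun u => by
    have := (hσd u).prodMk ((hξ (σ u)).comp u (hσd u))
    convert! this using 1
    ext <;> simp [mul_comm]
  have hderiv : ∀ u, deriv c u = (b - a) • ((1 : ℝ), ξ' (σ u)) := fun u => (hcd u).deriv
  have hcurve : IsCausalCurve K c (a, ξ a) (b, ξ b) := by
    refine ⟨contDiff_one_iff_deriv.2 ⟨fun u => (hcd u).differentiableAt, ?_⟩, by simp [hc, hσ],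
      by simp [hc, hσ], fun u hu => ?_⟩
    · have : deriv c = fun u => (b - a) • ((1 : ℝ), ξ' (σ u)) := funext hderiv
      rw [this]
      have : Continuous σ := by fun_prop
      fun_prop
    · rw [hderiv, metric_smul, hm _ (hσI u hu)]
      refine ⟨by simpa using hab, ?_⟩
      have : 0 ≤ (b - a) ^ 2 * g' (σ u) ^ 2 := by positivity
      linarith
  refine ⟨Or.inr ⟨c, hcurve⟩, ?_⟩
  have hlen : length K c = g b - g a := by
    have h1 : ∀ u ∈ Icc (0 : ℝ) 1, √(-metric K (c u) (deriv c u) (deriv c u)) =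
        (b - a) * g' (σ u) := fun u hu => by
      rw [hderiv, metric_smul, hm _ (hσI u hu), mul_neg, neg_neg, ← mul_pow, Real.sqrt_sq]
      exact mul_nonneg (by linarith) (hg0 _ (hσI u hu))
    have h2 : ∀ u ∈ Icc (0 : ℝ) 1, HasDerivAt (fun u => g (σ u)) ((b - a) * g' (σ u)) u :=
      fun u hu => by
        rw [mul_comm]; exact (hg _ (hσI u hu)).comp u (hσd u)
    rw [length, intervalIntegral.integral_congr (g := fun u => (b - a) * g' (σ u))]
    · rw [intervalIntegral.integral_eq_sub_of_hasDerivAt (f := fun u => g (σ u))]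
      · simp [hσ]
      · rwa [uIcc_of_le zero_le_one]
      · apply (hcurve.continuous_speed.intervalIntegrable 0 1).congr
        intro u hu
        rw [uIoc_of_le zero_le_one] at hu
        exact h1 u (Ioc_subset_Icc_self hu)
    · rw [uIcc_of_le zero_le_one]; exact h1
  rw [← hlen]
  exact hcurve.le_tau

/-- The reversed Cauchy-Schwarz inequality. -/
theorem sqrt_mul_sqrt_le_of_abs_le {P Q a b : ℝ} (h1 : |Q| ≤ P) (h2 : |b| ≤ a) :
    √(P ^ 2 - Q ^ 2) * √(a ^ 2 - b ^ 2) ≤ P * a + Q * b := by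
  have hP := (abs_nonneg Q).trans h1
  have ha := (abs_nonneg b).trans h2
  rw [← Real.sqrt_mul (by nlinarith [abs_le.1 h1])]
  apply Real.sqrt_le_iff.2
  constructor
  · have := mul_le_mul h1 h2 (abs_nonneg _) hP
    rw [← abs_mul] at this
    linarith [neg_abs_le (Q * b)]
  · nlinarith [sq_nonneg (P * b + Q * a)]

/-! ### The Minkowski plane -/

theorem metric_zero (p v w : ℝ × ℝ) : metric 0 p v w = -(v.1 * w.1) + v.2 * w.2 := by
  simp [metric]

theorem IsCausalCurve.abs_snd_le_fst_of_flat {c : ℝ → ℝ × ℝ} {p q : ℝ × ℝ}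
    (h : IsCausalCurve 0 c p q) {u : ℝ} (hu : u ∈ Icc (0 : ℝ) 1) :
    |(deriv c u).2| ≤ (deriv c u).1 := by
  have := h.2.2.2 u hu
  rw [metric_zero] at this
  apply abs_le_of_sq_le_sq _ this.1.le
  nlinarith [this.2]

theorem Causal.abs_sub_le {p q : ℝ × ℝ} (h : Causal 0 p q) : |q.2 - p.2| ≤ q.1 - p.1 := by
  obtain rfl | ⟨c, hc⟩ := h
  · simp
  · have h1 := monotoneOn_unitInterval
      (fun u _ => (hc.hasDerivAt_fst u).sub (hc.hasDerivAt_snd u))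
      (fun u hu => by linarith [(abs_le.1 (hc.abs_snd_le_fst_of_flat hu)).2])
    have h2 := monotoneOn_unitInterval
      (fun u _ => (hc.hasDerivAt_fst u).add (hc.hasDerivAt_snd u))
      (fun u hu => by linarith [(abs_le.1 (hc.abs_snd_le_fst_of_flat hu)).1])
    have h1 := h1 (left_mem_Icc.2 zero_le_one) (right_mem_Icc.2 zero_le_one) zero_le_one
    have h2 := h2 (left_mem_Icc.2 zero_le_one) (right_mem_Icc.2 zero_le_one) zero_le_one
    simp only [Pi.sub_apply, Pi.add_apply, hc.2.1, hc.2.2.1] at h1 h2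
    rw [abs_le]; constructor <;> linarith

/-- The time separation of the Minkowski plane. -/
theorem tau_zero_le (p q : ℝ × ℝ) :
    tau 0 p q ≤ ENNReal.ofReal √((q.1 - p.1) ^ 2 - (q.2 - p.2) ^ 2) := by
  apply tau_le
  intro c hc
  have hcone := abs_le.1 (Causal.abs_sub_le (Or.inr ⟨c, hc⟩))
  have hlt := hc.fst_lt
  -- The calibration is, up to sign, the Minkowski product with the unit vector in the direction
  -- `(T, X)`. The shift by `ε` keeps this direction timelike even if `q - p` is null.
  have key : ∀ ε > 0, length 0 c ≤ √((q.1 - p.1 + ε) ^ 2 - (q.2 - p.2) ^ 2) := by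
    intro ε hε
    set T := q.1 - p.1 + ε
    set X := q.2 - p.2
    have hTX : |X| ≤ T := by rw [abs_le]; constructor <;> linarith [hcone.1, hcone.2]
    have hD : 0 < T ^ 2 - X ^ 2 := by
      have h1 : 0 < T - X := by linarith [hcone.2]
      have h2 : 0 < T + X := by linarith [hcone.1]
      nlinarith
    set D := √(T ^ 2 - X ^ 2)
    have hDp : 0 < D := Real.sqrt_pos.2 hD
    have hD2 : D ^ 2 = T ^ 2 - X ^ 2 := Real.sq_sqrt hD.le
    have := hc.length_le (g := fun u => (T * (c u).1 - X * (c u).2) / D)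
      (g' := fun u => (T * (deriv c u).1 - X * (deriv c u).2) / D)
      (fun u _ => (((hc.hasDerivAt_fst u).const_mul T).sub
        ((hc.hasDerivAt_snd u).const_mul X)).div_const D)
      (fun u hu => by
        rw [le_div_iff₀ hDp, metric_zero]
        have := sqrt_mul_sqrt_le_of_abs_le (P := T) (Q := -X) (by rwa [abs_neg])
          (hc.abs_snd_le_fst_of_flat hu)
        rw [neg_sq] at this
        calc _ = D * √((deriv c u).1 ^ 2 - (deriv c u).2 ^ 2) := by ring_nf
          _ ≤ _ := this
          _ = _ := by ring)
    refine this.trans ?_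
    simp only [hc.2.1, hc.2.2.1]
    rw [← sub_div, div_le_iff₀ hDp, ← sq, hD2]
    nlinarith [(abs_nonneg X).trans hTX]
  refine ge_of_tendsto (f := fun ε : ℝ => √((q.1 - p.1 + ε) ^ 2 - (q.2 - p.2) ^ 2))
    (x := 𝓝[>] (0 : ℝ)) ?_ (eventually_nhdsWithin_of_forall key)
  have : Continuous fun ε : ℝ => √((q.1 - p.1 + ε) ^ 2 - (q.2 - p.2) ^ 2) := by fun_prop
  simpa using (this.tendsto 0).mono_left nhdsWithin_le_nhds

theorem causal_zero_and_tau_zero {p q : ℝ × ℝ} (h : |q.2 - p.2| ≤ q.1 - p.1) :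
    Causal 0 p q ∧ tau 0 p q = ENNReal.ofReal √((q.1 - p.1) ^ 2 - (q.2 - p.2) ^ 2) := by
  rcases ((abs_nonneg _).trans h).eq_or_lt with h0 | h0
  · have h2 : q.2 - p.2 = 0 := abs_eq_zero.1 (le_antisymm (h0 ▸ h) (abs_nonneg _))
    have : p = q := Prod.ext (by linarith) (by linarith)
    subst this
    exact ⟨Or.inl rfl, by simp [tau_self]⟩
  · set T := q.1 - p.1
    set X := q.2 - p.2
    set D := √(T ^ 2 - X ^ 2)
    have hD2 : D ^ 2 = T ^ 2 - X ^ 2 := Real.sq_sqrt (by nlinarith [abs_le.1 h])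
    have hpq : p.1 < q.1 := by linarith
    have := graph_le_tau (K := 0) hpq (ξ := fun t => p.2 + X / T * (t - p.1))
      (ξ' := fun _ => X / T) (g := fun t => D / T * t) (g' := fun _ => D / T)
      (fun t => by simpa using (((hasDerivAt_id t).sub_const p.1).const_mul (X / T)).const_add p.2)
      continuous_const (fun t _ => by simpa using (hasDerivAt_id t).const_mul (D / T))
      (fun t _ => div_nonneg (Real.sqrt_nonneg _) h0.le)
      (fun t _ => by
        rw [metric_zero, div_pow, hD2]; field_simp; ring)
    have e1 : p.2 + X / T * (p.1 - p.1) = p.2 := by simp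
    have e2 : p.2 + X / T * (q.1 - p.1) = q.2 := by
      change p.2 + X / T * T = q.2
      rw [div_mul_cancel₀ _ h0.ne']; simp [X]
    have e3 : D / T * q.1 - D / T * p.1 = D := by
      rw [← mul_sub]; exact div_mul_cancel₀ _ h0.ne'
    rw [e1, e2, e3] at this
    exact ⟨this.1, le_antisymm (tau_zero_le p q) this.2⟩

end KPlane

namespace KPlane

/-! ### The anti-de Sitter plane -/

theorem metric_negOne (p v w : ℝ × ℝ) :
    metric (-1) p v w = -(Real.cosh p.2 ^ 2 * (v.1 * w.1)) + v.2 * w.2 := by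
  have : √(-1 : ℝ) = 0 := Real.sqrt_eq_zero_of_nonpos (by norm_num)
  simp [metric, this]

theorem hasDerivAt_artanh {y : ℝ} (hy : y ∈ Ioo (-1 : ℝ) 1) :
    HasDerivAt Real.artanh (1 / (1 - y ^ 2)) y := by
  have h1 : 0 < 1 + y := by linarith [hy.1]
  have h2 : 0 < 1 - y := by linarith [hy.2]
  have hd : HasDerivAt (fun y : ℝ => 1 / 2 * (Real.log (1 + y) - Real.log (1 - y)))
      (1 / 2 * (1 / (1 + y) - -1 / (1 - y))) y :=
    ((((hasDerivAt_id' y).const_add 1).log h1.ne').sub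
      (((hasDerivAt_id' y).const_sub 1).log h2.ne')).const_mul _
  have he : Real.artanh =ᶠ[𝓝 y] fun y : ℝ => 1 / 2 * (Real.log (1 + y) - Real.log (1 - y)) := by
    filter_upwards [isOpen_Ioo.mem_nhds hy] with z hz
    rw [Real.artanh_eq_half_log (Ioo_subset_Icc_self hz),
      Real.log_div (by linarith [hz.1]) (by linarith [hz.2])]
  convert! hd.congr_of_eventuallyEq he using 1
  have : 1 - y ^ 2 = (1 + y) * (1 - y) := by ring
  rw [this]; field_simp; ring

/-- The coordinate `arctan (sinh x)` makes the metric conformal to the flat one. Its sum with and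
difference from the time coordinate are the null coordinates, nondecreasing along causal curves. -/
theorem IsCausalCurve.abs_arctan_sinh_le {c : ℝ → ℝ × ℝ} {p q : ℝ × ℝ}
    (h : IsCausalCurve (-1) c p q) (hp : p.2 = 0) {u : ℝ} (hu : u ∈ Icc (0 : ℝ) 1) :
    |(deriv c u).2| ≤ Real.cosh (c u).2 * (deriv c u).1 ∧
      |Real.arctan (Real.sinh (c u).2)| ≤ (c u).1 - p.1 := by
  have hcone : ∀ u ∈ Icc (0 : ℝ) 1, |(deriv c u).2| ≤ Real.cosh (c u).2 * (deriv c u).1 := by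
    intro u hu
    have := h.2.2.2 u hu
    rw [metric_negOne] at this
    apply abs_le_of_sq_le_sq _ (mul_nonneg (Real.cosh_pos _).le this.1.le)
    nlinarith [this.2]
  refine ⟨hcone u hu, ?_⟩
  have hd : ∀ u, HasDerivAt (fun u => Real.arctan (Real.sinh (c u).2))
      ((deriv c u).2 / Real.cosh (c u).2) u := fun u => by
    convert! ((h.hasDerivAt_snd u).sinh).arctan using 1
    rw [← Real.cosh_sq']
    have := Real.cosh_pos (c u).2
    field_simp
  have hb : ∀ u ∈ Icc (0 : ℝ) 1, |(deriv c u).2 / Real.cosh (c u).2| ≤ (deriv c u).1 := by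
    intro u hu
    rw [abs_div, abs_of_pos (Real.cosh_pos _), div_le_iff₀ (Real.cosh_pos _), mul_comm]
    exact hcone u hu
  have h1 := monotoneOn_unitInterval (fun u _ => (h.hasDerivAt_fst u).sub (hd u))
    (fun u hu => by linarith [(abs_le.1 (hb u hu)).2]) (left_mem_Icc.2 zero_le_one) hu hu.1
  have h2 := monotoneOn_unitInterval (fun u _ => (h.hasDerivAt_fst u).add (hd u))
    (fun u hu => by linarith [(abs_le.1 (hb u hu)).1]) (left_mem_Icc.2 zero_le_one) hu hu.1
  simp only [Pi.sub_apply, Pi.add_apply, h.2.1, hp, Real.sinh_zero, Real.arctan_zero] at h1 h2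
  rw [abs_le]; constructor <;> linarith

/-- In the quadric model with points `(cosh x cos t, cosh x sin t, sinh x)`, the function `cosh x *
cos (t - u)` is the product with the base point, and its `arccos` is a calibration. Moving the base
point into the past by `ε` puts the whole curve strictly inside its timelike future, where `arccos`
is differentiable. -/
theorem tau_negOne_le {u T X : ℝ} (hT : T - u < Real.pi / 2) :
    tau (-1) (u, 0) (T, X) ≤ ENNReal.ofReal (Real.arccos (Real.cosh X * Real.cos (T - u))) := by
  apply tau_le
  intro c hc
  have key : ∀ ε ∈ Ioo 0 (Real.pi / 2 - (T - u)),
      length (-1) c ≤ Real.arccos (Real.cosh X * Real.cos (T - u + ε)) := by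
    intro ε hε
    set F : ℝ → ℝ := fun v => Real.cosh (c v).2 * Real.cos ((c v).1 - u + ε) with hF
    set F' : ℝ → ℝ := fun v => Real.sinh (c v).2 * (deriv c v).2 * Real.cos ((c v).1 - u + ε) +
      Real.cosh (c v).2 * (-Real.sin ((c v).1 - u + ε) * (deriv c v).1) with hF'
    have hFd : ∀ v, HasDerivAt F (F' v) v := fun v =>
      (hc.hasDerivAt_snd v).cosh.mul (((hc.hasDerivAt_fst v).sub_const u).add_const ε).cos
    have hth : ∀ v ∈ Icc (0 : ℝ) 1, (c v).1 - u + ε ∈ Ioo 0 (Real.pi / 2) := fun v hv => by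
      have h1 := hc.monotoneOn_fst (left_mem_Icc.2 zero_le_one) hv hv.1
      have h2 := hc.monotoneOn_fst hv (right_mem_Icc.2 zero_le_one) hv.2
      simp only [hc.2.1, hc.2.2.1] at h1 h2
      constructor <;> linarith [hε.1, hε.2]
    -- The conformal cone bound after taking tangents; it is strict because of the shift by `ε`.
    have hsin : ∀ v ∈ Icc (0 : ℝ) 1,
        |Real.sinh (c v).2| * Real.cos ((c v).1 - u + ε) < Real.sin ((c v).1 - u + ε) := by
      intro v hv
      have hv' := hth v hv
      have hcos := Real.cos_pos_of_mem_Ioo ⟨by linarith [hv'.1, Real.pi_pos], hv'.2⟩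
      rw [← lt_div_iff₀ hcos, ← Real.tan_eq_sin_div_cos]
      have h1 := (hc.abs_arctan_sinh_le rfl hv).2
      have h2 := hε.1
      have h3 : ∀ y, |Real.arctan y| ≤ (c v).1 - u →
          y < Real.tan ((c v).1 - u + ε) := fun y hy => by
        rw [← Real.tan_arctan y]
        exact Real.tan_lt_tan_of_lt_of_lt_pi_div_two (Real.neg_pi_div_two_lt_arctan _) hv'.2
          (by linarith [le_abs_self (Real.arctan y)])
      rcases abs_cases (Real.sinh (c v).2) with ⟨h, _⟩ | ⟨h, _⟩ <;> rw [h]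
      · exact h3 _ h1
      · exact h3 _ (by rwa [Real.arctan_neg, abs_neg])
    have hF1 : ∀ v ∈ Icc (0 : ℝ) 1, 0 < F v ∧ 1 - F v ^ 2 =
        Real.sin ((c v).1 - u + ε) ^ 2 -
          (Real.sinh (c v).2 * Real.cos ((c v).1 - u + ε)) ^ 2 := fun v hv => by
      have hv' := hth v hv
      have hcos := Real.cos_pos_of_mem_Ioo ⟨by linarith [hv'.1, Real.pi_pos], hv'.2⟩
      refine ⟨mul_pos (Real.cosh_pos _) hcos, ?_⟩
      simp only [hF, mul_pow, Real.cosh_sq, Real.sin_sq]; ring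
    have hF2 : ∀ v ∈ Icc (0 : ℝ) 1, 0 < 1 - F v ^ 2 := fun v hv => by
      have hv' := hth v hv
      have hcos := Real.cos_pos_of_mem_Ioo ⟨by linarith [hv'.1, Real.pi_pos], hv'.2⟩
      rw [(hF1 v hv).2, ← sq_abs (Real.sinh (c v).2 * _), abs_mul, abs_of_pos hcos]
      have := hsin v hv
      have h0 : 0 ≤ |Real.sinh (c v).2| * Real.cos ((c v).1 - u + ε) := by positivity
      nlinarith
    have := hc.length_le (g := fun v => Real.arccos (F v))
      (g' := fun v => -(1 / √(1 - F v ^ 2)) * F' v)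
      (fun v hv => (Real.hasDerivAt_arccos (by linarith [(hF1 v hv).1])
        (by nlinarith [hF2 v hv, (hF1 v hv).1])).comp v (hFd v)) ?_
    · refine this.trans ?_
      simp only [hF, hc.2.1, hc.2.2.1]
      linarith [Real.arccos_nonneg (Real.cosh 0 * Real.cos (u - u + ε))]
    · intro v hv
      have hv' := hth v hv
      have hcos := Real.cos_pos_of_mem_Ioo ⟨by linarith [hv'.1, Real.pi_pos], hv'.2⟩
      have hs := Real.sqrt_pos.2 (hF2 v hv)
      rw [neg_mul, one_div, ← mul_neg, inv_mul_eq_div, le_div_iff₀ hs]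
      -- Here `P` and `Q` are the components of the gradient of `F` in an orthonormal frame, up to
      -- sign. Its squared norm is `1 - F ^ 2`, so the gradient of `arccos F` has unit length.
      have := sqrt_mul_sqrt_le_of_abs_le (P := Real.sin ((c v).1 - u + ε))
        (Q := -(Real.sinh (c v).2 * Real.cos ((c v).1 - u + ε)))
        (by rw [abs_neg, abs_mul, abs_of_pos hcos]; exact (hsin v hv).le)
        (hc.abs_arctan_sinh_le rfl hv).1
      rw [neg_sq, ← (hF1 v hv).2] at this
      rw [metric_negOne, mul_comm]
      convert! this using 1
      · ring_nf
      · simp only [hF']; ring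
  have hpos : 0 < Real.pi / 2 - (T - u) := by linarith
  refine ge_of_tendsto (f := fun ε : ℝ => Real.arccos (Real.cosh X * Real.cos (T - u + ε)))
    (x := 𝓝[>] (0 : ℝ)) ?_ (by filter_upwards [Ioo_mem_nhdsGT hpos] with ε hε using key ε hε)
  have : Continuous fun ε : ℝ => Real.arccos (Real.cosh X * Real.cos (T - u + ε)) := by fun_prop
  simpa using (this.tendsto 0).mono_left nhdsWithin_le_nhds

/-- Timelike geodesics are plane sections of the quadric. Through the base point they are the graphs
`tanh x = κ * sin (t - u)` with `κ ^ 2 < 1`, and their proper time is `arctan (σ * tan (t - u))`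
with `σ = √(1 - κ ^ 2)`. -/
theorem le_tau_negOne {u T X : ℝ} (hu : u < T) (hT : T - u < Real.pi / 2)
    (hF : Real.cosh X * Real.cos (T - u) < 1) :
    Causal (-1) (u, 0) (T, X) ∧
    ENNReal.ofReal (Real.arccos (Real.cosh X * Real.cos (T - u))) ≤ tau (-1) (u, 0) (T, X) := by
  set θ := T - u with hθ
  have hθ0 : 0 < θ := by linarith
  have hsin : 0 < Real.sin θ := Real.sin_pos_of_pos_of_lt_pi hθ0 (by linarith [Real.pi_pos])
  have hcos : 0 < Real.cos θ := Real.cos_pos_of_mem_Ioo ⟨by linarith [Real.pi_pos], hT⟩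
  have hch := Real.cosh_pos X
  set κ := Real.tanh X / Real.sin θ with hκ
  have hκs : κ * Real.sin θ = Real.tanh X := div_mul_cancel₀ _ hsin.ne'
  -- This is `hF` squared: `cos θ ^ 2 < 1 / cosh X ^ 2` says `tanh X ^ 2 < sin θ ^ 2`.
  have hκ2 : κ ^ 2 < 1 := by
    have h1 : Real.tanh X ^ 2 = 1 - 1 / Real.cosh X ^ 2 := by
      rw [Real.tanh_eq_sinh_div_cosh, div_pow, Real.sinh_sq]; field_simp
    have h2 : Real.cos θ ^ 2 < 1 / Real.cosh X ^ 2 := by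
      rw [lt_div_iff₀ (by positivity), ← mul_pow, mul_comm]
      exact pow_lt_one₀ (by positivity) hF two_ne_zero
    rw [hκ, div_pow, div_lt_one (by positivity), h1, Real.sin_sq]
    linarith
  clear_value κ
  set σ := √(1 - κ ^ 2)
  have hσ : 0 < σ := Real.sqrt_pos.2 (by linarith)
  have hσ2 : σ ^ 2 = 1 - κ ^ 2 := Real.sq_sqrt (by linarith)
  have hy2 : ∀ s, 0 < 1 - (κ * Real.sin s) ^ 2 := fun s => by
    have := Real.sin_sq_le_one s
    nlinarith [sq_nonneg κ]
  have hy : ∀ s, κ * Real.sin s ∈ Ioo (-1 : ℝ) 1 := fun s => by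
    have := hy2 s
    exact abs_lt.1 ((sq_lt_one_iff_abs_lt_one _).1 (by linarith))
  have := graph_le_tau (K := -1) hu (ξ := fun t => Real.artanh (κ * Real.sin (t - u)))
    (ξ' := fun t => 1 / (1 - (κ * Real.sin (t - u)) ^ 2) * (κ * (Real.cos (t - u) * 1)))
    (g := fun t => Real.arctan (σ * Real.tan (t - u)))
    (g' := fun t => σ / (1 - (κ * Real.sin (t - u)) ^ 2))
    (fun t => HasDerivAt.comp (h₂ := Real.artanh) (h := fun t => κ * Real.sin (t - u)) t
      (hasDerivAt_artanh (hy (t - u))) ((((hasDerivAt_id' t).sub_const u).sin).const_mul κ))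
    (by
      have h : ∀ t, 1 - (κ * Real.sin (t - u)) ^ 2 ≠ 0 := fun t => (hy2 _).ne'
      fun_prop (disch := exact h _))
    (fun t ht => by
      have hc0 : 0 < Real.cos (t - u) := Real.cos_pos_of_mem_Ioo
        ⟨by linarith [ht.1, Real.pi_pos], by linarith [ht.2]⟩
      have h1 : HasDerivAt (fun t => Real.tan (t - u)) (1 / Real.cos (t - u) ^ 2) t := by
        have := (Real.hasDerivAt_tan hc0.ne').comp t ((hasDerivAt_id' t).sub_const u)
        rwa [mul_one] at this
      convert! (h1.const_mul σ).arctan using 1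
      have h2 := hy2 (t - u)
      have h3 : 1 - (κ * Real.sin (t - u)) ^ 2 =
          (1 + (σ * Real.tan (t - u)) ^ 2) * Real.cos (t - u) ^ 2 := by
        rw [Real.tan_eq_sin_div_cos, mul_pow, mul_pow, div_pow, hσ2]
        field_simp
        linear_combination -(Real.sin_sq_add_cos_sq (t - u))
      rw [h3]
      have h4 : 0 < 1 + (σ * Real.tan (t - u)) ^ 2 := by positivity
      field_simp)
    (fun t _ => div_nonneg hσ.le (hy2 _).le)
    (fun t _ => by
      rw [metric_negOne]
      dsimp only
      have h2 := hy2 (t - u)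
      rw [Real.cosh_artanh (hy _), div_pow, div_pow, hσ2, Real.sq_sqrt h2.le]
      field_simp
      rw [Real.cos_sq']; ring)
  have e1 : Real.artanh (κ * Real.sin (u - u)) = 0 := by simp
  have e2 : Real.artanh (κ * Real.sin (T - u)) = X := by
    rw [← hθ, hκs, Real.artanh_tanh]
  have e3 : Real.arctan (σ * Real.tan (T - u)) - Real.arctan (σ * Real.tan (u - u)) =
      Real.arccos (Real.cosh X * Real.cos θ) := by
    have h0 : 0 ≤ σ * Real.tan θ :=
      mul_nonneg hσ.le (Real.tan_nonneg_of_nonneg_of_le_pi_div_two hθ0.le hT.le)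
    rw [← hθ, sub_self, Real.tan_zero, mul_zero, Real.arctan_zero, sub_zero,
      ← Real.arccos_cos (Real.arctan_nonneg.2 h0)
        (by linarith [Real.arctan_lt_pi_div_two (σ * Real.tan θ), Real.pi_pos]), Real.cos_arctan]
    congr 1
    have h1 : 1 + (σ * Real.tan θ) ^ 2 = ((Real.cosh X * Real.cos θ)⁻¹) ^ 2 := by
      have h2 : Real.cosh X = 1 / √(1 - (κ * Real.sin θ) ^ 2) := by
        rw [← Real.cosh_artanh (hy θ), hκs, Real.artanh_tanh]
      rw [inv_pow, mul_pow _ _ 2, mul_pow _ _ 2, h2, div_pow, Real.sq_sqrt (hy2 θ).le,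
        Real.tan_eq_sin_div_cos, hσ2]
      have := hy2 θ
      field_simp
      linear_combination (Real.sin_sq_add_cos_sq θ)
    rw [h1, Real.sqrt_sq (by positivity)]
    simp
  rwa [e1, e2, e3] at this

end KPlane

namespace KPlane

/-! ### The de Sitter plane -/

theorem metric_one (p v w : ℝ × ℝ) :
    metric 1 p v w = -(v.1 * w.1) + Real.cosh p.1 ^ 2 * (v.2 * w.2) := by
  have : √(-1 : ℝ) = 0 := Real.sqrt_eq_zero_of_nonpos (by norm_num)
  simp [metric, this]

/-- Here `arctan (sinh t)` is the conformal time: `x` plus or minus it is a null coordinate, hence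
monotone along causal curves. -/
theorem IsCausalCurve.abs_snd_le_arctan_sinh {c : ℝ → ℝ × ℝ} {p q : ℝ × ℝ}
    (h : IsCausalCurve 1 c p q) (hp : p.2 = 0) {u : ℝ} (hu : u ∈ Icc (0 : ℝ) 1) :
    |Real.cosh (c u).1 * (deriv c u).2| ≤ (deriv c u).1 ∧
      |(c u).2| ≤ Real.arctan (Real.sinh (c u).1) - Real.arctan (Real.sinh p.1) := by
  have hcone : ∀ u ∈ Icc (0 : ℝ) 1, |Real.cosh (c u).1 * (deriv c u).2| ≤ (deriv c u).1 := by
    intro u hu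
    have := h.2.2.2 u hu
    rw [metric_one] at this
    apply abs_le_of_sq_le_sq _ this.1.le
    nlinarith [this.2]
  refine ⟨hcone u hu, ?_⟩
  have hd : ∀ u, HasDerivAt (fun u => Real.arctan (Real.sinh (c u).1))
      ((deriv c u).1 / Real.cosh (c u).1) u := fun u => by
    convert! ((h.hasDerivAt_fst u).sinh).arctan using 1
    rw [← Real.cosh_sq']
    have := Real.cosh_pos (c u).1
    field_simp
  have hb : ∀ u ∈ Icc (0 : ℝ) 1, |(deriv c u).2| ≤ (deriv c u).1 / Real.cosh (c u).1 := by
    intro u hu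
    have := hcone u hu
    rwa [abs_mul, abs_of_pos (Real.cosh_pos _), mul_comm, ← le_div_iff₀ (Real.cosh_pos _)] at this
  have h1 := monotoneOn_unitInterval (fun u _ => (hd u).sub (h.hasDerivAt_snd u))
    (fun u hu => by linarith [(abs_le.1 (hb u hu)).2]) (left_mem_Icc.2 zero_le_one) hu hu.1
  have h2 := monotoneOn_unitInterval (fun u _ => (hd u).add (h.hasDerivAt_snd u))
    (fun u hu => by linarith [(abs_le.1 (hb u hu)).1]) (left_mem_Icc.2 zero_le_one) hu hu.1
  simp only [Pi.sub_apply, Pi.add_apply, h.2.1, hp] at h1 h2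
  rw [abs_le]; constructor <;> linarith

theorem cos_arctan_sinh (t : ℝ) : Real.cos (Real.arctan (Real.sinh t)) = 1 / Real.cosh t := by
  rw [Real.cos_arctan, ← Real.cosh_sq', Real.sqrt_sq (Real.cosh_pos t).le]

theorem sin_arctan_sinh (t : ℝ) : Real.sin (Real.arctan (Real.sinh t)) =
    Real.sinh t / Real.cosh t := by
  rw [Real.sin_arctan, ← Real.cosh_sq', Real.sqrt_sq (Real.cosh_pos t).le]

/-- The point `(t, x)` lies in the timelike future of `(v, 0)` when the hyperbolic product exceeds
`1`, and the product is then increasing in time direction. -/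
theorem one_lt_of_abs_lt_arctan_sinh {v t x : ℝ}
    (h : |x| < Real.arctan (Real.sinh t) - Real.arctan (Real.sinh v)) :
    1 < Real.cosh v * Real.cosh t * Real.cos x - Real.sinh v * Real.sinh t ∧
      0 < Real.cosh v * Real.sinh t * Real.cos x - Real.sinh v * Real.cosh t := by
  have hv := Real.cosh_pos v
  have ht := Real.cosh_pos t
  have hvt : v < t := by
    by_contra! hle
    have := Real.arctan_mono (Real.sinh_le_sinh.2 hle)
    linarith [abs_nonneg x]
  have hF : 1 < Real.cosh v * Real.cosh t * Real.cos x - Real.sinh v * Real.sinh t := by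
    have h1 : Real.cos (Real.arctan (Real.sinh t) - Real.arctan (Real.sinh v)) < Real.cos x := by
      rw [← Real.cos_abs x]
      apply Real.cos_lt_cos_of_nonneg_of_le_pi (abs_nonneg x) _ h
      linarith [Real.arctan_lt_pi_div_two (Real.sinh t),
        Real.neg_pi_div_two_lt_arctan (Real.sinh v)]
    rw [Real.cos_sub, cos_arctan_sinh, cos_arctan_sinh, sin_arctan_sinh, sin_arctan_sinh] at h1
    have h2 := mul_lt_mul_of_pos_left h1 (mul_pos hv ht)
    have h3 : Real.cosh v * Real.cosh t * (1 / Real.cosh t * (1 / Real.cosh v) +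
        Real.sinh t / Real.cosh t * (Real.sinh v / Real.cosh v)) =
          1 + Real.sinh t * Real.sinh v := by field_simp
    rw [h3] at h2
    linarith
  refine ⟨hF, ?_⟩
  set F := Real.cosh v * Real.cosh t * Real.cos x - Real.sinh v * Real.sinh t with hFdef
  have hP : (Real.cosh v * Real.sinh t * Real.cos x - Real.sinh v * Real.cosh t) * Real.cosh t =
      F * Real.sinh t - Real.sinh v := by
    rw [hFdef]
    linear_combination (-Real.sinh v) * Real.cosh_sq t
  refine pos_of_mul_pos_left ?_ ht.le
  rw [hP]
  -- For `sinh t ≥ 0` the bound `F > 1` suffices. For negative `sinh t` an upper bound for `F` is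
  -- needed instead, and `F ≤ cosh (t - v)` because `cos x ≤ 1`.
  rcases le_or_gt 0 (Real.sinh t) with hs | hs
  · nlinarith [Real.sinh_lt_sinh.2 hvt]
  · have h1 : F ≤ Real.cosh (t - v) := by
      rw [Real.cosh_sub, hFdef]
      nlinarith [Real.cos_le_one x, mul_pos hv ht]
    have h2 : Real.cosh (t - v) * Real.sinh t - Real.sinh v =
        Real.sinh (t - v) * Real.cosh t := by
      have : Real.sinh (t - v - t) = -Real.sinh v := by rw [← Real.sinh_neg]; ring_nf
      rw [Real.sinh_sub] at this
      linarith
    have h3 : 0 < Real.sinh (t - v) * Real.cosh t :=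
      mul_pos (Real.sinh_pos_iff.2 (by linarith)) ht
    nlinarith

/-- The `arcosh` of the product in the hyperboloid model is a calibration, once the base point is
moved into the past by `ε`. With `cosh` of the length on the left, the limit `ε → 0` only involves
an elementary expression in `ε`. -/
theorem IsCausalCurve.cosh_length_le {c : ℝ → ℝ × ℝ} {u T X : ℝ}
    (hc : IsCausalCurve 1 c (u, 0) (T, X)) :
    Real.cosh (length 1 c) ≤
      Real.cosh u * Real.cosh T * Real.cos X - Real.sinh u * Real.sinh T := by
  have hlen0 : 0 ≤ length 1 c :=
    intervalIntegral.integral_nonneg zero_le_one fun _ _ => Real.sqrt_nonneg _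
  have key : ∀ ε > 0, Real.cosh (length 1 c) ≤
      Real.cosh (u - ε) * Real.cosh T * Real.cos X - Real.sinh (u - ε) * Real.sinh T := by
    intro ε hε
    set v := u - ε with hv
    set F : ℝ → ℝ := fun s => Real.cosh v * Real.cosh (c s).1 * Real.cos (c s).2 -
      Real.sinh v * Real.sinh (c s).1 with hF
    set P : ℝ → ℝ := fun s => Real.cosh v * Real.sinh (c s).1 * Real.cos (c s).2 -
      Real.sinh v * Real.cosh (c s).1 with hP
    set F' : ℝ → ℝ := fun s => P s * (deriv c s).1 +
      -(Real.cosh v * Real.sin (c s).2) * (Real.cosh (c s).1 * (deriv c s).2) with hF'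
    have hFd : ∀ s, HasDerivAt F (F' s) s := fun s => by
      convert! (((hc.hasDerivAt_fst s).cosh.const_mul (Real.cosh v)).mul
        (hc.hasDerivAt_snd s).cos).sub ((hc.hasDerivAt_fst s).sinh.const_mul (Real.sinh v)) using 1
      simp only [hF', hP]; ring
    have hlt : ∀ s ∈ Icc (0 : ℝ) 1, 1 < F s ∧ 0 < P s := fun s hs => by
      apply one_lt_of_abs_lt_arctan_sinh
      refine (hc.abs_snd_le_arctan_sinh rfl hs).2.trans_lt ?_
      have := Real.arctan_strictMono (Real.sinh_lt_sinh.2 (show v < u by linarith))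
      simpa using this
    have hFP : ∀ s, P s ^ 2 - (Real.cosh v * Real.sin (c s).2) ^ 2 = F s ^ 2 - 1 := fun s => by
      simp only [hP, hF, mul_pow, sub_sq, Real.sin_sq]
      rw [Real.cosh_sq v, Real.cosh_sq (c s).1]; ring
    have := hc.length_le (g := fun s => Real.arcosh (F s))
      (g' := fun s => (√(F s ^ 2 - 1))⁻¹ * F' s)
      (fun s hs => (Real.hasDerivAt_arcosh (hlt s hs).1).comp s (hFd s)) ?_
    · have h0 := Real.arcosh_nonneg (hlt 0 (by simp)).1.le
      have h1 := (hlt 1 (by simp)).1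
      have h2 : length 1 c ≤ Real.arcosh (F 1) := by linarith
      have h3 := Real.cosh_le_cosh.2 (abs_le_abs_of_nonneg hlen0 h2)
      rw [Real.cosh_arcosh h1.le] at h3
      simpa only [hF, hc.2.2.1] using h3
    · intro s hs
      have hs1 : 0 < F s ^ 2 - 1 := by nlinarith [(hlt s hs).1]
      rw [inv_mul_eq_div, le_div_iff₀ (Real.sqrt_pos.2 hs1)]
      have := sqrt_mul_sqrt_le_of_abs_le (P := P s) (Q := -(Real.cosh v * Real.sin (c s).2))
        (abs_le_of_sq_le_sq (by rw [neg_sq]; linarith [hFP s]) (hlt s hs).2.le)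
        (hc.abs_snd_le_arctan_sinh rfl hs).1
      rw [neg_sq, hFP] at this
      rw [metric_one, mul_comm]
      convert! this using 1
      ring_nf
  refine ge_of_tendsto (f := fun ε : ℝ => Real.cosh (u - ε) * Real.cosh T * Real.cos X -
      Real.sinh (u - ε) * Real.sinh T)
    (x := 𝓝[>] (0 : ℝ)) ?_ (eventually_nhdsWithin_of_forall key)
  have : Continuous fun ε : ℝ => Real.cosh (u - ε) * Real.cosh T * Real.cos X -
      Real.sinh (u - ε) * Real.sinh T := by fun_prop
  simpa using (this.tendsto 0).mono_left nhdsWithin_le_nhds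

/-- If the product is below `1`, there is no causal curve; the maximum then makes the bound `arcosh
1 = 0`. -/
theorem tau_one_le {u T X : ℝ} : tau 1 (u, 0) (T, X) ≤ ENNReal.ofReal (Real.arcosh
    (max (Real.cosh u * Real.cosh T * Real.cos X - Real.sinh u * Real.sinh T) 1)) := by
  apply tau_le
  intro c hc
  have hlen0 : 0 ≤ length 1 c :=
    intervalIntegral.integral_nonneg zero_le_one fun _ _ => Real.sqrt_nonneg _
  rw [← Real.arcosh_cosh hlen0]
  exact (Real.arcosh_le_arcosh (Real.cosh_pos _) (by positivity)).2
    (hc.cosh_length_le.trans (le_max_left _ _))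

/-- The timelike geodesics used are the graphs `x = arcsin (ρ tanh t) - arcsin (ρ tanh u)` with `ρ ^
2 < 1`, whose proper time is `arsinh (σ sinh t)` up to a constant, `σ = √(1 - ρ ^ 2)`. The product
is `2π`-periodic in `X`, so on the universal cover it detects the timelike future only for `|X| ≤
π`. -/
theorem le_tau_one {u T X : ℝ} (hu : u < T) (hX : |X| ≤ Real.pi)
    (hF : 1 < Real.cosh u * Real.cosh T * Real.cos X - Real.sinh u * Real.sinh T) :
    Causal 1 (u, 0) (T, X) ∧ ENNReal.ofReal (Real.arcosh
      (Real.cosh u * Real.cosh T * Real.cos X - Real.sinh u * Real.sinh T)) ≤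
        tau 1 (u, 0) (T, X) := by
  set y : ℝ → ℝ := fun t => Real.sinh t / Real.cosh t with hy
  have hyc : ∀ t, 1 - y t ^ 2 = 1 / Real.cosh t ^ 2 := fun t => by
    have := Real.cosh_pos t
    simp only [hy, div_pow]
    field_simp
    linarith [Real.cosh_sq t]
  have hy1 : ∀ t, y t ^ 2 < 1 := fun t => by
    have := Real.cosh_pos t
    have : 0 < 1 / Real.cosh t ^ 2 := by positivity
    linarith [hyc t]
  -- For `ρ = ±1` the graph is null, as `arcsin (tanh t) = arctan (sinh t)`. By `hF` the point lies
  -- strictly between the two null graphs, so the intermediate value theorem yields a `ρ` strictly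
  -- between `-1` and `1`.
  obtain ⟨ρ, hρ2, hρX⟩ : ∃ ρ : ℝ, ρ ^ 2 < 1 ∧
      Real.arcsin (ρ * y T) - Real.arcsin (ρ * y u) = X := by
    have hcont : Continuous fun ρ : ℝ => Real.arcsin (ρ * y T) - Real.arcsin (ρ * y u) := by
      fun_prop
    have harc : ∀ t, Real.arcsin (1 * y t) = Real.arctan (Real.sinh t) := fun t => by
      rw [one_mul, Real.arctan_eq_arcsin, ← Real.cosh_sq', Real.sqrt_sq (Real.cosh_pos t).le]
    have h1 : |X| < Real.arcsin (1 * y T) - Real.arcsin (1 * y u) := by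
      rw [harc, harc]
      by_contra! hle
      have h2 := Real.cos_le_cos_of_nonneg_of_le_pi (sub_nonneg.2
        (Real.arctan_mono (Real.sinh_le_sinh.2 hu.le))) hX hle
      rw [Real.cos_abs, Real.cos_sub, cos_arctan_sinh, cos_arctan_sinh, sin_arctan_sinh, sin_arctan_sinh] at h2
      have hcu := Real.cosh_pos u
      have hcT := Real.cosh_pos T
      have h3 := mul_le_mul_of_nonneg_left h2 (mul_pos hcu hcT).le
      have h4 : Real.cosh u * Real.cosh T * (1 / Real.cosh T * (1 / Real.cosh u) +
          Real.sinh T / Real.cosh T * (Real.sinh u / Real.cosh u)) =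
            1 + Real.sinh T * Real.sinh u := by field_simp
      rw [h4] at h3
      linarith
    have h2 : Real.arcsin (-1 * y T) - Real.arcsin (-1 * y u) < X := by
      rw [neg_one_mul, neg_one_mul, Real.arcsin_neg, Real.arcsin_neg, ← one_mul (y T),
        ← one_mul (y u)]
      linarith [neg_abs_le X]
    have h3 := (le_abs_self X).trans_lt h1
    obtain ⟨ρ, hρ, hρX⟩ := intermediate_value_Icc (by norm_num) hcont.continuousOn
      (show X ∈ Icc _ _ from ⟨h2.le, h3.le⟩)
    refine ⟨ρ, (sq_lt_one_iff_abs_lt_one _).2 (abs_lt.2 ⟨lt_of_le_of_ne hρ.1 ?_,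
      lt_of_le_of_ne hρ.2 ?_⟩), hρX⟩
    · rintro rfl
      exact h2.ne hρX
    · rintro rfl
      exact h3.ne' hρX
  set σ := √(1 - ρ ^ 2)
  have hσ : 0 < σ := Real.sqrt_pos.2 (by linarith)
  have hσ2 : σ ^ 2 = 1 - ρ ^ 2 := Real.sq_sqrt (by linarith)
  have hρy : ∀ t, (ρ * y t) ^ 2 < 1 := fun t => by
    rw [mul_pow]; nlinarith [hy1 t, sq_nonneg ρ, sq_nonneg (y t)]
  have hρy' : ∀ t, ρ * y t ∈ Ioo (-1 : ℝ) 1 := fun t =>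
    abs_lt.1 ((sq_lt_one_iff_abs_lt_one _).1 (hρy t))
  have hroot : ∀ t, √(1 - (ρ * y t) ^ 2) = √(1 + (σ * Real.sinh t) ^ 2) / Real.cosh t := fun t => by
    have h0 := Real.cosh_pos t
    rw [eq_div_iff h0.ne', ← Real.sqrt_sq h0.le, ← Real.sqrt_mul (by linarith [hρy t])]
    congr 1
    simp only [hy]
    rw [mul_pow σ, hσ2]
    field_simp
    linarith [Real.cosh_sq t]
  have hyd : ∀ t, HasDerivAt y (1 / Real.cosh t ^ 2) t := fun t => by
    have h0 := Real.cosh_pos t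
    convert! (Real.hasDerivAt_sinh t).div (Real.hasDerivAt_cosh t) h0.ne' using 1
    field_simp
    linarith [Real.cosh_sq t]
  have hS : ∀ t, 0 < 1 + (σ * Real.sinh t) ^ 2 := fun t => by positivity
  have hSs : ∀ t, 0 < √(1 + (σ * Real.sinh t) ^ 2) := fun t => Real.sqrt_pos.2 (hS t)
  have := graph_le_tau (K := 1) hu
    (ξ := fun t => Real.arcsin (ρ * y t) - Real.arcsin (ρ * y u))
    (ξ' := fun t => 1 / (√(1 + (σ * Real.sinh t) ^ 2) / Real.cosh t) * (ρ * (1 / Real.cosh t ^ 2)))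
    (g := fun t => Real.arsinh (σ * Real.sinh t))
    (g' := fun t => (√(1 + (σ * Real.sinh t) ^ 2))⁻¹ • (σ * Real.cosh t))
    (fun t => by
      rw [← hroot]
      exact (HasDerivAt.comp (h₂ := Real.arcsin) (h := fun t => ρ * y t) t
        (Real.hasDerivAt_arcsin (hρy' t).1.ne' (hρy' t).2.ne)
        ((hyd t).const_mul ρ)).sub_const _)
    (by
      have h1 : ∀ t, Real.cosh t ≠ 0 := fun t => (Real.cosh_pos t).ne'
      have h2 : ∀ t, Real.cosh t ^ 2 ≠ 0 := fun t => pow_ne_zero _ (h1 t)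
      have h3 : ∀ t, √(1 + (σ * Real.sinh t) ^ 2) / Real.cosh t ≠ 0 := fun t =>
        div_ne_zero (hSs t).ne' (h1 t)
      refine (continuous_const.div (Continuous.div ?_ Real.continuous_cosh h1) h3).mul
        (continuous_const.mul (continuous_const.div (by fun_prop) h2))
      fun_prop)
    (fun t _ => ((Real.hasDerivAt_sinh t).const_mul σ).arsinh)
    (fun t _ => by
      have := Real.cosh_pos t
      have := hSs t
      rw [smul_eq_mul]; positivity)
    (fun t _ => by
      rw [metric_one]
      have h0 := Real.cosh_pos t
      have h1 := hSs t
      have h2 := Real.sq_sqrt (hS t).le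
      rw [smul_eq_mul]
      generalize √(1 + (σ * Real.sinh t) ^ 2) = R at h1 h2
      field_simp
      rw [h2, mul_pow, hσ2, Real.cosh_sq]; ring)
  have e1 : Real.arcsin (ρ * y u) - Real.arcsin (ρ * y u) = 0 := sub_self _
  have e2 : Real.arsinh (σ * Real.sinh T) - Real.arsinh (σ * Real.sinh u) = Real.arcosh
      (Real.cosh u * Real.cosh T * Real.cos X - Real.sinh u * Real.sinh T) := by
    have hnn : 0 ≤ Real.arsinh (σ * Real.sinh T) - Real.arsinh (σ * Real.sinh u) := by
      rw [sub_nonneg, Real.arsinh_le_arsinh]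
      exact mul_le_mul_of_nonneg_left (Real.sinh_le_sinh.2 hu.le) hσ.le
    rw [← Real.arcosh_cosh hnn, Real.cosh_sub, Real.cosh_arsinh, Real.cosh_arsinh,
      Real.sinh_arsinh, Real.sinh_arsinh, ← hρX, Real.cos_sub, Real.cos_arcsin, Real.cos_arcsin,
      Real.sin_arcsin (hρy' T).1.le (hρy' T).2.le, Real.sin_arcsin (hρy' u).1.le (hρy' u).2.le,
      hroot, hroot]
    congr 1
    have hcu := Real.cosh_pos u
    have hcT := Real.cosh_pos T
    simp only [hy]
    field_simp
    linear_combination (-Real.sinh T * Real.sinh u) * hσ2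
  rw [e1, hρX, e2] at this
  exact this

end KPlane

namespace KPlane

/-! ### Comparison of hinges at small scales

A triangle in the plane of curvature `K` with a side along the time axis, from `(-t, 0)` to `(r, 0)`,
satisfies at small scales an approximate version of Stewart's theorem for the point `0` of this
side. -/

/-- At small scales, there are triangles in the plane of curvature `K` with two vertices `(-t, 0)`
and `(r, 0)` and prescribed time separations `m` and `n` to a third vertex `a`; and if `0` has time
separation at least `A` to `a`, the flat hinges with sides `r`, `A` and `t`, `A` satisfy the
approximate inequality between their angles. -/
def HingeComparison (K : ℝ) : Prop :=
  ∀ ε > 0, ∃ δ > 0,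
    (∀ u T : ℝ, u < T → T - u < δ →
      Causal K (u, 0) (T, 0) ∧ tau K (u, 0) (T, 0) = ENNReal.ofReal (T - u)) ∧
    ∀ t ∈ Ioo 0 δ, ∀ r ∈ Ioo 0 δ, ∀ m ∈ Ioo 0 δ, ∀ n ∈ Ioo 0 δ, ∀ A ∈ Ioo 0 δ,
      A + t ≤ m → n ≤ |A - r| →
      (t + r + n ≤ m → ∃ a : ℝ × ℝ, tau K (-t, 0) a = ENNReal.ofReal m ∧
        tau K (r, 0) a = ENNReal.ofReal n ∧ (ENNReal.ofReal A ≤ tau K (0, 0) a →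
          t * ((A - r) ^ 2 - n ^ 2) ≤ (1 + ε) * (r * (m ^ 2 - (A + t) ^ 2)))) ∧
      (m + n ≤ t + r → ∃ a : ℝ × ℝ, tau K (-t, 0) a = ENNReal.ofReal m ∧
        tau K a (r, 0) = ENNReal.ofReal n ∧ (ENNReal.ofReal A ≤ tau K (0, 0) a →
          t * ((A - r) ^ 2 - n ^ 2) ≤ (1 + ε) * (r * (m ^ 2 - (A + t) ^ 2))))

/-- The two sides of the hinge inequality are homogeneous of degree three in the lengths, so a
dilation by `k` multiplies both by `k ^ 3`. -/
theorem HingeComparison.scale {K J k : ℝ} (h : HingeComparison J) (hk : 0 < k)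
    (hJ : K = k ^ 2 * J) : HingeComparison K := by
  intro ε hε
  obtain ⟨δ, hδ, h1, h2⟩ := h ε hε
  have hkinv : 0 < k⁻¹ := inv_pos.2 hk
  have hJ' : J = k⁻¹ ^ 2 * K := by rw [hJ]; field_simp
  have hmem : ∀ s, s ∈ Ioo 0 (δ / k) → k * s ∈ Ioo 0 δ := fun s hs =>
    ⟨mul_pos hk hs.1, by rw [mul_comm]; exact (lt_div_iff₀ hk).1 hs.2⟩
  have hax : ∀ u, ((u, 0) : ℝ × ℝ) = k⁻¹ • ((k * u, 0) : ℝ × ℝ) := fun u => by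
    ext <;> simp [hk.ne']
  have hof : ∀ s, ENNReal.ofReal s = ENNReal.ofReal k⁻¹ * ENNReal.ofReal (k * s) := fun s => by
    rw [← ENNReal.ofReal_mul hkinv.le, inv_mul_cancel_left₀ hk.ne']
  have htau : ∀ p q s, tau J p q = ENNReal.ofReal (k * s) →
      tau K (k⁻¹ • p) (k⁻¹ • q) = ENNReal.ofReal s := fun p q s h => by
    rw [tau_scale hkinv hJ', h, hof s]
  have hle : ∀ p q s, ENNReal.ofReal s ≤ tau K (k⁻¹ • p) (k⁻¹ • q) →
      ENNReal.ofReal (k * s) ≤ tau J p q := fun p q s h => by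
    rw [tau_scale hkinv hJ', hof s] at h
    rwa [ENNReal.mul_le_mul_iff_right (by simpa using hk) ENNReal.ofReal_ne_top] at h
  refine ⟨δ / k, div_pos hδ hk, fun u T huT hT => ?_, ?_⟩
  · have := h1 (k * u) (k * T) (by gcongr) (by
      rw [← mul_sub, mul_comm]; exact (lt_div_iff₀ hk).1 hT)
    rw [← mul_sub] at this
    rw [hax u, hax T]
    refine ⟨?_, htau _ _ _ this.2⟩
    rcases this.1 with h | ⟨c, hc⟩
    · exact Or.inl (by rw [h])
    · exact Or.inr ⟨_, (hc.scale hkinv hJ').1⟩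
  · intro t ht r hr m hm n hn A hA hm' hn'
    have hk2 : 0 < k ^ 3 := by positivity
    have hconcl : k * t * ((k * A - k * r) ^ 2 - (k * n) ^ 2) ≤
        (1 + ε) * (k * r * ((k * m) ^ 2 - (k * A + k * t) ^ 2)) →
        t * ((A - r) ^ 2 - n ^ 2) ≤ (1 + ε) * (r * (m ^ 2 - (A + t) ^ 2)) := fun h => by
      apply le_of_mul_le_mul_left _ hk2
      linarith
    obtain ⟨c1, c2⟩ := h2 _ (hmem t ht) _ (hmem r hr) _ (hmem m hm) _ (hmem n hn) _ (hmem A hA)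
      (by rw [← mul_add]; gcongr)
      (by rw [← mul_sub, abs_mul, abs_of_pos hk]; gcongr)
    have hz : ((0, 0) : ℝ × ℝ) = k⁻¹ • ((0, 0) : ℝ × ℝ) := by simp
    have hneg : k * -t = -(k * t) := by ring
    refine ⟨fun h => ?_, fun h => ?_⟩
    · obtain ⟨a, ha1, ha2, ha3⟩ := c1 (by rw [← mul_add, ← mul_add]; gcongr)
      refine ⟨k⁻¹ • a, ?_, ?_, fun hA' => hconcl (ha3 ?_)⟩
      · rw [hax]; exact htau _ _ _ (hneg ▸ ha1)
      · rw [hax]; exact htau _ _ _ ha2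
      · rw [hz] at hA'; exact hle _ _ _ hA'
    · obtain ⟨a, ha1, ha2, ha3⟩ := c2 (by rw [← mul_add, ← mul_add]; gcongr)
      refine ⟨k⁻¹ • a, ?_, ?_, fun hA' => hconcl (ha3 ?_)⟩
      · rw [hax]; exact htau _ _ _ (hneg ▸ ha1)
      · rw [hax]; exact htau _ _ _ ha2
      · rw [hz] at hA'; exact hle _ _ _ hA'

/-- Near `0`, products of three values of a function with derivative `1` may be compared with the
products of the arguments. -/
theorem exists_hinge_estimate {f : ℝ → ℝ} (hf : HasDerivAt f 1 0) (hf0 : f 0 = 0) {ε : ℝ}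
    (hε : 0 < ε) : ∃ δ > 0, ∀ t ∈ Ioo 0 δ, ∀ r ∈ Ioo 0 δ, ∀ m ∈ Ioo 0 δ, ∀ n ∈ Ioo 0 δ,
      ∀ A ∈ Ioo 0 δ, A + t ≤ m → n ≤ |A - r| →
      f t * (2 * f ((|A - r| + n) / 2) * f ((|A - r| - n) / 2)) ≤
        f r * (2 * f ((m + (A + t)) / 2) * f ((m - (A + t)) / 2)) →
      t * ((A - r) ^ 2 - n ^ 2) ≤ (1 + ε) * (r * (m ^ 2 - (A + t) ^ 2)) := by
  -- Each side has three factors `f z`, and `f z / z` will lie between `1 - η` and `1 + η`.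
  obtain ⟨η, hη0, hη1, hη⟩ : ∃ η : ℝ, 0 < η ∧ η < 1 ∧ (1 + η) ^ 3 < (1 + ε) * (1 - η) ^ 3 := by
    have h1 : ∀ᶠ η : ℝ in 𝓝 0, (1 + η) ^ 3 < (1 + ε) * (1 - η) ^ 3 :=
      ContinuousAt.eventually_lt (by fun_prop) (by fun_prop) (by simpa using hε)
    have h2 : ∀ᶠ η : ℝ in 𝓝[>] 0, η ∈ Ioo (0 : ℝ) 1 := Ioo_mem_nhdsGT one_pos
    obtain ⟨η, h3, h4⟩ := ((h1.filter_mono nhdsWithin_le_nhds).and h2).exists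
    exact ⟨η, h4.1, h4.2, h3⟩
  have hlo := (hasDerivAt_iff_isLittleO.1 hf).def hη0
  obtain ⟨δ, hδ, hb⟩ := Metric.eventually_nhds_iff.1 hlo
  have hb' : ∀ z, 0 ≤ z → z < δ → (1 - η) * z ≤ f z ∧ f z ≤ (1 + η) * z := by
    intro z hz0 hz
    have := hb (y := z) (by simpa [abs_of_nonneg hz0] using hz)
    simp only [hf0, sub_zero, smul_eq_mul, mul_one, Real.norm_eq_abs, abs_of_nonneg hz0] at this
    constructor <;> nlinarith [abs_le.1 this]
  -- Halving keeps `(m + (A + t)) / 2`, which involves three of the lengths, below `δ`.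
  refine ⟨δ / 2, half_pos hδ, fun t ht r hr m hm n hn A hA hAm hnA h => ?_⟩
  simp only [mem_Ioo] at ht hr hm hn hA
  set y := |A - r| with hy
  have hy2 : y < δ / 2 := by rw [hy, abs_lt]; constructor <;> linarith
  rw [← sq_abs (A - r), ← hy]
  have hw : 0 < A + t := by linarith
  set w := A + t
  clear_value y w
  obtain ⟨t1, t2⟩ := hb' t (by linarith) (by linarith)
  obtain ⟨r1, r2⟩ := hb' r (by linarith) (by linarith)
  obtain ⟨a1, a2⟩ := hb' ((y + n) / 2) (by linarith) (by linarith)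
  obtain ⟨b1, b2⟩ := hb' ((y - n) / 2) (by linarith) (by linarith)
  obtain ⟨c1, c2⟩ := hb' ((m + w) / 2) (by linarith) (by linarith)
  obtain ⟨d1, d2⟩ := hb' ((m - w) / 2) (by linarith) (by linarith)
  have hη' : 0 < 1 - η := by linarith
  have hl : ((1 - η) * t) * (2 * ((1 - η) * ((y + n) / 2)) * ((1 - η) * ((y - n) / 2))) ≤
      f t * (2 * f ((y + n) / 2) * f ((y - n) / 2)) := by
    have e1 : 0 ≤ (1 - η) * ((y + n) / 2) := mul_nonneg hη'.le (by linarith)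
    have e2 : 0 ≤ (1 - η) * ((y - n) / 2) := mul_nonneg hη'.le (by linarith)
    have e3 : 0 ≤ (1 - η) * t := mul_nonneg hη'.le (by linarith)
    have e4 := e1.trans a1
    have e5 := e2.trans b1
    have e6 := e3.trans t1
    gcongr
  have hr' : f r * (2 * f ((m + w) / 2) * f ((m - w) / 2)) ≤
      ((1 + η) * r) * (2 * ((1 + η) * ((m + w) / 2)) * ((1 + η) * ((m - w) / 2))) := by
    have e1 : 0 ≤ f ((m + w) / 2) := (mul_nonneg hη'.le (by linarith)).trans c1
    have e2 : 0 ≤ f ((m - w) / 2) := (mul_nonneg hη'.le (by linarith)).trans d1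
    have e3 : 0 ≤ f r := (mul_nonneg hη'.le (by linarith)).trans r1
    have : 0 < r := by linarith
    have e4 : 0 ≤ 2 * ((1 + η) * ((m + w) / 2)) := by
      have : 0 < m + w := by linarith
      positivity
    gcongr
  have hmain : (1 - η) ^ 3 * (t * (y ^ 2 - n ^ 2)) ≤ (1 + η) ^ 3 * (r * (m ^ 2 - w ^ 2)) := by
    linarith
  have hD : 0 ≤ r * (m ^ 2 - w ^ 2) := mul_nonneg (by linarith) (by nlinarith)
  apply le_of_mul_le_mul_left _ (pow_pos hη' 3)
  calc _ ≤ _ := hmain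
    _ ≤ (1 + ε) * (1 - η) ^ 3 * (r * (m ^ 2 - w ^ 2)) := mul_le_mul_of_nonneg_right hη.le hD
    _ = _ := by ring

/-- The third vertex `(T, X)` solves two quadratic equations, whose difference is linear in `T`.
Stewart's theorem is exact in the flat plane, so the factor `1 + ε` is not needed until the
right-hand side is enlarged at the very end. -/
theorem hingeComparison_zero : HingeComparison 0 := by
  intro ε hε
  refine ⟨1, one_pos, fun u T huT _ => ?_, ?_⟩
  · have := causal_zero_and_tau_zero (p := (u, 0)) (q := (T, 0)) (by simpa using huT.le)
    simpa [Real.sqrt_sq (sub_pos.2 huT).le] using this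
  intro t ht r hr m hm n hn A hA hAm hnA
  simp only [mem_Ioo] at ht hr hm hn hA
  have hL : 0 < t + r := by linarith
  set T := (m ^ 2 - n ^ 2 + r ^ 2 - t ^ 2) / (2 * (t + r)) with hT
  have hT' : T * (2 * (t + r)) = m ^ 2 - n ^ 2 + r ^ 2 - t ^ 2 := div_mul_cancel₀ _ (by positivity)
  have hTt : (T + t) * (2 * (t + r)) = (t + r) ^ 2 + m ^ 2 - n ^ 2 := by linear_combination hT'
  have hTr : (T - r) * (2 * (t + r)) = m ^ 2 - n ^ 2 - (t + r) ^ 2 := by linear_combination hT'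
  clear_value T
  have hpos1 : t + r + n ≤ m ∨ m + n ≤ t + r → 0 < (t + r) ^ 2 + m ^ 2 - n ^ 2 := by
    rintro (h | h)
    · linarith [pow_le_pow_left₀ (by linarith) h 2, mul_pos hL hn.1, pow_pos hL 2]
    · linarith [pow_le_pow_left₀ (by linarith) h 2, mul_pos hm.1 hn.1, pow_pos hm.1 2]
  have hX : t + r + n ≤ m ∨ m + n ≤ t + r → 0 ≤ (T + t) ^ 2 - m ^ 2 := by
    intro h
    -- Heron's formula. In either causal order of the vertices, the reverse triangle inequality
    -- makes both factors nonnegative.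
    have e : ((T + t) ^ 2 - m ^ 2) * (2 * (t + r)) ^ 2 =
        ((t + r - m) ^ 2 - n ^ 2) * ((t + r + m) ^ 2 - n ^ 2) := by
      linear_combination ((T + t) * (2 * (t + r)) + ((t + r) ^ 2 + m ^ 2 - n ^ 2)) * hTt
    have e1 : 0 ≤ (t + r - m) ^ 2 - n ^ 2 := by 
      rcases h with h | h
      · have := pow_le_pow_left₀ (n := 2) hn.1.le (show n ≤ m - (t + r) by linarith)
        linarith
      · have := pow_le_pow_left₀ (n := 2) hn.1.le (show n ≤ t + r - m by linarith)
        linarith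
    have e2 : 0 ≤ (t + r + m) ^ 2 - n ^ 2 := by
      have := pow_le_pow_left₀ (n := 2) hn.1.le (show n ≤ t + r + m by
        rcases h with h | h <;> linarith)
      linarith
    refine nonneg_of_mul_nonneg_left (b := (2 * (t + r)) ^ 2) ?_ (by positivity)
    rw [e]; positivity
  set X := √((T + t) ^ 2 - m ^ 2) with hXdef
  have hX0 : 0 ≤ X := Real.sqrt_nonneg _
  have main : t + r + n ≤ m ∨ m + n ≤ t + r → tau 0 (-t, 0) (T, X) = ENNReal.ofReal m ∧
      X ^ 2 = (T - r) ^ 2 - n ^ 2 ∧ (ENNReal.ofReal A ≤ tau 0 (0, 0) (T, X) →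
        t * ((A - r) ^ 2 - n ^ 2) ≤ (1 + ε) * (r * (m ^ 2 - (A + t) ^ 2))) := by
    intro h
    have hX2 : X ^ 2 = (T + t) ^ 2 - m ^ 2 := Real.sq_sqrt (hX h)
    clear_value X
    have hTt0 : 0 < T + t := by
      refine pos_of_mul_pos_left (b := 2 * (t + r)) ?_ (by positivity)
      rw [hTt]; exact hpos1 h
    refine ⟨?_, by linear_combination hX2 + hT', fun hle => ?_⟩
    · have := (causal_zero_and_tau_zero (p := (-t, 0)) (q := (T, X)) (by
        simp only [sub_zero, sub_neg_eq_add]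
        apply abs_le_of_sq_le_sq _ hTt0.le
        linarith [sq_nonneg m])).2
      rw [this]
      simp only [sub_zero, sub_neg_eq_add]
      rw [hX2, sub_sub_cancel, Real.sqrt_sq hm.1.le]
    · have := hle.trans (tau_zero_le _ _)
      rw [ENNReal.ofReal_le_ofReal_iff (Real.sqrt_nonneg _),
        Real.le_sqrt' hA.1] at this
      simp only [sub_zero] at this
      have hD : 0 ≤ r * (m ^ 2 - (A + t) ^ 2) := mul_nonneg hr.1.le (by nlinarith)
      have : A ^ 2 * (t + r) ≤ (T ^ 2 - X ^ 2) * (t + r) := by gcongr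
      -- Stewart's theorem for the point `0` on the side of length `t + r`.
      have e : (T ^ 2 - X ^ 2) * (t + r) = r * m ^ 2 + t * n ^ 2 - t * r * (t + r) := by
        linear_combination (-(t + r)) * hX2 - t * hT'
      have : t * ((A - r) ^ 2 - n ^ 2) ≤ r * (m ^ 2 - (A + t) ^ 2) := by linarith
      linarith [mul_nonneg hε.le hD]
  refine ⟨fun h => ?_, fun h => ?_⟩
  · obtain ⟨h1, h2, h3⟩ := main (Or.inl h)
    refine ⟨(T, X), h1, ?_, h3⟩
    have hTr0 : 0 ≤ T - r := by
      refine nonneg_of_mul_nonneg_left (b := 2 * (t + r)) ?_ (by positivity)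
      rw [hTr]; linarith [pow_le_pow_left₀ (by linarith) h 2, mul_pos hL hn.1]
    rw [(causal_zero_and_tau_zero (p := (r, 0)) (q := (T, X)) (by
        simp only [sub_zero]
        apply abs_le_of_sq_le_sq _ hTr0
        linarith [sq_nonneg n])).2]
    simp only [sub_zero]
    rw [h2, sub_sub_cancel, Real.sqrt_sq hn.1.le]
  · obtain ⟨h1, h2, h3⟩ := main (Or.inr h)
    refine ⟨(T, X), h1, ?_, h3⟩
    have hTr0 : 0 ≤ r - T := by
      refine nonneg_of_mul_nonneg_left (b := 2 * (t + r)) ?_ (by positivity)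
      have : (r - T) * (2 * (t + r)) = (t + r) ^ 2 + n ^ 2 - m ^ 2 := by linear_combination -hTr
      rw [this]; linarith [pow_le_pow_left₀ (by linarith) h 2, mul_pos hm.1 hn.1, sq_nonneg n]
    rw [(causal_zero_and_tau_zero (p := (T, X)) (q := (r, 0)) (by
        simp only [zero_sub]
        apply abs_le_of_sq_le_sq _ hTr0
        linarith [sq_nonneg n])).2]
    simp only [zero_sub]
    have : (r - T) ^ 2 - (-X) ^ 2 = n ^ 2 := by linear_combination -h2
    rw [this, Real.sqrt_sq hn.1.le]

end KPlane

/-! ### Hinges in the anti-de Sitter plane -/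

namespace KPlane

theorem cos_sub_cos_eq (x y : ℝ) :
    Real.cos x - Real.cos y = 2 * Real.sin ((y + x) / 2) * Real.sin ((y - x) / 2) := by
  rw [Real.cos_sub_cos, add_comm x y, ← neg_sub y x, neg_div, Real.sin_neg]; ring

theorem cosh_sub_cosh_eq (x y : ℝ) :
    Real.cosh y - Real.cosh x = 2 * Real.sinh ((y + x) / 2) * Real.sinh ((y - x) / 2) := by
  have h1 := Real.cosh_add ((y + x) / 2) ((y - x) / 2)
  have h2 := Real.cosh_sub ((y + x) / 2) ((y - x) / 2)
  rw [show (y + x) / 2 + (y - x) / 2 = y by ring] at h1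
  rw [show (y + x) / 2 - (y - x) / 2 = x by ring] at h2
  rw [h1, h2]; ring

/-- The cosine equation alone does not determine the time order: the positive sine excludes `T ≤ u`,
and `cos m > 0` forces `T - u < π / 2`, where the explicit formula is valid. -/
theorem tau_negOne_eq {u T X m : ℝ} (hm : 0 < m) (hm' : m < Real.pi / 2)
    (h1 : -Real.pi ≤ T - u) (h2 : T - u ≤ Real.pi) (hs : 0 < Real.sin (T - u))
    (hc : Real.cosh X * Real.cos (T - u) = Real.cos m) :
    tau (-1) (u, 0) (T, X) = ENNReal.ofReal m := by
  have hu : u < T := by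
    by_contra! hle
    exact absurd hs (not_lt.2 (Real.sin_nonpos_of_nonpos_of_neg_pi_le (by linarith) h1))
  have hT : T - u < Real.pi / 2 := by
    by_contra! hle
    have h3 := Real.cos_nonpos_of_pi_div_two_le_of_le hle (by linarith)
    have h4 := Real.cos_pos_of_mem_Ioo (x := m) ⟨by linarith, hm'⟩
    linarith [mul_nonpos_of_nonneg_of_nonpos (Real.cosh_pos X).le h3]
  have hlt : Real.cosh X * Real.cos (T - u) < 1 := by
    rw [hc, ← Real.cos_zero]
    exact Real.cos_lt_cos_of_nonneg_of_le_pi le_rfl (by linarith) hm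
  rw [le_antisymm (tau_negOne_le hT) (le_tau_negOne hu hT hlt).2, hc,
    Real.arccos_cos hm.le (by linarith)]

/-- `C` and `S` are the first two coordinates of the third vertex in the quadric model, determined
linearly by its products with the other two vertices. Since `C` is also the product with the point
`0` of the side, the equation `hC` is Stewart's theorem in this plane. Differences of cosines are
products of sines, which `exists_hinge_estimate` compares with their arguments. -/
theorem hingeComparison_negOne : HingeComparison (-1) := by
  intro ε hε
  obtain ⟨δ₀, hδ₀, hest⟩ := exists_hinge_estimate (f := Real.sin)
    (by simpa using Real.hasDerivAt_sin 0) Real.sin_zero hε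
  have hpi := Real.pi_gt_three
  refine ⟨min δ₀ (1 / 2), by positivity, fun u T huT hT => ?_, ?_⟩
  · have h1 : 0 < T - u := sub_pos.2 huT
    have hT' : T - u < Real.pi / 2 := by linarith [min_le_right δ₀ (1 / 2)]
    have hcos : Real.cosh 0 * Real.cos (T - u) < 1 := by
      rw [Real.cosh_zero, one_mul, ← Real.cos_zero]
      exact Real.cos_lt_cos_of_nonneg_of_le_pi le_rfl (by linarith) h1
    have h2 := le_tau_negOne huT hT' hcos
    have h3 := tau_negOne_le (X := 0) hT'
    rw [Real.cosh_zero, one_mul, Real.arccos_cos h1.le (by linarith)] at h2 h3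
    exact ⟨h2.1, le_antisymm h3 h2.2⟩
  intro t ht r hr m hm n hn A hA hAm hnA
  have hest := hest t ⟨ht.1, ht.2.trans_le (min_le_left _ _)⟩ r ⟨hr.1, hr.2.trans_le (min_le_left _ _)⟩
    m ⟨hm.1, hm.2.trans_le (min_le_left _ _)⟩ n ⟨hn.1, hn.2.trans_le (min_le_left _ _)⟩
    A ⟨hA.1, hA.2.trans_le (min_le_left _ _)⟩ hAm hnA
  have hsm : ∀ s, s ∈ Ioo 0 (min δ₀ (1 / 2)) → 0 < s ∧ s < 1 / 2 := fun s hs =>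
    ⟨hs.1, hs.2.trans_le (min_le_right _ _)⟩
  replace ht := hsm t ht
  replace hr := hsm r hr
  replace hm := hsm m hm
  replace hn := hsm n hn
  replace hA := hsm A hA
  have sinpos : ∀ x, 0 < x → x < 3 → 0 < Real.sin x := fun x h1 h2 =>
    Real.sin_pos_of_pos_of_lt_pi h1 (by linarith)
  have cospos : ∀ x, -1 < x → x < 1 → 0 < Real.cos x := fun x h1 h2 =>
    Real.cos_pos_of_mem_Ioo ⟨by linarith, by linarith⟩
  have hsL : 0 < Real.sin (t + r) := sinpos _ (by linarith) (by linarith)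
  have hst := sinpos t ht.1 (by linarith)
  have hsr := sinpos r hr.1 (by linarith)
  have hsm := sinpos m hm.1 (by linarith)
  have hsn := sinpos n hn.1 (by linarith)
  have hct := cospos t (by linarith) (by linarith)
  have hcr := cospos r (by linarith) (by linarith)
  have hcm := cospos m (by linarith) (by linarith)
  have hcn := cospos n (by linarith) (by linarith)
  have hsinL := Real.sin_add t r
  have hcosL := Real.cos_add t r
  have pt := Real.sin_sq_add_cos_sq t
  have pr := Real.sin_sq_add_cos_sq r
  set C := (Real.cos n * Real.sin t + Real.cos m * Real.sin r) / Real.sin (t + r) with hCdef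
  set S := (Real.cos n * Real.cos t - Real.cos m * Real.cos r) / Real.sin (t + r) with hSdef
  have hC : C * Real.sin (t + r) = Real.cos n * Real.sin t + Real.cos m * Real.sin r :=
    div_mul_cancel₀ _ hsL.ne'
  have hS : S * Real.sin (t + r) = Real.cos n * Real.cos t - Real.cos m * Real.cos r :=
    div_mul_cancel₀ _ hsL.ne'
  have hC0 : 0 < C := by positivity
  clear_value C S
  have hm' : C * Real.cos t - S * Real.sin t = Real.cos m := by
    apply mul_right_cancel₀ hsL.ne'
    linear_combination Real.cos t * hC - Real.sin t * hS - Real.cos m * hsinL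
  have hn' : C * Real.cos r + S * Real.sin r = Real.cos n := by
    apply mul_right_cancel₀ hsL.ne'
    linear_combination Real.cos r * hC + Real.sin r * hS - Real.cos n * hsinL
  have hdist : (S * Real.cos t + C * Real.sin t) * Real.sin (t + r) =
      Real.cos n - Real.cos m * Real.cos (t + r) := by
    rw [hcosL]
    linear_combination Real.cos t * hS + Real.sin t * hC + Real.cos n * pt
  have hdisr : (S * Real.cos r - C * Real.sin r) * Real.sin (t + r) =
      Real.cos n * Real.cos (t + r) - Real.cos m := by
    rw [hcosL]
    linear_combination Real.cos r * hS - Real.sin r * hC - Real.cos m * pr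
  -- The Gram determinant, factored as in Heron's formula. Its sign shows that `C ^ 2 + S ^ 2` can
  -- be a value of `cosh X ^ 2`.
  have hgram : (C ^ 2 + S ^ 2 - 1) * Real.sin (t + r) ^ 2 =
      (Real.cos (t + r) - Real.cos (m - n)) * (Real.cos (t + r) - Real.cos (m + n)) := by
    have e : (C ^ 2 + S ^ 2) * Real.sin (t + r) ^ 2 =
        Real.cos m ^ 2 + Real.cos n ^ 2 - 2 * Real.cos m * Real.cos n * Real.cos (t + r) := by
      calc (C ^ 2 + S ^ 2) * Real.sin (t + r) ^ 2
          = (C * Real.sin (t + r)) ^ 2 + (S * Real.sin (t + r)) ^ 2 := by ring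
        _ = _ := by
          rw [hC, hS, hcosL]
          linear_combination Real.cos n ^ 2 * pt + Real.cos m ^ 2 * pr
    rw [Real.cos_sub, Real.cos_add m n]
    linear_combination e - Real.sin_sq_add_cos_sq (t + r) +
      Real.sin n ^ 2 * Real.sin_sq_add_cos_sq m +
      (1 - Real.cos m ^ 2) * Real.sin_sq_add_cos_sq n
  have main : t + r + n ≤ m ∨ m + n ≤ t + r → ∃ T X : ℝ, -(Real.pi / 2) < T ∧
      T < Real.pi / 2 ∧ Real.cosh X * Real.cos T = C ∧ Real.cosh X * Real.sin T = S ∧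
      tau (-1) (-t, 0) (T, X) = ENNReal.ofReal m ∧
      (ENNReal.ofReal A ≤ tau (-1) (0, 0) (T, X) →
        t * ((A - r) ^ 2 - n ^ 2) ≤ (1 + ε) * (r * (m ^ 2 - (A + t) ^ 2))) := by
    intro h
    have hnorm : 1 ≤ C ^ 2 + S ^ 2 := by
      have hmono : ∀ x y, 0 ≤ x → x ≤ y → y ≤ 2 → Real.cos y ≤ Real.cos x := fun x y h1 h2 h3 =>
        Real.cos_le_cos_of_nonneg_of_le_pi h1 (by linarith) h2
      have : 0 ≤ (C ^ 2 + S ^ 2 - 1) * Real.sin (t + r) ^ 2 := by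
        rw [hgram]
        rcases h with h | h
        · exact mul_nonneg
            (sub_nonneg.2 (hmono _ _ (by linarith) (by linarith) (by linarith)))
            (sub_nonneg.2 (hmono _ _ (by linarith) (by linarith) (by linarith)))
        · apply mul_nonneg_of_nonpos_of_nonpos
          · rw [sub_nonpos, ← Real.cos_abs (m - n)]
            exact hmono _ _ (abs_nonneg _) (by rw [abs_le]; constructor <;> linarith) (by linarith)
          · exact sub_nonpos.2 (hmono _ _ (by linarith) (by linarith) (by linarith))
      linarith [nonneg_of_mul_nonneg_left this (by positivity)]
    -- The global coordinates are polar coordinates of `(C, S)`: the modulus is `cosh X` and the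
    -- argument is `T`.
    set z : ℂ := ⟨C, S⟩ with hz
    have hz1 : 1 ≤ ‖z‖ := by
      rw [Complex.norm_eq_sqrt_sq_add_sq]
      exact Real.one_le_sqrt.2 hnorm
    have hX : Real.cosh (Real.arcosh ‖z‖) = ‖z‖ := Real.cosh_arcosh hz1
    have hc := Complex.norm_mul_cos_arg z
    have hs := Complex.norm_mul_sin_arg z
    have harg := abs_lt.1 (Complex.abs_arg_lt_pi_div_two_iff.2 (Or.inl hC0) : |z.arg| < _)
    set T := z.arg
    set X := Real.arcosh ‖z‖
    rw [← hX] at hc hs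
    change _ = C at hc
    change _ = S at hs
    have hch := Real.cosh_pos X
    refine ⟨T, X, harg.1, harg.2, hc, hs, ?_, fun hle => ?_⟩
    · have hT1 : 0 < Real.sin (T - -t) := by
        have h1 : 0 < Real.cos n - Real.cos m * Real.cos (t + r) := by
          have hcL := cospos (t + r) (by linarith) (by linarith)
          rcases h with h | h
          · have h2 : Real.cos m < Real.cos n :=
              Real.cos_lt_cos_of_nonneg_of_le_pi hn.1.le (by linarith) (by linarith)
            linarith [mul_le_of_le_one_right hcm.le (Real.cos_le_one (t + r))]
          · have h2 : Real.cos (t + r - m) ≤ Real.cos n :=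
              Real.cos_le_cos_of_nonneg_of_le_pi hn.1.le (by linarith) (by linarith)
            rw [Real.cos_sub] at h2
            linarith [mul_pos hsL hsm]
        rw [← hdist] at h1
        have h2 := pos_of_mul_pos_left h1 hsL.le
        refine pos_of_mul_pos_right (a := Real.cosh X) ?_ hch.le
        rw [sub_neg_eq_add, Real.sin_add]
        calc 0 < _ := h2
          _ = _ := by rw [← hc, ← hs]; ring
      have hT2 : Real.cosh X * Real.cos (T - -t) = Real.cos m := by
        rw [sub_neg_eq_add, Real.cos_add, ← hm', ← hc, ← hs]; ring
      exact tau_negOne_eq hm.1 (by linarith) (by linarith) (by linarith) hT1 hT2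
    · have h1 := hle.trans (tau_negOne_le (by simpa using harg.2))
      rw [sub_zero, hc, ENNReal.ofReal_le_ofReal_iff (Real.arccos_nonneg _)] at h1
      -- Otherwise `arccos C` would be `0`, less than `A`.
      have hC1 : C ≤ 1 := by
        by_contra! hlt
        rw [Real.arccos_of_one_le hlt.le] at h1
        linarith [hA.1]
      have h2 := Real.cos_le_cos_of_nonneg_of_le_pi hA.1.le (Real.arccos_le_pi _) h1
      rw [Real.cos_arccos (by linarith) hC1] at h2
      apply hest
      rw [← cos_sub_cos_eq, ← cos_sub_cos_eq, Real.cos_abs]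
      have h3 := mul_le_mul_of_nonneg_right h2 hsL.le
      rw [hC, hsinL] at h3
      rw [Real.cos_sub, Real.cos_add]
      linarith
  refine ⟨fun h => ?_, fun h => ?_⟩
  · obtain ⟨T, X, hT1, hT2, hc, hs, h1, h2⟩ := main (Or.inl h)
    refine ⟨(T, X), h1, ?_, h2⟩
    have hch := Real.cosh_pos X
    have hT3 : 0 < Real.sin (T - r) := by
      have h1 : 0 < Real.cos n * Real.cos (t + r) - Real.cos m := by
        have h2 : Real.cos m ≤ Real.cos (t + r + n) :=
          Real.cos_le_cos_of_nonneg_of_le_pi (by linarith) (by linarith) h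
        rw [Real.cos_add (t + r) n] at h2
        linarith [mul_pos hsL hsn]
      rw [← hdisr] at h1
      have h2 := pos_of_mul_pos_left h1 hsL.le
      refine pos_of_mul_pos_right (a := Real.cosh X) ?_ hch.le
      rw [Real.sin_sub]
      calc 0 < _ := h2
        _ = _ := by rw [← hc, ← hs]; ring
    have hT4 : Real.cosh X * Real.cos (T - r) = Real.cos n := by
      rw [Real.cos_sub, ← hn', ← hc, ← hs]; ring
    exact tau_negOne_eq hn.1 (by linarith) (by linarith) (by linarith) hT3 hT4
  · obtain ⟨T, X, hT1, hT2, hc, hs, h1, h2⟩ := main (Or.inr h)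
    refine ⟨(T, X), h1, ?_, h2⟩
    have hch := Real.cosh_pos X
    have hT3 : 0 < Real.sin (r - T) := by
      have h1 : 0 < Real.cos m - Real.cos n * Real.cos (t + r) := by
        have h2 : Real.cos (t + r - n) ≤ Real.cos m :=
          Real.cos_le_cos_of_nonneg_of_le_pi (by linarith) (by linarith) (by linarith)
        rw [Real.cos_sub (t + r) n] at h2
        linarith [mul_pos hsL hsn]
      have h3 : (C * Real.sin r - S * Real.cos r) * Real.sin (t + r) =
        Real.cos m - Real.cos n * Real.cos (t + r) := by linear_combination -hdisr
      rw [← h3] at h1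
      have h2 := pos_of_mul_pos_left h1 hsL.le
      refine pos_of_mul_pos_right (a := Real.cosh X) ?_ hch.le
      rw [Real.sin_sub]
      calc 0 < _ := h2
        _ = _ := by rw [← hc, ← hs]; ring
    have hT4 : Real.cosh X * Real.cos (r - T) = Real.cos n := by
      rw [Real.cos_sub, ← hn', ← hc, ← hs]; ring
    rw [← tau_neg]
    have e : -T - -r = r - T := by ring
    simpa using tau_negOne_eq (u := -r) (T := -T) (X := -X) hn.1 (by linarith) (by linarith)
      (by linarith) (by rwa [e]) (by rwa [e, Real.cosh_neg])

end KPlane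

/-! ### Hinges in the de Sitter plane, and the conclusion for all curvatures -/

namespace KPlane

theorem tau_one_eq {u T X m : ℝ} (hm : 0 < m) (hu : u < T) (hX : |X| ≤ Real.pi)
    (hc : Real.cosh u * Real.cosh T * Real.cos X - Real.sinh u * Real.sinh T = Real.cosh m) :
    tau 1 (u, 0) (T, X) = ENNReal.ofReal m := by
  have h1 : 1 < Real.cosh m := Real.one_lt_cosh.2 hm.ne'
  have h2 := tau_one_le (u := u) (T := T) (X := X)
  have h3 := (le_tau_one hu hX (by rwa [hc])).2
  rw [hc, max_eq_left h1.le, Real.arcosh_cosh hm.le] at h2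
  rw [hc, Real.arcosh_cosh hm.le] at h3
  exact le_antisymm h2 h3

/-- The hyperbolic counterpart of the anti-de Sitter computation: `hC` is again Stewart's theorem,
and the third vertex exists because `C ^ 2 ≤ 1 + S ^ 2`, with `S = sinh T` and `C = cosh T * cos X`.
-/
theorem hingeComparison_one : HingeComparison 1 := by
  intro ε hε
  obtain ⟨δ, hδ, hest⟩ := exists_hinge_estimate (f := Real.sinh)
    (by simpa using Real.hasDerivAt_sinh 0) Real.sinh_zero hε
  have hpi := Real.pi_pos
  refine ⟨δ, hδ, fun u T huT hT => ?_, ?_⟩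
  · have h1 : 0 < T - u := sub_pos.2 huT
    have hc : Real.cosh u * Real.cosh T * Real.cos 0 - Real.sinh u * Real.sinh T =
        Real.cosh (T - u) := by
      rw [Real.cos_zero, Real.cosh_sub]; ring
    refine ⟨(le_tau_one huT (by simpa using hpi.le) ?_).1,
      tau_one_eq h1 huT (by simpa using hpi.le) hc⟩
    rw [hc]
    exact Real.one_lt_cosh.2 h1.ne'
  intro t ht r hr m hm n hn A hA hAm hnA
  have hest := hest t ht r hr m hm n hn A hA hAm hnA
  simp only [mem_Ioo] at ht hr hm hn hA
  have hsL : 0 < Real.sinh (t + r) := Real.sinh_pos_iff.2 (by linarith)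
  have hst := Real.sinh_pos_iff.2 ht.1
  have hsr := Real.sinh_pos_iff.2 hr.1
  have hsm := Real.sinh_pos_iff.2 hm.1
  have hsn := Real.sinh_pos_iff.2 hn.1
  have hct := Real.cosh_pos t
  have hcr := Real.cosh_pos r
  have hcm := Real.cosh_pos m
  have hcn := Real.cosh_pos n
  have hsinL := Real.sinh_add t r
  have hcosL := Real.cosh_add t r
  have pt := Real.cosh_sq t
  have pr := Real.cosh_sq r
  set C := (Real.cosh n * Real.sinh t + Real.cosh m * Real.sinh r) / Real.sinh (t + r) with hCdef
  set S := (Real.cosh m * Real.cosh r - Real.cosh n * Real.cosh t) / Real.sinh (t + r) with hSdef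
  have hC : C * Real.sinh (t + r) = Real.cosh n * Real.sinh t + Real.cosh m * Real.sinh r :=
    div_mul_cancel₀ _ hsL.ne'
  have hS : S * Real.sinh (t + r) = Real.cosh m * Real.cosh r - Real.cosh n * Real.cosh t :=
    div_mul_cancel₀ _ hsL.ne'
  have hC0 : 0 < C := by positivity
  clear_value C S
  have hm' : C * Real.cosh t + S * Real.sinh t = Real.cosh m := by
    apply mul_right_cancel₀ hsL.ne'
    linear_combination Real.cosh t * hC + Real.sinh t * hS - Real.cosh m * hsinL
  have hn' : C * Real.cosh r - S * Real.sinh r = Real.cosh n := by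
    apply mul_right_cancel₀ hsL.ne'
    linear_combination Real.cosh r * hC - Real.sinh r * hS - Real.cosh n * hsinL
  have hgram : (C ^ 2 - S ^ 2 - 1) * Real.sinh (t + r) ^ 2 =
      (Real.cosh (m + n) - Real.cosh (t + r)) * (Real.cosh (t + r) - Real.cosh (m - n)) := by
    have e : (C ^ 2 - S ^ 2) * Real.sinh (t + r) ^ 2 =
        2 * Real.cosh m * Real.cosh n * Real.cosh (t + r) - Real.cosh m ^ 2 - Real.cosh n ^ 2 := by
      calc (C ^ 2 - S ^ 2) * Real.sinh (t + r) ^ 2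
          = (C * Real.sinh (t + r)) ^ 2 - (S * Real.sinh (t + r)) ^ 2 := by ring
        _ = _ := by
          rw [hC, hS, hcosL]
          linear_combination (-Real.cosh n ^ 2) * pt - Real.cosh m ^ 2 * pr
    rw [Real.cosh_sub, Real.cosh_add m n]
    linear_combination e + Real.cosh_sq (t + r) +
      Real.sinh n ^ 2 * Real.cosh_sq m + (Real.cosh m ^ 2 - 1) * Real.cosh_sq n
  have main : t + r + n ≤ m ∨ m + n ≤ t + r → ∃ T X : ℝ, |X| ≤ Real.pi ∧ Real.sinh T = S ∧
      (∀ u, Real.cosh u * Real.cosh T * Real.cos X - Real.sinh u * Real.sinh T =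
        C * Real.cosh u - S * Real.sinh u) ∧
      (-t < T → tau 1 (-t, 0) (T, X) = ENNReal.ofReal m) ∧
      (ENNReal.ofReal A ≤ tau 1 (0, 0) (T, X) →
        t * ((A - r) ^ 2 - n ^ 2) ≤ (1 + ε) * (r * (m ^ 2 - (A + t) ^ 2))) := by
    intro h
    have hnorm : C ^ 2 ≤ 1 + S ^ 2 := by
      have : (C ^ 2 - S ^ 2 - 1) * Real.sinh (t + r) ^ 2 ≤ 0 := by
        rw [hgram]
        rcases h with h | h
        · apply mul_nonpos_of_nonneg_of_nonpos <;> simp only [sub_nonneg, sub_nonpos] <;>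
            apply Real.cosh_le_cosh.2 <;> apply abs_le_abs <;> linarith
        · apply mul_nonpos_of_nonpos_of_nonneg <;> simp only [sub_nonneg, sub_nonpos] <;>
            apply Real.cosh_le_cosh.2 <;> apply abs_le_abs <;> linarith
      by_contra! hlt
      have : 0 < (C ^ 2 - S ^ 2 - 1) * Real.sinh (t + r) ^ 2 :=
        mul_pos (by linarith) (by positivity)
      linarith
    have hch : Real.cosh (Real.arsinh S) = √(1 + S ^ 2) := Real.cosh_arsinh S
    have hr0 : 0 < √(1 + S ^ 2) := Real.sqrt_pos.2 (by positivity)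
    have hCle : C / √(1 + S ^ 2) ≤ 1 :=
      (div_le_one hr0).2 (Real.le_sqrt_of_sq_le hnorm)
    have hCge : -1 ≤ C / √(1 + S ^ 2) := by
      have : 0 < C / √(1 + S ^ 2) := by positivity
      linarith
    have hF : ∀ u, Real.cosh u * Real.cosh (Real.arsinh S) *
        Real.cos (Real.arccos (C / √(1 + S ^ 2))) - Real.sinh u * Real.sinh (Real.arsinh S) =
          C * Real.cosh u - S * Real.sinh u := fun u => by
      rw [hch, Real.cos_arccos hCge hCle, Real.sinh_arsinh]
      field_simp
    have hX : |Real.arccos (C / √(1 + S ^ 2))| ≤ Real.pi := by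
      rw [abs_of_nonneg (Real.arccos_nonneg _)]
      exact Real.arccos_le_pi _
    refine ⟨Real.arsinh S, Real.arccos (C / √(1 + S ^ 2)), hX, Real.sinh_arsinh S, hF, fun hT => ?_,
      fun hle => ?_⟩
    · refine tau_one_eq hm.1 hT hX ?_
      rw [hF, Real.cosh_neg, Real.sinh_neg, ← hm']; ring
    · have h1 := hle.trans tau_one_le
      rw [hF, Real.cosh_zero, Real.sinh_zero, mul_one, mul_zero, sub_zero,
        ENNReal.ofReal_le_ofReal_iff (Real.arcosh_nonneg (le_max_right _ _))] at h1
      have h2 := Real.cosh_le_cosh.2 (abs_le_abs_of_nonneg hA.1.le h1)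
      rw [Real.cosh_arcosh (le_max_right _ _)] at h2
      -- As `A > 0`, the bound is not the trivial entry `1` of the maximum.
      have h3 : Real.cosh A ≤ C :=
        (le_max_iff.1 h2).resolve_right (not_le.2 (Real.one_lt_cosh.2 hA.1.ne'))
      apply hest
      rw [← cosh_sub_cosh_eq, ← cosh_sub_cosh_eq, Real.cosh_abs]
      have h3 := mul_le_mul_of_nonneg_right h3 hsL.le
      rw [hC, hsinL] at h3
      rw [Real.cosh_sub, Real.cosh_add]
      linarith
  have hlt : ∀ x y, x * Real.sinh (t + r) < y * Real.sinh (t + r) → x < y := fun x y h =>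
    lt_of_mul_lt_mul_right h hsL.le
  refine ⟨fun h => ?_, fun h => ?_⟩
  · obtain ⟨T, X, hX, hT, hF, h1, h2⟩ := main (Or.inl h)
    -- Since `sinh T = S`, the time order is a comparison of `S` with `sinh r`, which is made after
    -- multiplication by `sinh (t + r)`.
    have hrT : r < T := by
      rw [← Real.sinh_lt_sinh, hT]
      apply hlt
      have h3 := Real.cosh_le_cosh.2 (abs_le_abs_of_nonneg (show 0 ≤ t + r + n by linarith) h)
      rw [Real.cosh_add (t + r) n] at h3
      have h4 := mul_le_mul_of_nonneg_right h3 hcr.le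
      have h5 := mul_pos (mul_pos hsL hsn) hcr
      have h6 : Real.cosh (t + r) * Real.cosh r - Real.cosh t =
          Real.sinh (t + r) * Real.sinh r := by
        rw [hcosL, hsinL]
        linear_combination Real.cosh t * pr
      have h7 : Real.sinh (t + r) * Real.sinh r ≤
          Real.cosh n * (Real.sinh (t + r) * Real.sinh r) :=
        le_mul_of_one_le_left (by positivity) (Real.one_le_cosh n)
      rw [hS]
      linear_combination h4 + h5 + h7 - Real.cosh n * h6
    refine ⟨(T, X), h1 (by linarith), tau_one_eq hn.1 hrT hX ?_, h2⟩
    rw [hF, hn']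
  · obtain ⟨T, X, hX, hT, hF, h1, h2⟩ := main (Or.inr h)
    have htT : -t < T := by
      rw [← Real.sinh_lt_sinh, hT]
      apply hlt
      have h3 := Real.cosh_le_cosh.2 (abs_le_abs_of_nonneg hn.1.le (show n ≤ t + r - m by linarith))
      rw [Real.cosh_sub (t + r) m] at h3
      have h4 := mul_le_mul_of_nonneg_right h3 hct.le
      have h6 : Real.cosh (t + r) * Real.cosh t - Real.cosh r =
          Real.sinh (t + r) * Real.sinh t := by
        rw [hcosL, hsinL]
        linear_combination Real.cosh r * pt
      have h7 : Real.sinh (t - m) * Real.sinh (t + r) < Real.sinh t * Real.sinh (t + r) :=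
        mul_lt_mul_of_pos_right (Real.sinh_lt_sinh.2 (by linarith)) hsL
      rw [Real.sinh_sub] at h7
      rw [hS, Real.sinh_neg]
      linear_combination h4 + h7 + Real.cosh m * h6
    have hTr : T < r := by
      rw [← Real.sinh_lt_sinh, hT]
      apply hlt
      have h3 := Real.cosh_le_cosh.2 (abs_le_abs_of_nonneg hm.1.le (show m ≤ t + r - n by linarith))
      rw [Real.cosh_sub (t + r) n] at h3
      have h4 := mul_le_mul_of_nonneg_right h3 hcr.le
      have h6 : Real.cosh (t + r) * Real.cosh r - Real.cosh t =
          Real.sinh (t + r) * Real.sinh r := by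
        rw [hcosL, hsinL]
        linear_combination Real.cosh t * pr
      have h7 : Real.sinh (r - n) * Real.sinh (t + r) < Real.sinh r * Real.sinh (t + r) :=
        mul_lt_mul_of_pos_right (Real.sinh_lt_sinh.2 (by linarith)) hsL
      rw [Real.sinh_sub] at h7
      rw [hS]
      linear_combination h4 + h7 + Real.cosh n * h6
    refine ⟨(T, X), h1 htT, ?_, h2⟩
    rw [← tau_neg]
    have := tau_one_eq (u := -r) (T := -T) (X := -X) hn.1 (by linarith) (by rwa [abs_neg])
      (by
        have := hF r
        rw [hn'] at this
        rw [Real.cosh_neg, Real.cosh_neg, Real.cos_neg, Real.sinh_neg, Real.sinh_neg, neg_mul_neg,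
          this])
    simpa using this

theorem hingeComparison (K : ℝ) : HingeComparison K := by
  rcases lt_trichotomy K 0 with h | rfl | h
  · exact hingeComparison_negOne.scale (Real.sqrt_pos.2 (neg_pos.2 h))
      (by rw [Real.sq_sqrt (by linarith)]; ring)
  · exact hingeComparison_zero
  · exact hingeComparison_one.scale (Real.sqrt_pos.2 h) (by rw [Real.sq_sqrt h.le]; ring)

theorem diam_pos (K : ℝ) : 0 < diam K := by
  unfold diam
  split_ifs with h
  · have := Real.sqrt_pos.2 (neg_pos.2 h)
    have := Real.pi_pos
    simpa using by positivity
  · exact ENNReal.zero_lt_top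

end KPlane

/-! ### Equations and causal relations read off from model time separations -/

namespace KPlane

theorem Causal.sq_eq_of_tau_eq {p q : ℝ × ℝ} {d : ℝ} (h : Causal 0 p q) (hd : 0 ≤ d)
    (ht : tau 0 p q = ENNReal.ofReal d) : (q.1 - p.1) ^ 2 - (q.2 - p.2) ^ 2 = d ^ 2 := by
  have h1 := h.abs_sub_le
  have h2 := (causal_zero_and_tau_zero h1).2
  have h3 : 0 ≤ (q.1 - p.1) ^ 2 - (q.2 - p.2) ^ 2 := by
    have := pow_le_pow_left₀ (abs_nonneg _) h1 2
    rw [sq_abs] at this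
    linarith
  rw [ht, ENNReal.ofReal_eq_ofReal_iff hd (Real.sqrt_nonneg _)] at h2
  rw [h2, Real.sq_sqrt h3]

theorem causal_of_tau_eq {K d : ℝ} {p q : ℝ × ℝ} (hd : 0 < d)
    (h : tau K p q = ENNReal.ofReal d) : Causal K p q := by
  by_contra hc
  have : tau K p q = 0 := by
    apply le_antisymm _ bot_le
    exact iSup₂_le fun c hcurve => absurd (Or.inr ⟨c, hcurve⟩) hc
  rw [this] at h
  exact hd.not_ge (ENNReal.ofReal_eq_zero.1 h.symm)

end KPlane

namespace LorentzianPreLengthSpace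

variable {X : Type*} [MetricSpace X] {L : LorentzianPreLengthSpace X}

/-! ### Elementary causality -/

theorem chron_of_chron_of_causal {p q r : X} (h1 : L.chron p q) (h2 : L.causal q r) :
    L.chron p r := by
  rw [← L.tau_pos_iff] at h1 ⊢
  calc 0 < L.tau p q := h1
    _ ≤ L.tau p q + L.tau q r := le_self_add
    _ ≤ _ := L.reverse_triangle _ _ _ (L.causal_of_chron _ _ ((L.tau_pos_iff _ _).1 h1)) h2

/-- The reverse triangle inequality gives `2 τ(p, p) ≤ τ(p, p)`, and this value is finite. -/
theorem tau_self_eq_zero (hfin : L.LocallyFiniteValued) (p : X) : L.tau p p = 0 := by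
  obtain ⟨U, hU, h⟩ := hfin p
  have hlt := h p (mem_of_mem_nhds hU) p (mem_of_mem_nhds hU)
  have := L.reverse_triangle p p p (L.causal_refl p) (L.causal_refl p)
  by_contra h0
  exact absurd this (not_le.2 (ENNReal.lt_add_right hlt.ne h0))

theorem not_causal_of_chron (hfin : L.LocallyFiniteValued) {p q : X} (h : L.chron p q) :
    ¬L.causal q p := fun hc => by
  have := (L.tau_pos_iff _ _).2 (chron_of_chron_of_causal h hc)
  rw [tau_self_eq_zero hfin] at this
  exact lt_irrefl _ this

theorem reverse_triangle_real {p q r : X} {a b c : ℝ} (hpq : L.causal p q) (hqr : L.causal q r)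
    (ha : L.tau p q = ENNReal.ofReal a) (hb : L.tau q r = ENNReal.ofReal b)
    (hc : L.tau p r = ENNReal.ofReal c) (ha0 : 0 ≤ a) (hb0 : 0 ≤ b) (hc0 : 0 ≤ c) :
    a + b ≤ c := by
  have := L.reverse_triangle p q r hpq hqr
  rwa [ha, hb, hc, ← ENNReal.ofReal_add ha0 hb0, ENNReal.ofReal_le_ofReal_iff hc0] at this

theorem chron_of_tau_eq {p q : X} {a : ℝ} (ha : 0 < a) (h : L.tau p q = ENNReal.ofReal a) :
    L.chron p q := by
  rw [← L.tau_pos_iff, h]; simpa using ha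

/-! ### The law of cosines for comparison angles -/

/-- `p` and `q` are causally related, in one order or the other, with time separation `d`. -/
def HasSeparation (L : LorentzianPreLengthSpace X) (p q : X) (d : ℝ) : Prop :=
  0 ≤ d ∧ ((L.causal p q ∧ L.tau p q = ENNReal.ofReal d) ∨
    (L.causal q p ∧ L.tau q p = ENNReal.ofReal d))

theorem HasSeparation.sq_eq {p q : X} {d : ℝ} {a b : ℝ × ℝ} (h : L.HasSeparation p q d)
    (h1 : L.Corresponds p q a b) (h2 : L.Corresponds q p b a) :
    (b.1 - a.1) ^ 2 - (b.2 - a.2) ^ 2 = d ^ 2 := by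
  obtain ⟨hd, ⟨hc, ht⟩ | ⟨hc, ht⟩⟩ := h
  · exact (h1 hc).1.sq_eq_of_tau_eq hd ((h1 hc).2.trans ht)
  · rw [← (h2 hc).1.sq_eq_of_tau_eq hd ((h2 hc).2.trans ht)]; ring

/-- The Minkowski law of cosines by polarization. The absolute value makes the formula the same for
all time orientations of the sides. -/
theorem IsComparisonAngle.eq_arcosh {x y z : X} {A G n ω : ℝ} (hA : L.HasSeparation x y A)
    (hG : L.HasSeparation x z G) (hn : L.HasSeparation y z n) (h : L.IsComparisonAngle x y z ω) :
    ω = Real.arcosh (|A ^ 2 + G ^ 2 - n ^ 2| / (2 * A * G)) := by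
  obtain ⟨a, b, c, h1, h2, h3, h4, h5, h6, rfl⟩ := h
  have e1 := hA.sq_eq h1 h2
  have e2 := hG.sq_eq h3 h4
  have e3 := hn.sq_eq h5 h6
  simp only [KPlane.flatAngle, KPlane.metric_zero, Prod.fst_sub, Prod.snd_sub]
  have f1 : -((b.1 - a.1) * (b.1 - a.1)) + (b.2 - a.2) * (b.2 - a.2) = -A ^ 2 := by
    linear_combination -e1
  have f2 : -((c.1 - a.1) * (c.1 - a.1)) + (c.2 - a.2) * (c.2 - a.2) = -G ^ 2 := by
    linear_combination -e2
  have f3 : -((b.1 - a.1) * (c.1 - a.1)) + (b.2 - a.2) * (c.2 - a.2) =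
      -((A ^ 2 + G ^ 2 - n ^ 2) / 2) := by
    linear_combination (e3 - e1 - e2) / 2
  rw [f1, f2, f3, abs_neg, abs_neg, abs_neg, abs_of_nonneg (sq_nonneg A),
    abs_of_nonneg (sq_nonneg G), Real.sqrt_sq hA.1, Real.sqrt_sq hG.1, abs_div, abs_two, div_div,
    ← mul_assoc]

theorem comparisonAngle_eq_arcosh {x y z : X} {A G n : ℝ} (hA : L.HasSeparation x y A)
    (hG : L.HasSeparation x z G) (hn : L.HasSeparation y z n)
    (h : ∃ ω, L.IsComparisonAngle x y z ω) :
    L.comparisonAngle x y z = Real.arcosh (|A ^ 2 + G ^ 2 - n ^ 2| / (2 * A * G)) := by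
  rw [comparisonAngle, dif_pos h]
  exact h.choose_spec.eq_arcosh hA hG hn

theorem isComparisonAngle_comm (x y z : X) :
    L.IsComparisonAngle x y z = L.IsComparisonAngle x z y := by
  have key : ∀ y z ω, L.IsComparisonAngle x y z ω → L.IsComparisonAngle x z y ω := by
    rintro y z ω ⟨a, b, c, h1, h2, h3, h4, h5, h6, rfl⟩
    refine ⟨a, c, b, h3, h4, h1, h2, h6, h5, ?_⟩
    simp only [KPlane.flatAngle, KPlane.metric_zero]
    rw [mul_comm (√_), mul_comm (b - a).1, mul_comm (b - a).2]
  exact funext fun ω => propext ⟨key _ _ _, key _ _ _⟩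

/-- The angle is a choice from a predicate, so equality of the two predicates gives symmetry without
any uniqueness. -/
theorem comparisonAngle_comm (x y z : X) : L.comparisonAngle x y z = L.comparisonAngle x z y := by
  have h := isComparisonAngle_comm (L := L) x y z
  unfold comparisonAngle
  revert h
  generalize L.IsComparisonAngle x y z = P
  generalize L.IsComparisonAngle x z y = Q
  rintro rfl
  rfl

theorem corresponds_of_abs_le {p q : X} {d : ℝ} {a b : ℝ × ℝ}
    (h : L.tau p q = ENNReal.ofReal d) (hd : 0 ≤ d) (hab : |b.2 - a.2| ≤ b.1 - a.1)
    (hsq : (b.1 - a.1) ^ 2 - (b.2 - a.2) ^ 2 = d ^ 2) : L.Corresponds p q a b := fun _ => by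
  have := KPlane.causal_zero_and_tau_zero hab
  rw [hsq, Real.sqrt_sq hd] at this
  exact ⟨this.1, this.2.trans h.symm⟩

variable {x y z : X} {A G n φ : ℝ}

/-- Without a comparison triangle the angle has the default value `0`, and an upper bound for it
would carry no information. With `y` on the time axis, the time coordinate `w` of `z` is forced by
the law of cosines, and `w ≥ G` is the reverse triangle inequality. -/
theorem exists_comparisonAngle_of_future (hfin : L.LocallyFiniteValued) (hA0 : 0 < A) (hG0 : 0 < G)
    (hn0 : 0 < n) (hA : L.tau x y = ENNReal.ofReal A) (hG : L.tau x z = ENNReal.ofReal G)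
    (hn : L.tau y z = ENNReal.ofReal n) : ∃ ω, L.IsComparisonAngle x y z ω := by
  have cxy := chron_of_tau_eq hA0 hA
  have cxz := chron_of_tau_eq hG0 hG
  have cyz := chron_of_tau_eq hn0 hn
  have htri := reverse_triangle_real (L.causal_of_chron _ _ cxy) (L.causal_of_chron _ _ cyz)
    hA hn hG hA0.le hn0.le hG0.le
  set w := (A ^ 2 + G ^ 2 - n ^ 2) / (2 * A) with hw
  have hw' : w * (2 * A) = A ^ 2 + G ^ 2 - n ^ 2 := div_mul_cancel₀ _ (by positivity)
  have hwG : G ≤ w := by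
    rw [hw, le_div_iff₀ (by positivity)]
    have := pow_le_pow_left₀ hn0.le (show n ≤ G - A by linarith) 2
    linarith
  have hs : √(w ^ 2 - G ^ 2) ^ 2 = w ^ 2 - G ^ 2 :=
    Real.sq_sqrt (sub_nonneg.2 (pow_le_pow_left₀ hG0.le hwG 2))
  refine ⟨_, (0, 0), (A, 0), (w, √(w ^ 2 - G ^ 2)), ?_, ?_, ?_, ?_, ?_, ?_, rfl⟩
  · exact corresponds_of_abs_le hA hA0.le (by simpa using hA0.le) (by simp)
  · exact fun h => absurd h (not_causal_of_chron hfin cxy)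
  · refine corresponds_of_abs_le hG hG0.le ?_ ?_
    · simp only [sub_zero]
      apply abs_le_of_sq_le_sq _ (by linarith)
      rw [hs]; linarith [sq_nonneg G]
    · simp only [sub_zero]; rw [hs]; ring
  · exact fun h => absurd h (not_causal_of_chron hfin cxz)
  · have e : (w - A) ^ 2 - √(w ^ 2 - G ^ 2) ^ 2 = n ^ 2 := by rw [hs]; linear_combination -hw'
    refine corresponds_of_abs_le hn hn0.le ?_ ?_
    · simp only [sub_zero]
      apply abs_le_of_sq_le_sq _ (by linarith)
      linarith [sq_nonneg n]
    · simpa only [sub_zero] using e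
  · exact fun h => absurd h (not_causal_of_chron hfin cyz)

theorem exists_comparisonAngle_of_past (hfin : L.LocallyFiniteValued) (hA0 : 0 < A) (hG0 : 0 < G)
    (hn0 : 0 < n) (hA : L.tau x y = ENNReal.ofReal A) (hG : L.tau z x = ENNReal.ofReal G)
    (hn : L.tau z y = ENNReal.ofReal n) : ∃ ω, L.IsComparisonAngle x y z ω := by
  have cxy := chron_of_tau_eq hA0 hA
  have czx := chron_of_tau_eq hG0 hG
  have czy := chron_of_tau_eq hn0 hn
  have htri := reverse_triangle_real (L.causal_of_chron _ _ czx) (L.causal_of_chron _ _ cxy)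
    hG hA hn hG0.le hA0.le hn0.le
  set w := (n ^ 2 - A ^ 2 - G ^ 2) / (2 * A) with hw
  have hw' : w * (2 * A) = n ^ 2 - A ^ 2 - G ^ 2 := div_mul_cancel₀ _ (by positivity)
  have hwG : G ≤ w := by
    rw [hw, le_div_iff₀ (by positivity)]
    have := pow_le_pow_left₀ (by linarith) htri 2
    linarith
  have hs : √(w ^ 2 - G ^ 2) ^ 2 = w ^ 2 - G ^ 2 :=
    Real.sq_sqrt (sub_nonneg.2 (pow_le_pow_left₀ hG0.le hwG 2))
  refine ⟨_, (0, 0), (A, 0), (-w, √(w ^ 2 - G ^ 2)), ?_, ?_, ?_, ?_, ?_, ?_, rfl⟩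
  · exact corresponds_of_abs_le hA hA0.le (by simpa using hA0.le) (by simp)
  · exact fun h => absurd h (not_causal_of_chron hfin cxy)
  · exact fun h => absurd h (not_causal_of_chron hfin czx)
  · refine corresponds_of_abs_le hG hG0.le ?_ ?_
    · simp only [zero_sub, neg_neg, abs_neg]
      apply abs_le_of_sq_le_sq _ (by linarith)
      rw [hs]; linarith [sq_nonneg G]
    · simp only [zero_sub, neg_neg, neg_sq]; rw [hs]; ring
  · exact fun h => absurd h (not_causal_of_chron hfin czy)
  · have e : (A + w) ^ 2 - √(w ^ 2 - G ^ 2) ^ 2 = n ^ 2 := by rw [hs]; linear_combination hw'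
    refine corresponds_of_abs_le hn hn0.le ?_ ?_
    · simp only [zero_sub, sub_neg_eq_add, abs_neg]
      apply abs_le_of_sq_le_sq _ (by linarith)
      linarith [sq_nonneg n]
    · simpa only [zero_sub, sub_neg_eq_add, neg_sq] using e

/-- An upper bound of the comparison angle between two points in the future of `x` bounds their
time separation below. -/
theorem lt_sq_of_comparisonAngle_lt_of_future (hfin : L.LocallyFiniteValued) (hA0 : 0 < A)
    (hG0 : 0 < G) (hn0 : 0 < n) (hA : L.tau x y = ENNReal.ofReal A)
    (hG : L.tau x z = ENNReal.ofReal G) (hn : L.tau y z = ENNReal.ofReal n) (hφ : 0 ≤ φ)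
    (h : L.comparisonAngle x y z < φ) :
    A ^ 2 + G ^ 2 - 2 * A * G * Real.cosh φ < n ^ 2 := by
  have cxy := L.causal_of_chron _ _ (chron_of_tau_eq hA0 hA)
  have cxz := L.causal_of_chron _ _ (chron_of_tau_eq hG0 hG)
  have cyz := L.causal_of_chron _ _ (chron_of_tau_eq hn0 hn)
  have htri := reverse_triangle_real cxy cyz hA hn hG hA0.le hn0.le hG0.le
  rw [comparisonAngle_eq_arcosh ⟨hA0.le, Or.inl ⟨cxy, hA⟩⟩ ⟨hG0.le, Or.inl ⟨cxz, hG⟩⟩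
    ⟨hn0.le, Or.inl ⟨cyz, hn⟩⟩ (exists_comparisonAngle_of_future hfin hA0 hG0 hn0 hA hG hn),
    ← Real.arcosh_cosh hφ] at h
  have h1 : 2 * A * G ≤ A ^ 2 + G ^ 2 - n ^ 2 := by
    have := pow_le_pow_left₀ hn0.le (show n ≤ G - A by linarith) 2
    linarith
  have h2 : 0 < 2 * A * G := by positivity
  rw [abs_of_pos (by linarith), Real.arcosh_lt_arcosh (div_pos (by linarith) h2)
    (Real.cosh_pos _), div_lt_iff₀ h2] at h
  linarith

/-- A lower bound of the comparison angle between two points in the future of `x` bounds their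
time separation above. -/
theorem sq_lt_of_lt_comparisonAngle_of_future (hA0 : 0 < A)
    (hG0 : 0 < G) (hn0 : 0 ≤ n) (hA : L.tau x y = ENNReal.ofReal A)
    (hG : L.tau x z = ENNReal.ofReal G) (cyz : L.causal y z) (hn : L.tau y z = ENNReal.ofReal n)
    (hφ : 0 ≤ φ) (h : φ < L.comparisonAngle x y z) :
    n ^ 2 < A ^ 2 + G ^ 2 - 2 * A * G * Real.cosh φ := by
  have cxy := L.causal_of_chron _ _ (chron_of_tau_eq hA0 hA)
  have cxz := L.causal_of_chron _ _ (chron_of_tau_eq hG0 hG)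
  have htri := reverse_triangle_real cxy cyz hA hn hG hA0.le hn0 hG0.le
  -- The default value `0` does not exceed `φ`, so the lower bound itself provides a comparison
  -- triangle. This includes `n = 0`, that is, `y` and `z` null related.
  have hex : ∃ ω, L.IsComparisonAngle x y z ω := by
    by_contra hne
    rw [comparisonAngle, dif_neg hne] at h
    linarith
  rw [comparisonAngle_eq_arcosh ⟨hA0.le, Or.inl ⟨cxy, hA⟩⟩ ⟨hG0.le, Or.inl ⟨cxz, hG⟩⟩
    ⟨hn0, Or.inl ⟨cyz, hn⟩⟩ hex, ← Real.arcosh_cosh hφ] at h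
  have h1 : 2 * A * G ≤ A ^ 2 + G ^ 2 - n ^ 2 := by
    have := pow_le_pow_left₀ hn0 (show n ≤ G - A by linarith) 2
    linarith
  have h2 : 0 < 2 * A * G := by positivity
  rw [abs_of_pos (by linarith), Real.arcosh_lt_arcosh (Real.cosh_pos _)
    (div_pos (by linarith) h2), lt_div_iff₀ h2] at h
  linarith

theorem comparisonAngle_of_past (hfin : L.LocallyFiniteValued) (hA0 : 0 < A) (hG0 : 0 < G)
    (hn0 : 0 < n) (hA : L.tau x y = ENNReal.ofReal A) (hG : L.tau z x = ENNReal.ofReal G)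
    (hn : L.tau z y = ENNReal.ofReal n) :
    0 < n ^ 2 - A ^ 2 - G ^ 2 ∧
      L.comparisonAngle x y z = Real.arcosh ((n ^ 2 - A ^ 2 - G ^ 2) / (2 * A * G)) := by
  have cxy := L.causal_of_chron _ _ (chron_of_tau_eq hA0 hA)
  have czx := L.causal_of_chron _ _ (chron_of_tau_eq hG0 hG)
  have czy := L.causal_of_chron _ _ (chron_of_tau_eq hn0 hn)
  have htri := reverse_triangle_real czx cxy hG hA hn hG0.le hA0.le hn0.le
  have h1 : 0 < n ^ 2 - A ^ 2 - G ^ 2 := by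
    have := pow_le_pow_left₀ (by linarith) htri 2
    have := mul_pos hA0 hG0
    linarith
  refine ⟨h1, ?_⟩
  rw [comparisonAngle_eq_arcosh ⟨hA0.le, Or.inl ⟨cxy, hA⟩⟩ ⟨hG0.le, Or.inr ⟨czx, hG⟩⟩
    ⟨hn0.le, Or.inr ⟨czy, hn⟩⟩ (exists_comparisonAngle_of_past hfin hA0 hG0 hn0 hA hG hn),
    ← abs_neg, abs_of_pos (by linarith)]
  ring_nf

theorem sq_lt_of_comparisonAngle_lt_of_past (hfin : L.LocallyFiniteValued) (hA0 : 0 < A)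
    (hG0 : 0 < G) (hn0 : 0 < n) (hA : L.tau x y = ENNReal.ofReal A)
    (hG : L.tau z x = ENNReal.ofReal G) (hn : L.tau z y = ENNReal.ofReal n) (hφ : 0 ≤ φ)
    (h : L.comparisonAngle x y z < φ) :
    n ^ 2 < A ^ 2 + G ^ 2 + 2 * A * G * Real.cosh φ := by
  obtain ⟨h1, h2⟩ := comparisonAngle_of_past hfin hA0 hG0 hn0 hA hG hn
  have h3 : 0 < 2 * A * G := by positivity
  rw [h2, ← Real.arcosh_cosh hφ, Real.arcosh_lt_arcosh (div_pos h1 h3) (Real.cosh_pos _),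
    div_lt_iff₀ h3] at h
  linarith

theorem lt_sq_of_lt_comparisonAngle_of_past (hfin : L.LocallyFiniteValued) (hA0 : 0 < A)
    (hG0 : 0 < G) (hn0 : 0 < n) (hA : L.tau x y = ENNReal.ofReal A)
    (hG : L.tau z x = ENNReal.ofReal G) (hn : L.tau z y = ENNReal.ofReal n) (hφ : 0 ≤ φ)
    (h : φ < L.comparisonAngle x y z) :
    A ^ 2 + G ^ 2 + 2 * A * G * Real.cosh φ < n ^ 2 := by
  obtain ⟨h1, h2⟩ := comparisonAngle_of_past hfin hA0 hG0 hn0 hA hG hn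
  have h3 : 0 < 2 * A * G := by positivity
  rw [h2, ← Real.arcosh_cosh hφ, Real.arcosh_lt_arcosh (Real.cosh_pos _) (div_pos h1 h3),
    lt_div_iff₀ h3] at h
  linarith

end LorentzianPreLengthSpace

namespace LorentzianPreLengthSpace

variable {X : Type*} [MetricSpace X] {L : LorentzianPreLengthSpace X}

/-! ### Distance realizers -/

theorem IsCurveOn.mono {c : ℝ → X} {I J : Set ℝ} (h : IsCurveOn c I) (hJ : J ⊆ I) :
    IsCurveOn c J :=
  ⟨h.1.mono hJ, fun s hs t ht hst => h.2 s (hJ hs) t (hJ ht) hst⟩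

theorem IsFutureCausal.mono {c : ℝ → X} {I J : Set ℝ} (h : L.IsFutureCausal c I) (hJ : J ⊆ I) :
    L.IsFutureCausal c J :=
  ⟨h.1.mono hJ, fun s hs t ht hst => h.2 s (hJ hs) t (hJ ht) hst⟩

theorem IsFutureCausal.causal_of_le {c : ℝ → X} {I : Set ℝ} (h : L.IsFutureCausal c I) {s t : ℝ}
    (hs : s ∈ I) (ht : t ∈ I) (hst : s ≤ t) : L.causal (c s) (c t) := by
  rcases hst.eq_or_lt with rfl | hlt
  · exact L.causal_refl _
  · exact h.2 s hs t ht hlt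

theorem IsCurveOn.comp_affine {c : ℝ → X} {a b : ℝ} (hab : a < b) (h : IsCurveOn c (Icc a b)) :
    IsCurveOn (fun u => c (a + (b - a) * u)) (Icc 0 1) := by
  have hmaps : MapsTo (fun u => a + (b - a) * u) (Icc (0 : ℝ) 1) (Icc a b) := fun u hu => by
    constructor <;> nlinarith [hu.1, hu.2]
  constructor
  · intro u hu
    obtain ⟨K, V, hV, hK⟩ := h.1 (hmaps hu)
    have hlip : LipschitzWith (Real.nnabs (b - a)) fun u : ℝ => a + (b - a) * u :=
      LipschitzWith.of_dist_le_mul fun x y => by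
        simp [Real.dist_eq, ← mul_sub, abs_mul]
    have hcont : Continuous fun u : ℝ => a + (b - a) * u := by fun_prop
    refine ⟨K * Real.nnabs (b - a), _,
      (hcont.continuousWithinAt.tendsto_nhdsWithin hmaps) hV, ?_⟩
    exact hK.comp (hlip.lipschitzOnWith) fun v hv => hv
  · intro s hs t ht hst
    obtain ⟨u, hu, hne⟩ := h.2 _ (hmaps hs) _ (hmaps ht)
      (show a + (b - a) * s < a + (b - a) * t by nlinarith)
    have hba : 0 < b - a := sub_pos.2 hab
    refine ⟨(u - a) / (b - a), ⟨?_, ?_⟩, ?_⟩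
    · rw [le_div_iff₀ hba]; linarith [hu.1]
    · rw [div_le_iff₀ hba]; linarith [hu.2]
    · dsimp only
      rwa [mul_div_cancel₀ _ hba.ne', add_sub_cancel]

theorem length_le_tau (c : ℝ → X) {a b : ℝ} (hab : a < b) :
    L.length c a b ≤ L.tau (c a) (c b) := by
  refine (iInf₂_le 1 ![a, b]).trans ((iInf_le _ ⟨?_, rfl, rfl⟩).trans ?_)
  rotate_left
  · rw [Fin.strictMono_iff_lt_succ]
    simpa using hab
  · simp

theorem IsRealizer.tau_le_sum {c : ℝ → X} {a b : ℝ} (h : L.IsRealizer c a b) {n : ℕ}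
    {t : Fin (n + 1) → ℝ} (ht : StrictMono t) (h0 : t 0 = a) (h1 : t (Fin.last n) = b) :
    L.tau (c a) (c b) ≤ ∑ i : Fin n, L.tau (c (t i.castSucc)) (c (t i.succ)) :=
  h.2.le.trans ((iInf₂_le n t).trans (iInf_le _ ⟨ht, h0, h1⟩))

theorem isRealizer_of_tau_le_sum {c : ℝ → X} {a b : ℝ} (hab : a < b)
    (hc : L.IsFutureCausal c (Icc a b))
    (h : ∀ (n : ℕ) (t : Fin (n + 1) → ℝ), StrictMono t → t 0 = a → t (Fin.last n) = b →
      L.tau (c a) (c b) ≤ ∑ i : Fin n, L.tau (c (t i.castSucc)) (c (t i.succ))) :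
    L.IsRealizer c a b :=
  ⟨hc, le_antisymm (le_iInf₂ fun n t => le_iInf fun ht => h n t ht.1 ht.2.1 ht.2.2)
    (length_le_tau c hab)⟩

theorem IsRealizer.comp_affine {c : ℝ → X} {a b : ℝ} (hab : a < b) (h : L.IsRealizer c a b) :
    L.IsRealizer (fun u => c (a + (b - a) * u)) 0 1 := by
  have hba : 0 < b - a := sub_pos.2 hab
  have hmaps : MapsTo (fun u => a + (b - a) * u) (Icc (0 : ℝ) 1) (Icc a b) := fun u hu => by
    constructor <;> nlinarith [hu.1, hu.2]
  have hmono : StrictMono fun u => a + (b - a) * u := fun s t hst => by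
    change a + (b - a) * s < a + (b - a) * t
    gcongr
  refine isRealizer_of_tau_le_sum one_pos ⟨h.1.1.comp_affine hab, fun s hs t ht hst =>
    h.1.2 _ (hmaps hs) _ (hmaps ht) (hmono hst)⟩ fun n t ht h0 h1 => ?_
  have := h.tau_le_sum (t := fun i => a + (b - a) * t i) (hmono.comp ht) (by simp [h0])
    (by simp [h1])
  simpa using this

/-- A partition finer than a Lebesgue number of the finiteness neighbourhoods has finite sum, and
for a realizer this sum bounds the separation of the endpoints. -/
theorem IsRealizer.tau_lt_top (hfin : L.LocallyFiniteValued) {c : ℝ → X} {a b : ℝ} (hab : a < b)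
    (h : L.IsRealizer c a b) : L.tau (c a) (c b) < ⊤ := by
  choose U hU hUfin using hfin
  have hcont : ContinuousOn c (Icc a b) := h.1.1.1.continuousOn
  obtain ⟨δ, hδ, hball⟩ := lebesgue_number_lemma_of_metric
    (isCompact_Icc.image_of_continuousOn hcont) (fun x => isOpen_interior (s := U x))
    (fun y _ => mem_iUnion.2 ⟨y, mem_interior_iff_mem_nhds.2 (hU y)⟩)
  obtain ⟨δ', hδ', hunif⟩ := Metric.uniformContinuousOn_iff.1
    (isCompact_Icc.uniformContinuousOn_of_continuous hcont) δ hδ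
  obtain ⟨N, hN⟩ := exists_nat_gt ((b - a) / δ')
  have hba : 0 < b - a := sub_pos.2 hab
  have hN0 : (0 : ℝ) < N := (div_pos hba hδ').trans hN
  set t : Fin (N + 1) → ℝ := fun i => a + (b - a) * ((i : ℕ) / N) with ht
  have htI : ∀ i, t i ∈ Icc a b := fun i => by
    have h1 : ((i : ℕ) : ℝ) / N ≤ 1 := (div_le_one hN0).2 (by exact_mod_cast i.is_le)
    have h2 : 0 ≤ ((i : ℕ) : ℝ) / N := by positivity
    constructor <;> simp only [ht] <;> nlinarith
  have hmono : StrictMono t := fun i j hij => by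
    have : ((i : ℕ) : ℝ) < (j : ℕ) := by exact_mod_cast hij
    simp only [ht]
    gcongr
  refine (h.tau_le_sum hmono (by simp [ht]) ?_).trans_lt ?_
  · simp only [ht, Fin.val_last]
    rw [div_self hN0.ne']; ring
  · refine ENNReal.sum_lt_top.2 fun i _ => ?_
    obtain ⟨y, hy⟩ := hball _ (mem_image_of_mem c (htI i.castSucc))
    have hd : dist (t i.succ) (t i.castSucc) < δ' := by
      have : t i.succ - t i.castSucc = (b - a) / N := by
        simp only [ht, Fin.val_succ, Fin.val_castSucc]; push_cast; field_simp; ring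
      rw [Real.dist_eq, this, abs_of_pos (by positivity), div_lt_comm₀ hN0 hδ']
      exact hN
    exact hUfin y _ (interior_subset (hy (Metric.mem_ball_self hδ))) _
      (interior_subset (hy (hunif _ (htI _) _ (htI _) hd)))

/-- The time separation is additive along a distance realizer. -/
theorem IsRealizer.tau_add_tau (hfin : L.LocallyFiniteValued) {c : ℝ → X} {a b s t : ℝ}
    (hab : a < b) (h : L.IsRealizer c a b) (has : a ≤ s) (hst : s ≤ t) (htb : t ≤ b) :
    L.tau (c a) (c s) + L.tau (c s) (c t) = L.tau (c a) (c t) := by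
  have ha : a ∈ Icc a b := left_mem_Icc.2 hab.le
  have hb : b ∈ Icc a b := right_mem_Icc.2 hab.le
  have hs : s ∈ Icc a b := ⟨has, hst.trans htb⟩
  have ht : t ∈ Icc a b := ⟨has.trans hst, htb⟩
  have htop := h.tau_lt_top hfin hab
  have hself := tau_self_eq_zero hfin
  have key : ∀ u ∈ Icc a b, L.tau (c a) (c u) + L.tau (c u) (c b) = L.tau (c a) (c b) := by
    intro u hu
    rcases hu.1.eq_or_lt with rfl | hau
    · simp [hself]
    rcases hu.2.eq_or_lt with rfl | hub
    · simp [hself]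
    refine le_antisymm (L.reverse_triangle _ _ _ (h.1.causal_of_le ha hu hau.le)
      (h.1.causal_of_le hu hb hub.le)) ?_
    have := h.tau_le_sum (t := ![a, u, b]) (by
      rw [Fin.strictMono_iff_lt_succ]
      intro i
      fin_cases i
      · exact hau
      · exact hub) rfl rfl
    simpa [Fin.sum_univ_succ] using this
  rcases has.eq_or_lt with rfl | has'
  · simp [hself]
  rcases hst.eq_or_lt with rfl | hst'
  · simp [hself]
  rcases htb.eq_or_lt with rfl | htb'
  · exact key s hs
  have htb_top : L.tau (c t) (c b) ≠ ⊤ := fun htop' => by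
    have := key t ht
    rw [htop', add_top] at this
    exact htop.ne this.symm
  refine le_antisymm (L.reverse_triangle _ _ _ (h.1.causal_of_le ha hs has)
    (h.1.causal_of_le hs ht hst)) ?_
  have h3 := h.tau_le_sum (t := ![a, s, t, b]) (by
      rw [Fin.strictMono_iff_lt_succ]
      intro i
      fin_cases i
      · exact has'
      · exact hst'
      · exact htb') rfl rfl
  rw [← key t ht] at h3
  refine (ENNReal.add_le_add_iff_right htb_top).1 (h3.trans ?_)
  simp [Fin.sum_univ_succ, add_assoc]

/-- By additivity the sum over every partition of `[s, t]` telescopes to the same value; the term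
from `a` to `s` is finite and cancels. -/
theorem IsRealizer.subinterval (hfin : L.LocallyFiniteValued) {c : ℝ → X} {a b s t : ℝ}
    (h : L.IsRealizer c a b) (has : a ≤ s) (hst : s < t) (htb : t ≤ b) :
    L.IsRealizer c s t := by
  have hab : a < b := has.trans_lt (hst.trans_le htb)
  have hsub : Icc s t ⊆ Icc a b := Icc_subset_Icc has htb
  refine isRealizer_of_tau_le_sum hst (h.1.mono hsub) fun n u hu h0 h1 => ?_
  have hsum : ∀ (n : ℕ) (u : Fin (n + 1) → ℝ), StrictMono u → (∀ i, u i ∈ Icc a b) →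
      L.tau (c a) (c (u 0)) + ∑ i : Fin n, L.tau (c (u i.castSucc)) (c (u i.succ)) =
        L.tau (c a) (c (u (Fin.last n))) := by
    intro n
    induction n with
    | zero => intro u _ _; simp
    | succ k ih =>
      intro u hu huI
      rw [Fin.sum_univ_castSucc, ← add_assoc]
      have := ih (fun i => u i.castSucc) (hu.comp Fin.strictMono_castSucc) fun i => huI _
      rw [Fin.castSucc_zero] at this
      simp only [← Fin.succ_castSucc] at this ⊢
      rw [this]
      exact h.tau_add_tau hfin hab (huI _).1 (hu (Fin.castSucc_lt_last _)).le (huI _).2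
  have hfinite : L.tau (c a) (c s) ≠ ⊤ := fun htop => by
    have := h.tau_add_tau hfin hab has (hst.le.trans htb) le_rfl
    rw [htop, top_add] at this
    exact (h.tau_lt_top hfin hab).ne this.symm
  have huI : ∀ i, u i ∈ Icc a b := fun i => hsub
    ⟨h0 ▸ hu.monotone (Fin.zero_le i), h1 ▸ hu.monotone (Fin.le_last i)⟩
  have := hsum n u hu huI
  rw [h0, h1, ← h.tau_add_tau hfin hab has hst.le htb] at this
  exact ((ENNReal.add_right_inj hfinite).1 this).ge

end LorentzianPreLengthSpace

namespace LorentzianPreLengthSpace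

variable {X : Type*} [MetricSpace X] {L : LorentzianPreLengthSpace X}

/-! ### Hinges under a lower curvature bound -/

theorem StrictlyTimelikeGeodesicallyConnected.exists_side {U : Set X}
    (h : L.StrictlyTimelikeGeodesicallyConnected U) {p q : X} (hp : p ∈ U) (hq : q ∈ U)
    (hpq : L.chron p q) :
    ∃ s : ℝ → X, L.IsRealizer s 0 1 ∧ s 0 = p ∧ s 1 = q ∧ MapsTo s (Icc 0 1) U := by
  obtain ⟨a, b, c, hab, hc, hU, rfl, rfl⟩ := (h p hp q hq hpq).1
  refine ⟨_, hc.comp_affine hab, by simp, by simp, fun u hu => hU ?_⟩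
  constructor <;> nlinarith [hu.1, hu.2]

/-- The third vertex and a point on a side of a timelike triangle are at most as far apart as in
the comparison triangle. -/
theorem IsLowerComparisonNhd.tau_le_of_first_side {K : ℝ} {U : Set X}
    (h : L.IsLowerComparisonNhd K U) (hfin : L.LocallyFiniteValued) {p z y x : X} {s : ℝ → X}
    (hs : L.IsRealizer s 0 1) (hs0 : s 0 = p) (hs1 : s 1 = z) (hsU : MapsTo s (Icc 0 1) U)
    (hx : x ∈ s '' Icc 0 1) (hyU : y ∈ U) (hpz : L.chron p z) (hzy : L.chron z y)
    (hdiam : L.tau p y < KPlane.diam K) {p' z' y' x' : ℝ × ℝ}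
    (h1 : KPlane.tau K p' z' = L.tau p z) (h2 : KPlane.tau K p' y' = L.tau p y)
    (h3 : KPlane.tau K z' y' = L.tau z y) (hx' : L.IsComparisonPoint K p z x p' z' x')
    (hy' : KPlane.Causal K p' y') : L.tau x y ≤ KPlane.tau K x' y' := by
  have hpU : p ∈ U := hs0 ▸ hsU (left_mem_Icc.2 zero_le_one)
  have hzU : z ∈ U := hs1 ▸ hsU (right_mem_Icc.2 zero_le_one)
  have hpy := L.chron_trans _ _ _ hpz hzy
  obtain ⟨-, hUfin, -, hconn, hcomp⟩ := h
  obtain ⟨s₂, hs₂, hs₂0, hs₂1, hs₂U⟩ := hconn.exists_side hpU hyU hpy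
  obtain ⟨s₃, hs₃, hs₃0, hs₃1, hs₃U⟩ := hconn.exists_side hzU hyU hzy
  -- The curvature condition compares points on sides; the vertex `y` enters as the endpoint of the
  -- side from `p`.
  refine hcomp ![p, z, y] (fun i j => if i = 0 then (if j = 1 then s else s₂) else s₃) ?_ hdiam
    ![p', z', y'] ?_ 0 1 0 2 (by decide) (by decide) x hx y
    ⟨1, right_mem_Icc.2 zero_le_one, hs₂1⟩ x' y' hx'
    ⟨hy', Or.inl rfl, h2, ?_⟩
  · intro i j hij
    fin_cases i <;> fin_cases j <;> first
      | exact absurd hij (by decide)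
      | exact ⟨hpz, hUfin _ hpU _ hzU, hs, hs0, hs1, hsU⟩
      | exact ⟨hpy, hUfin _ hpU _ hyU, hs₂, hs₂0, hs₂1, hs₂U⟩
      | exact ⟨hzy, hUfin _ hzU _ hyU, hs₃, hs₃0, hs₃1, hs₃U⟩
  · intro i j hij
    fin_cases i <;> fin_cases j <;> first
      | exact absurd hij (by decide)
      | exact h1
      | exact h2
      | exact h3
  · exact (KPlane.tau_self K y').trans (tau_self_eq_zero hfin y).symm

/-- The middle vertex and a point on the long side of a timelike triangle are at most as far apart
as in the comparison triangle. -/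
theorem IsLowerComparisonNhd.tau_le_of_long_side {K : ℝ} {U : Set X}
    (h : L.IsLowerComparisonNhd K U) (hfin : L.LocallyFiniteValued) {p z y x : X} {s : ℝ → X}
    (hs : L.IsRealizer s 0 1) (hs0 : s 0 = p) (hs1 : s 1 = z) (hsU : MapsTo s (Icc 0 1) U)
    (hx : x ∈ s '' Icc 0 1) (hyU : y ∈ U) (hpy : L.chron p y) (hyz : L.chron y z)
    (hdiam : L.tau p z < KPlane.diam K) {p' z' y' x' : ℝ × ℝ}
    (h1 : KPlane.tau K p' z' = L.tau p z) (h2 : KPlane.tau K p' y' = L.tau p y)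
    (h3 : KPlane.tau K y' z' = L.tau y z) (hx' : L.IsComparisonPoint K p z x p' z' x')
    (hy' : KPlane.Causal K p' y') : L.tau x y ≤ KPlane.tau K x' y' := by
  have hpU : p ∈ U := hs0 ▸ hsU (left_mem_Icc.2 zero_le_one)
  have hzU : z ∈ U := hs1 ▸ hsU (right_mem_Icc.2 zero_le_one)
  have hpz := L.chron_trans _ _ _ hpy hyz
  obtain ⟨-, hUfin, -, hconn, hcomp⟩ := h
  obtain ⟨s₂, hs₂, hs₂0, hs₂1, hs₂U⟩ := hconn.exists_side hpU hyU hpy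
  obtain ⟨s₃, hs₃, hs₃0, hs₃1, hs₃U⟩ := hconn.exists_side hyU hzU hyz
  refine hcomp ![p, y, z] (fun i j => if i = 0 then (if j = 1 then s₂ else s) else s₃) ?_ hdiam
    ![p', y', z'] ?_ 0 2 0 1 (by decide) (by decide) x hx y
    ⟨1, right_mem_Icc.2 zero_le_one, hs₂1⟩ x' y' hx'
    ⟨hy', Or.inl rfl, h2, ?_⟩
  · intro i j hij
    fin_cases i <;> fin_cases j <;> first
      | exact absurd hij (by decide)
      | exact ⟨hpz, hUfin _ hpU _ hzU, hs, hs0, hs1, hsU⟩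
      | exact ⟨hpy, hUfin _ hpU _ hyU, hs₂, hs₂0, hs₂1, hs₂U⟩
      | exact ⟨hyz, hUfin _ hyU _ hzU, hs₃, hs₃0, hs₃1, hs₃U⟩
  · intro i j hij
    fin_cases i <;> fin_cases j <;> first
      | exact absurd hij (by decide)
      | exact h1
      | exact h2
      | exact h3
  · exact (KPlane.tau_self K y').trans (tau_self_eq_zero hfin y).symm

/-- Let `x` be an inner point of a realizer from `p` to `z` and `y` a point in the future of `x`. At
small scales, the angle of the hinge `z`, `x`, `y` is at most about the one of the hinge
`p`, `x`, `y`. -/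
theorem IsLowerComparisonNhd.exists_hinge_bound {K : ℝ} {U : Set X}
    (h : L.IsLowerComparisonNhd K U) (hfin : L.LocallyFiniteValued) {φ ψ : ℝ} (hφ : 0 < φ)
    (hφψ : φ < ψ) : ∃ δ > 0, ∀ (c : ℝ → X) (a b : ℝ) (y : X), a < 0 → 0 < b →
      L.IsRealizer c a b → MapsTo c (Icc a b) U → y ∈ U →
      ∀ t ∈ Ioo 0 δ, ∀ r ∈ Ioo 0 δ, ∀ m ∈ Ioo 0 δ, ∀ n ∈ Ioo 0 δ, ∀ A ∈ Ioo 0 δ,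
      L.tau (c a) (c 0) = ENNReal.ofReal t → L.tau (c 0) (c b) = ENNReal.ofReal r →
      L.tau (c a) y = ENNReal.ofReal m → L.tau (c 0) y = ENNReal.ofReal A →
      (L.tau (c b) y = ENNReal.ofReal n ∨ L.tau y (c b) = ENNReal.ofReal n) →
      L.comparisonAngle (c 0) (c a) y < φ →
      A ^ 2 + r ^ 2 - 2 * A * r * Real.cosh ψ ≤ n ^ 2 := by
  have hcφ : 0 < Real.cosh φ - 1 := sub_pos.2 (Real.one_lt_cosh.2 hφ.ne')
  have hcψ : Real.cosh φ - 1 < Real.cosh ψ - 1 := by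
    rw [sub_lt_sub_iff_right, Real.cosh_lt_cosh, abs_of_pos hφ, abs_of_pos (hφ.trans hφψ)]
    exact hφψ
  -- The error factor that turns the angle `φ` into exactly `ψ`, since the hinge comparison is
  -- linear in `cosh - 1` of the angles.
  set ε := (Real.cosh ψ - 1) / (Real.cosh φ - 1) - 1 with hε
  have hε0 : 0 < ε := sub_pos.2 ((one_lt_div hcφ).2 hcψ)
  have hε1 : (1 + ε) * (Real.cosh φ - 1) = Real.cosh ψ - 1 := by
    rw [hε, add_sub_cancel, div_mul_cancel₀ _ hcφ.ne']
  obtain ⟨δ₀, hδ₀, haxis, hhinge⟩ := KPlane.hingeComparison K ε hε0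
  obtain ⟨d, hd0, hd⟩ := ENNReal.lt_iff_exists_nnreal_btwn.1 (KPlane.diam_pos K)
  have hd0' : (0 : ℝ) < d := by exact_mod_cast hd0
  refine ⟨min (δ₀ / 2) (d / 2), by positivity, ?_⟩
  intro c a b y ha hb hc hcU hyU t ht r hr m hm n hn A hA htau hrtau hmtau hAtau hntau hangle
  have hab : a < b := ha.trans hb
  have hsmall : ∀ s ∈ Ioo 0 (min (δ₀ / 2) ((d : ℝ) / 2)), s ∈ Ioo 0 δ₀ ∧ s < δ₀ / 2 ∧ s < d / 2 :=
    fun s hs => ⟨⟨hs.1, by linarith [hs.2, min_le_left (δ₀ / 2) ((d : ℝ) / 2)]⟩,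
      hs.2.trans_le (min_le_left _ _), hs.2.trans_le (min_le_right _ _)⟩
  have htp := ht.1
  have hrp := hr.1
  have hmp := hm.1
  have hnp := hn.1
  have hAp := hA.1
  obtain ⟨ht, ht1, ht2⟩ := hsmall t ht
  obtain ⟨hr, hr1, hr2⟩ := hsmall r hr
  obtain ⟨hm, hm1, hm2⟩ := hsmall m hm
  obtain ⟨hn, -, -⟩ := hsmall n hn
  obtain ⟨hA, -, -⟩ := hsmall A hA
  have hdiam : ∀ s : ℝ, s < d → ENNReal.ofReal s < KPlane.diam K := fun s hs => by
    refine lt_of_le_of_lt ?_ hd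
    rw [← ENNReal.ofReal_coe_nnreal]
    exact ENNReal.ofReal_le_ofReal hs.le
  have cpx := chron_of_tau_eq htp htau
  have cxz := chron_of_tau_eq hrp hrtau
  have cxy := chron_of_tau_eq hAp hAtau
  have cpy := chron_of_tau_eq hmp hmtau
  have cpz := L.chron_trans _ _ _ cpx cxz
  have hpz : L.tau (c a) (c b) = ENNReal.ofReal (t + r) := by
    rw [← hc.tau_add_tau hfin hab ha.le hb.le le_rfl, htau, hrtau, ENNReal.ofReal_add htp.le hrp.le]
  have hAm : A + t ≤ m := by
    have := reverse_triangle_real (L.causal_of_chron _ _ cpx) (L.causal_of_chron _ _ cxy)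
      htau hAtau hmtau htp.le hAp.le hmp.le
    linarith
  have hs := hc.comp_affine hab
  have hs0 : (fun u => c (a + (b - a) * u)) 0 = c a := by simp
  have hs1 : (fun u => c (a + (b - a) * u)) 1 = c b := by simp
  have hsU : MapsTo (fun u => c (a + (b - a) * u)) (Icc 0 1) U := fun u hu => hcU (by
    constructor <;> nlinarith [hu.1, hu.2])
  have hx : c 0 ∈ (fun u => c (a + (b - a) * u)) '' Icc 0 1 := by
    have hba : 0 < b - a := sub_pos.2 hab
    refine ⟨-a / (b - a), ⟨div_nonneg (by linarith) hba.le, (div_le_one hba).2 (by linarith)⟩, ?_⟩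
    dsimp only
    rw [mul_div_cancel₀ _ hba.ne', add_neg_cancel]
  obtain ⟨c1, c2⟩ := hhinge t ht r hr m hm n hn A hA hAm (by
    rcases hntau with h | h
    · have := reverse_triangle_real (L.causal_of_chron _ _ cxz)
        (L.causal_of_chron _ _ (chron_of_tau_eq hnp h)) hrtau h hAtau hrp.le hnp.le hAp.le
      exact le_abs.2 (Or.inl (by linarith))
    · have := reverse_triangle_real (L.causal_of_chron _ _ cxy)
        (L.causal_of_chron _ _ (chron_of_tau_eq hnp h)) hAtau h hrtau hAp.le hnp.le hrp.le
      exact le_abs.2 (Or.inr (by linarith)))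
  obtain ⟨e1, e1'⟩ := haxis (-t) r (by linarith) (by linarith)
  obtain ⟨e2, e2'⟩ := haxis (-t) 0 (by linarith) (by linarith)
  obtain ⟨e3, e3'⟩ := haxis 0 r (by linarith) (by linarith)
  rw [sub_neg_eq_add, add_comm r t, ← hpz] at e1'
  rw [sub_neg_eq_add, zero_add, ← htau] at e2'
  rw [sub_zero, ← hrtau] at e3'
  have hkey : t * ((A - r) ^ 2 - n ^ 2) ≤ (1 + ε) * (r * (m ^ 2 - (A + t) ^ 2)) := by
    rcases hntau with h' | h'
    · have czy := chron_of_tau_eq hnp h'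
      have htri := reverse_triangle_real (L.causal_of_chron _ _ cpz) (L.causal_of_chron _ _ czy)
        hpz h' hmtau (by linarith) hnp.le hmp.le
      obtain ⟨a', f1, f2, f3⟩ := c1 htri
      refine f3 ?_
      rw [← hAtau]
      exact h.tau_le_of_first_side hfin hs hs0 hs1 hsU hx hyU cpz czy
        (hmtau ▸ hdiam m (by linarith)) e1' (f1.trans hmtau.symm) (f2.trans h'.symm)
        ⟨e2, e3, e2', e3'⟩ (KPlane.causal_of_tau_eq hmp f1)
    · have cyz := chron_of_tau_eq hnp h'
      have htri := reverse_triangle_real (L.causal_of_chron _ _ cpy) (L.causal_of_chron _ _ cyz)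
        hmtau h' hpz hmp.le hnp.le (by linarith)
      obtain ⟨a', f1, f2, f3⟩ := c2 htri
      refine f3 ?_
      rw [← hAtau]
      exact h.tau_le_of_long_side hfin hs hs0 hs1 hsU hx hyU cpy cyz
        (hpz ▸ hdiam (t + r) (by linarith)) e1' (f1.trans hmtau.symm) (f2.trans h'.symm)
        ⟨e2, e3, e2', e3'⟩ (KPlane.causal_of_tau_eq hmp f1)
  rw [comparisonAngle_comm] at hangle
  have hm3 := sq_lt_of_comparisonAngle_lt_of_past hfin hAp htp hmp hAtau htau hmtau hφ.le hangle
  -- By the law of cosines the two differences of squares in `hkey` are `2 A t` and `2 A r` times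
  -- `cosh - 1` of the hinge angles, so the common factor `2 A t r` drops out.
  have h4 : r * (m ^ 2 - (A + t) ^ 2) ≤ r * (2 * A * t * (Real.cosh φ - 1)) :=
    mul_le_mul_of_nonneg_left (by linarith) hrp.le
  have h5 : t * ((A - r) ^ 2 - n ^ 2) ≤ t * (2 * A * r * (Real.cosh ψ - 1)) := by
    calc _ ≤ _ := hkey
      _ ≤ (1 + ε) * (r * (2 * A * t * (Real.cosh φ - 1))) :=
        mul_le_mul_of_nonneg_left h4 (by linarith)
      _ = t * (2 * A * r * ((1 + ε) * (Real.cosh φ - 1))) := by ring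
      _ = _ := by rw [hε1]
  have h6 := le_of_mul_le_mul_left h5 htp
  linarith

end LorentzianPreLengthSpace

/-! ### Collinear points in the Minkowski plane -/

/-- Rays from the origin at rapidities `0`, `φ` and `ω = φ + ψ`: the point at distance `M` on the
reflected third ray, the point at distance `1` on the first ray and the point at distance `R` on the
second one are collinear and equidistant. -/
theorem exists_collinear_of_past {φ ψ : ℝ} (hφ : 0 < φ) (hψ : 0 < ψ) :
    ∃ M R : ℝ, 0 < M ∧ 1 ≤ R ∧
      1 + R ^ 2 - 2 * R * Real.cosh φ = 1 + M ^ 2 + 2 * M * Real.cosh (φ + ψ) ∧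
      R ^ 2 + M ^ 2 + 2 * R * M * Real.cosh ψ = 4 * (1 + M ^ 2 + 2 * M * Real.cosh (φ + ψ)) := by
  have h1 := Real.sinh_pos_iff.2 hφ
  have h2 := Real.sinh_pos_iff.2 hψ
  have h3 : Real.sinh ψ < Real.sinh (φ + ψ) := Real.sinh_lt_sinh.2 (by linarith)
  have e1 : Real.sinh ψ = Real.sinh (φ + ψ) * Real.cosh φ - Real.cosh (φ + ψ) * Real.sinh φ := by
    rw [← Real.sinh_sub]; ring_nf
  have e2 : Real.cosh ψ = Real.cosh (φ + ψ) * Real.cosh φ - Real.sinh (φ + ψ) * Real.sinh φ := by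
    rw [← Real.cosh_sub]; ring_nf
  have e3 := Real.cosh_sq (φ + ψ)
  have e4 := Real.cosh_sq φ
  set S := Real.sinh (φ + ψ)
  set C := Real.cosh (φ + ψ)
  -- These values make the point `(1, 0)` of the first ray the midpoint of the other two: `k1` and
  -- `k2` are the space and time components of that equation.
  set M := 2 * Real.sinh φ / Real.sinh ψ with hM
  set R := 2 * S / Real.sinh ψ with hR
  have k1 : R * Real.sinh φ = M * S := by rw [hM, hR]; ring
  have k2 : R * Real.cosh φ = 2 + M * C := by
    rw [hM, hR]
    field_simp
    linear_combination -e1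
  have k3 : R ^ 2 = 4 + M ^ 2 + 4 * M * C := by
    have : R ^ 2 = (R * Real.cosh φ) ^ 2 - (R * Real.sinh φ) ^ 2 := by
      rw [mul_pow, mul_pow, e4]; ring
    rw [this, k1, k2]
    linear_combination M ^ 2 * e3
  have k4 : R * Real.cosh ψ = 2 * C + M := by
    rw [e2]
    linear_combination C * k2 - S * k1 + M * e3
  refine ⟨M, R, by positivity, ?_, ?_, ?_⟩
  · rw [hR, le_div_iff₀ h2]; linarith
  · linear_combination k3 - 2 * k2
  · linear_combination k3 + 2 * M * k4

/-- If the points at distances `A` and `G` on rays from the origin at rapidities `0` and `φ + ψ` are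
timelike related, the segment between them meets the ray at rapidity `φ`. -/
theorem exists_collinear_of_future {A G φ ψ : ℝ} (hA : 0 < A) (hAG : A ≤ G) (hφ : 0 < φ)
    (hψ : 0 < ψ) (hD : 0 < A ^ 2 + G ^ 2 - 2 * A * G * Real.cosh (φ + ψ)) :
    ∃ r μ : ℝ, 0 < r ∧ 0 < μ ∧ μ < 1 ∧ A ≤ r * Real.cosh φ ∧ r ≤ G * Real.cosh ψ ∧
      A ^ 2 + r ^ 2 - 2 * A * r * Real.cosh φ =
        μ ^ 2 * (A ^ 2 + G ^ 2 - 2 * A * G * Real.cosh (φ + ψ)) ∧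
      r ^ 2 + G ^ 2 - 2 * r * G * Real.cosh ψ =
        (1 - μ) ^ 2 * (A ^ 2 + G ^ 2 - 2 * A * G * Real.cosh (φ + ψ)) := by
  have hG : 0 < G := hA.trans_le hAG
  have h1 := Real.sinh_pos_iff.2 hφ
  have h2 := Real.sinh_pos_iff.2 hψ
  have c1 := Real.one_le_cosh φ
  have c2 := Real.one_le_cosh ψ
  have p1 := Real.cosh_sq φ
  have p2 := Real.cosh_sq ψ
  have eS := Real.sinh_add φ ψ
  have eC := Real.cosh_add φ ψ
  have hS : 0 < Real.sinh (φ + ψ) := Real.sinh_pos_iff.2 (by linarith)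
  have hC := Real.one_le_cosh (φ + ψ)
  set s₁ := Real.sinh φ
  set s₂ := Real.sinh ψ
  set c₁ := Real.cosh φ
  set c₂ := Real.cosh ψ
  set S := Real.sinh (φ + ψ)
  set C := Real.cosh (φ + ψ)
  clear_value s₁ s₂ c₁ c₂ S C
  -- The segment splits the triangle into two with areas `A r s₁ / 2` and `r G s₂ / 2`. Comparison
  -- with the total area `A G S / 2` gives `r`, and the share of the first one is `μ`.
  set E := A * s₁ + G * s₂ with hE
  have hE0 : 0 < E := by positivity
  set r := A * G * S / E with hr
  set μ := A * s₁ / E with hμ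
  have hrE : r * E = A * G * S := div_mul_cancel₀ _ hE0.ne'
  have hμE : μ * E = A * s₁ := div_mul_cancel₀ _ hE0.ne'
  have hr0 : 0 < r := by positivity
  have k1 : c₁ * S - s₂ = s₁ * C := by rw [eS, eC]; linear_combination s₂ * p1
  have k2 : c₂ * S - s₁ = s₂ * C := by rw [eS, eC]; linear_combination s₁ * p2
  have hGC : A * C < G := by
    by_contra! hle
    have f1 := mul_nonneg (sub_nonneg.2 hAG) (sub_nonneg.2 hle)
    have f2 : 0 ≤ (G + A) * (A * (C - 1)) :=
      mul_nonneg (by linarith) (mul_nonneg hA.le (by linarith))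
    linarith
  have hle1 : c₁ ≤ C := by
    rw [eC]
    have := le_mul_of_one_le_right (by linarith : 0 ≤ c₁) c2
    linarith [mul_pos h1 h2]
  refine ⟨r, μ, hr0, by positivity, ?_, ?_, ?_, ?_, ?_⟩
  · rw [hμ, div_lt_one hE0, hE]
    linarith [mul_pos hG h2]
  · refine le_of_mul_le_mul_right ?_ hE0
    have f1 : A * s₁ ≤ G * (s₁ * C) :=
      calc A * s₁ ≤ G * s₁ := mul_le_mul_of_nonneg_right hAG h1.le
        _ ≤ G * s₁ * C := le_mul_of_one_le_right (by positivity) hC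
        _ = _ := by ring
    rw [← k1] at f1
    have f2 := mul_le_mul_of_nonneg_left f1 hA.le
    calc A * E = A * (A * s₁) + A * (G * s₂) := by rw [hE]; ring
      _ ≤ A * (G * (c₁ * S - s₂)) + A * (G * s₂) := by linarith
      _ = r * E * c₁ := by rw [hrE]; ring
      _ = _ := by ring
  · refine le_of_mul_le_mul_right ?_ hE0
    have f1 : A * c₁ ≤ G * c₂ :=
      calc A * c₁ ≤ A * C := mul_le_mul_of_nonneg_left hle1 hA.le
        _ ≤ G := hGC.le
        _ ≤ G * c₂ := le_mul_of_one_le_right hG.le c2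
    have f2 := mul_le_mul_of_nonneg_left f1 (mul_pos hG h2).le
    rw [hrE, eS, hE]
    linarith
  · have hE2 : E ^ 2 ≠ 0 := by positivity
    apply mul_right_cancel₀ hE2
    calc (A ^ 2 + r ^ 2 - 2 * A * r * c₁) * E ^ 2
        = A ^ 2 * E ^ 2 + (r * E) ^ 2 - 2 * A * (r * E) * c₁ * E := by ring
      _ = (A * s₁) ^ 2 * (A ^ 2 + G ^ 2 - 2 * A * G * C) := by
        rw [hrE, hE]
        linear_combination (-2 * A ^ 3 * G * s₁) * k1 +
          A ^ 2 * G ^ 2 * (S - c₁ * s₂ + s₁ * c₂) * eS - A ^ 2 * G ^ 2 * s₂ ^ 2 * p1 +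
          A ^ 2 * G ^ 2 * s₁ ^ 2 * p2
      _ = _ := by rw [← hμE]; ring
  · have hE2 : E ^ 2 ≠ 0 := by positivity
    have hμE' : (1 - μ) * E = G * s₂ := by rw [sub_mul, hμE, hE]; ring
    apply mul_right_cancel₀ hE2
    calc (r ^ 2 + G ^ 2 - 2 * r * G * c₂) * E ^ 2
        = G ^ 2 * E ^ 2 + (r * E) ^ 2 - 2 * G * (r * E) * c₂ * E := by ring
      _ = (G * s₂) ^ 2 * (A ^ 2 + G ^ 2 - 2 * A * G * C) := by
        rw [hrE, hE]
        linear_combination (-2 * G ^ 3 * A * s₂) * k2 +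
          A ^ 2 * G ^ 2 * (S - c₂ * s₁ + s₂ * c₁) * eS - A ^ 2 * G ^ 2 * s₁ ^ 2 * p2 +
          A ^ 2 * G ^ 2 * s₂ ^ 2 * p1
      _ = _ := by rw [← hμE']; ring

/-- A continuous function that stays above the side of a planar hinge as long as it is positive, is
positive throughout. -/
theorem le_sq_of_continuousOn_hinge {N f : ℝ → ℝ} {s A r C : ℝ} (hs : 0 ≤ s)
    (hN : ContinuousOn N (Icc 0 s)) (hN0 : N 0 = r) (hr : 0 < r) (hnn : ∀ u ∈ Icc 0 s, 0 ≤ N u)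
    (hf : ∀ u ∈ Icc 0 s, 0 ≤ f u ∧ f u ≤ A) (hAr : A ≤ r * C)
    (hq : 0 < A ^ 2 + r ^ 2 - 2 * A * r * C)
    (h : ∀ u ∈ Ioc 0 s, 0 < N u → f u ^ 2 + r ^ 2 - 2 * f u * r * C ≤ N u ^ 2) :
    A ^ 2 + r ^ 2 - 2 * A * r * C ≤ N s ^ 2 := by
  set q := A ^ 2 + r ^ 2 - 2 * A * r * C with hqdef
  -- By `hAr` the quadratic decreases on `[0, A]`, so `q` is its minimum there.
  have hmono : ∀ y, 0 ≤ y → y ≤ A → q ≤ y ^ 2 + r ^ 2 - 2 * y * r * C := fun y h1 h2 => by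
    have : 0 ≤ (A - y) * (2 * (r * C) - A - y) := mul_nonneg (by linarith) (by linarith)
    rw [hqdef]; linarith
  have hgap : ∀ u ∈ Icc 0 s, 0 < N u → q ≤ N u ^ 2 := by
    intro u hu hpos
    rcases hu.1.eq_or_lt with rfl | hu0
    · rw [hN0]
      simpa using hmono 0 le_rfl ((hf 0 hu).1.trans (hf 0 hu).2)
    · exact (hmono _ (hf u hu).1 (hf u hu).2).trans (h u ⟨hu0, hu.2⟩ hpos)
  have hsI : s ∈ Icc 0 s := right_mem_Icc.2 hs
  rcases (hnn s hsI).eq_or_lt with h0 | hpos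
  -- A continuous `N` falling from `r` to `0` would take the value `√q / 2`, in the excluded gap
  -- between `0` and `√q`.
  · exfalso
    have hsq : 0 < √q := Real.sqrt_pos.2 hq
    have hrq : √q ≤ r := by
      rw [← hN0]
      apply Real.sqrt_le_iff.2 ⟨hN0 ▸ hr.le, hgap 0 (left_mem_Icc.2 hs) (hN0 ▸ hr)⟩
    obtain ⟨u, hu, hNu⟩ := intermediate_value_Icc' hs hN
      (show √q / 2 ∈ Icc (N s) (N 0) from ⟨by rw [← h0]; positivity, by rw [hN0]; linarith⟩)
    have := hgap u hu (by rw [hNu]; positivity)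
    rw [hNu, div_pow, Real.sq_sqrt hq.le] at this
    linarith
  · exact hgap s hsI hpos

/-- The slack `e` is kept apart from `φ` and `ψ`, as in the geodesic case the curvature comparison
costs `e` in each angle. -/
theorem ENNReal.exists_real_add_lt {a b c : ℝ≥0∞} (h : a + b < c) :
    ∃ φ ψ e : ℝ, 0 < φ ∧ 0 < ψ ∧ 0 < e ∧ a < ENNReal.ofReal φ ∧ b < ENNReal.ofReal ψ ∧
      ENNReal.ofReal (φ + e + (ψ + e)) < c := by
  obtain ⟨d, hd1, hd2⟩ := ENNReal.lt_iff_exists_nnreal_btwn.1 h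
  have ha : a ≠ ⊤ := fun h' => by simp [h'] at h
  have hb : b ≠ ⊤ := fun h' => by simp [h'] at h
  lift a to NNReal using ha
  lift b to NNReal using hb
  have hd : (a : ℝ) + b < d := by exact_mod_cast hd1
  set e : ℝ := (d - a - b) / 4 with he
  have he0 : 0 < e := by rw [he]; linarith
  refine ⟨a + e, b + e, e, by positivity, by positivity, he0, ?_, ?_, ?_⟩
  · rw [← ENNReal.ofReal_coe_nnreal, ENNReal.ofReal_lt_ofReal_iff (by positivity)]; linarith
  · rw [← ENNReal.ofReal_coe_nnreal, ENNReal.ofReal_lt_ofReal_iff (by positivity)]; linarith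
  · have : (a : ℝ) + e + e + (b + e + e) = d := by rw [he]; ring
    rwa [this, ENNReal.ofReal_coe_nnreal]

namespace LorentzianPreLengthSpace

variable {X : Type*} [MetricSpace X] {L : LorentzianPreLengthSpace X}

/-! ### Local structure near a point -/

/-- A set on whose square the time separation is continuous and less than `d`. -/
structure IsSmall (L : LorentzianPreLengthSpace X) (V : Set X) (d : ℝ) : Prop where
  tau_lt : ∀ p ∈ V, ∀ q ∈ V, L.tau p q < ENNReal.ofReal d
  continuousOn : ContinuousOn (fun z : X × X => L.tau z.1 z.2) (V ×ˢ V)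

/-- Continuity at `(x, x)`, where the time separation vanishes. -/
theorem exists_isSmall (hfin : L.LocallyFiniteValued) (hcont : L.LocallyContinuous) (x : X) {d : ℝ}
    (hd : 0 < d) : ∃ V, IsOpen V ∧ x ∈ V ∧ L.IsSmall V d := by
  obtain ⟨U, hU, hUc⟩ := hcont x
  have hUU : U ×ˢ U ∈ 𝓝 (x, x) := prod_mem_nhds hU hU
  have h1 : ∀ᶠ z : X × X in 𝓝 (x, x), L.tau z.1 z.2 < ENNReal.ofReal d := by
    refine ((hUc _ (mem_of_mem_nhds hUU)).continuousAt hUU).eventually_lt_const ?_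
    show L.tau x x < _
    rw [tau_self_eq_zero hfin]
    simpa using hd
  rw [nhds_prod_eq] at h1
  obtain ⟨W, hW, hWd⟩ := (eventually_prod_self_iff (r := fun p q => L.tau p q < ENNReal.ofReal d)).1 h1
  obtain ⟨V, hV, hVo, hxV⟩ := mem_nhds_iff.1 (inter_mem hU hW)
  exact ⟨V, hVo, hxV, fun p hp q hq => hWd p (hV hp).2 q (hV hq).2,
    hUc.mono (prod_mono (fun p hp => (hV hp).1) fun p hp => (hV hp).1)⟩

namespace IsSmall

variable {V : Set X} {d : ℝ}

theorem mono (h : L.IsSmall V d) {W : Set X} (hW : W ⊆ V) : L.IsSmall W d :=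
  ⟨fun p hp q hq => h.tau_lt p (hW hp) q (hW hq), h.continuousOn.mono (prod_mono hW hW)⟩

theorem ofReal_toReal (h : L.IsSmall V d) {p q : X} (hp : p ∈ V) (hq : q ∈ V) :
    L.tau p q = ENNReal.ofReal (L.tau p q).toReal :=
  (ENNReal.ofReal_toReal ((h.tau_lt p hp q hq).trans ENNReal.ofReal_lt_top).ne).symm

theorem toReal_pos_iff (h : L.IsSmall V d) {p q : X} (hp : p ∈ V) (hq : q ∈ V) :
    0 < (L.tau p q).toReal ↔ L.chron p q := by
  rw [ENNReal.toReal_pos_iff, L.tau_pos_iff]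
  exact and_iff_left ((h.tau_lt p hp q hq).trans ENNReal.ofReal_lt_top)

theorem toReal_mem_Ioo (h : L.IsSmall V d) {p q : X} (hp : p ∈ V) (hq : q ∈ V) (hpq : L.chron p q) :
    (L.tau p q).toReal ∈ Ioo 0 d := by
  refine ⟨(h.toReal_pos_iff hp hq).2 hpq, ?_⟩
  have := h.tau_lt p hp q hq
  rw [h.ofReal_toReal hp hq] at this
  exact (ENNReal.ofReal_lt_ofReal_iff'.1 this).1

theorem continuousOn_toReal (h : L.IsSmall V d) {f g : ℝ → X} {s : Set ℝ} (hf : ContinuousOn f s)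
    (hg : ContinuousOn g s) (hfV : MapsTo f s V) (hgV : MapsTo g s V) :
    ContinuousOn (fun u => (L.tau (f u) (g u)).toReal) s := by
  have h1 : ContinuousOn (fun u => L.tau (f u) (g u)) s :=
    h.continuousOn.comp (hf.prodMk hg) fun u hu => ⟨hfV hu, hgV hu⟩
  refine ENNReal.continuousOn_toReal.comp h1 fun u hu => ?_
  exact ((h.tau_lt _ (hfV hu) _ (hgV hu)).trans ENNReal.ofReal_lt_top).ne

theorem add_le (h : L.IsSmall V d) {p q r : X} (hp : p ∈ V) (hq : q ∈ V) (hr : r ∈ V) (hpq : L.causal p q)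
    (hqr : L.causal q r) :
    (L.tau p q).toReal + (L.tau q r).toReal ≤ (L.tau p r).toReal :=
  reverse_triangle_real hpq hqr (h.ofReal_toReal hp hq) (h.ofReal_toReal hq hr)
    (h.ofReal_toReal hp hr) ENNReal.toReal_nonneg ENNReal.toReal_nonneg ENNReal.toReal_nonneg

theorem mem_angleDomain (h : L.IsSmall V d) {x : X} {α β : ℝ → X} {z : ℝ × ℝ} (hx : x ∈ V) (hα : α z.1 ∈ V)
    (hβ : β z.2 ∈ V) (hc : L.causal (α z.1) (β z.2) ∨ L.causal (β z.2) (α z.1)) :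
    z ∈ L.angleDomain x α β := by
  have hmem : ∀ p ∈ ({x, α z.1, β z.2} : Set X), p ∈ V := by
    rintro p (rfl | rfl | rfl) <;> assumption
  exact ⟨hc, fun p hp q hq => (h.tau_lt p (hmem p hp) q (hmem q hq)).trans ENNReal.ofReal_lt_top⟩

end IsSmall

theorem exists_mapsTo_Icc {c : ℝ → X} {B : ℝ} (hB : 0 < B) (hc : ContinuousOn c (Ico 0 B))
    {V : Set X} (hV : IsOpen V) (h0 : c 0 ∈ V) : ∃ σ, 0 < σ ∧ σ < B ∧ MapsTo c (Icc 0 σ) V := by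
  have h1 : c ⁻¹' V ∈ 𝓝[≥] (0 : ℝ) := by
    rw [← nhdsWithin_Ico_eq_nhdsGE hB]
    exact hc 0 ⟨le_rfl, hB⟩ (hV.mem_nhds h0)
  obtain ⟨σ, hσ, hsub⟩ := mem_nhdsGE_iff_exists_Icc_subset.1 h1
  refine ⟨min σ (B / 2), lt_min hσ (by linarith), by linarith [min_le_right σ (B / 2)], ?_⟩
  exact fun u hu => hsub ⟨hu.1, hu.2.trans (min_le_left _ _)⟩

theorem exists_eq_of_continuousOn {f : ℝ → ℝ} {σ ρ : ℝ} (hσ : 0 ≤ σ)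
    (hf : ContinuousOn f (Icc 0 σ)) (hf0 : f 0 = 0) (hρ : ρ ∈ Ioc 0 (f σ)) :
    ∃ s ∈ Ioc 0 σ, f s = ρ := by
  obtain ⟨s, hs, hfs⟩ := intermediate_value_Icc hσ hf (show ρ ∈ Icc _ _ from
    ⟨by rw [hf0]; exact hρ.1.le, hρ.2⟩)
  refine ⟨s, ⟨lt_of_le_of_ne hs.1 ?_, hs.2⟩, hfs⟩
  rintro rfl
  exact hρ.1.ne (hf0.symm.trans hfs)

/-! ### Angles -/

theorem eventually_angleFilter {x : X} {α β : ℝ → X} {P : ℝ × ℝ → Prop}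
    (h : ∀ᶠ z in L.angleFilter x α β, P z) :
    ∃ δ > 0, ∀ s ∈ Ioo 0 δ, ∀ t ∈ Ioo 0 δ, (s, t) ∈ L.angleDomain x α β → P (s, t) := by
  rw [angleFilter, eventually_inf_principal,
    (nhdsGT_basis (0 : ℝ)).prod_self.eventually_iff] at h
  obtain ⟨δ, hδ, hP⟩ := h
  exact ⟨δ, hδ, fun s hs t ht hd => hP (mk_mem_prod hs ht) hd⟩

theorem comparisonAngle_lt_of_upperAngle_lt {x : X} {α β : ℝ → X} {φ : ℝ}
    (h : L.upperAngle x α β < ENNReal.ofReal φ) :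
    ∃ δ > 0, ∀ s ∈ Ioo 0 δ, ∀ t ∈ Ioo 0 δ, (s, t) ∈ L.angleDomain x α β →
      L.comparisonAngle x (α s) (β t) < φ := by
  obtain ⟨δ, hδ, hP⟩ := eventually_angleFilter (eventually_lt_of_limsup_lt h)
  exact ⟨δ, hδ, fun s hs t ht hd => (ENNReal.ofReal_lt_ofReal_iff'.1 (hP s hs t ht hd)).1⟩

theorem exists_lt_comparisonAngle_of_lt_upperAngle {x : X} {α β : ℝ → X} {ω δ : ℝ}
    (h : ENNReal.ofReal ω < L.upperAngle x α β) (hδ : 0 < δ) :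
    ∃ s ∈ Ioo 0 δ, ∃ t ∈ Ioo 0 δ, (s, t) ∈ L.angleDomain x α β ∧
      ω < L.comparisonAngle x (α s) (β t) := by
  have h1 := frequently_lt_of_lt_limsup (h := h)
  by_contra! hne
  refine h1 ?_
  rw [angleFilter, eventually_inf_principal, (nhdsGT_basis (0 : ℝ)).prod_self.eventually_iff]
  refine ⟨δ, hδ, fun z hz hd => ?_⟩
  have := hne z.1 hz.1 z.2 hz.2 hd
  simpa using ENNReal.ofReal_le_ofReal this

/-- A limit superior yields the bound only at some small parameters; a limit yields it at all of
them. On an empty domain the upper angle is `0` and the hypothesis fails. -/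
theorem lt_comparisonAngle_of_angleExists {x : X} {α β : ℝ → X} {ω : ℝ}
    (hex : L.AngleExists x α β) (h : ENNReal.ofReal ω < L.upperAngle x α β) :
    ∃ δ > 0, ∀ s ∈ Ioo 0 δ, ∀ t ∈ Ioo 0 δ, (s, t) ∈ L.angleDomain x α β →
      ω < L.comparisonAngle x (α s) (β t) := by
  obtain ⟨ω₀, hω₀⟩ := hex
  rcases eq_or_neBot (L.angleFilter x α β) with hbot | hne
  · rw [upperAngle, hbot, limsup_bot] at h
    exact absurd h not_lt_bot
  · have hlim := (ENNReal.tendsto_ofReal hω₀).limsup_eq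
    rw [upperAngle, hlim, ENNReal.ofReal_lt_ofReal_iff'] at h
    exact eventually_angleFilter (hω₀.eventually_const_lt h.1)

/-! ### The triangle inequality for two future directed curves and a past directed one -/

theorem upperAngle_le_add_of_past (hfin : L.LocallyFiniteValued) (hcont : L.LocallyContinuous)
    {B : ℝ} (hB : 0 < B) {x : X} {α β γ : ℝ → X} (hα0 : α 0 = x) (hβ0 : β 0 = x) (hγ0 : γ 0 = x)
    (hα : L.IsFutureTimelike α (Ico 0 B)) (hβ : L.IsFutureTimelike β (Ico 0 B))
    (hγ : L.IsPastTimelike γ (Ico 0 B)) (hex : L.AngleExists x α γ) :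
    L.upperAngle x α γ ≤ L.upperAngle x α β + L.upperAngle x β γ := by
  by_contra! hlt
  obtain ⟨φ, ψ, e, hφ, hψ, he, hαβ, hβγ, hαγ⟩ := ENNReal.exists_real_add_lt hlt
  obtain ⟨δ₁, hδ₁, h1⟩ := comparisonAngle_lt_of_upperAngle_lt hαβ
  obtain ⟨δ₂, hδ₂, h2⟩ := comparisonAngle_lt_of_upperAngle_lt hβγ
  obtain ⟨δ₃, hδ₃, h3⟩ := lt_comparisonAngle_of_angleExists hex hαγ
  obtain ⟨V, hVo, hxV, hV⟩ := exists_isSmall hfin hcont x one_pos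
  have hself := tau_self_eq_zero hfin x
  have hαc : ContinuousOn α (Ico 0 B) := hα.1.1.continuousOn
  have hβc : ContinuousOn β (Ico 0 B) := hβ.1.1.continuousOn
  have hγc : ContinuousOn γ (Ico 0 B) := hγ.1.1.continuousOn
  obtain ⟨σ₁, hσ₁, hσ₁B, hm1⟩ := exists_mapsTo_Icc hB hαc hVo (hα0 ▸ hxV)
  obtain ⟨σ₂, hσ₂, hσ₂B, hm2⟩ := exists_mapsTo_Icc hB hβc hVo (hβ0 ▸ hxV)
  obtain ⟨σ₃, hσ₃, hσ₃B, hm3⟩ := exists_mapsTo_Icc hB hγc hVo (hγ0 ▸ hxV)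
  obtain ⟨σ, hσ0, hσ⟩ : ∃ σ : ℝ, 0 < σ ∧
      σ < δ₁ ∧ σ < δ₂ ∧ σ < δ₃ ∧ σ < σ₁ ∧ σ < σ₂ ∧ σ < σ₃ := by
    have := exists_between (show (0 : ℝ) < min δ₁ (min δ₂ (min δ₃ (min σ₁ (min σ₂ σ₃)))) by
      simp only [lt_min_iff]; exact ⟨hδ₁, hδ₂, hδ₃, hσ₁, hσ₂, hσ₃⟩)
    simpa only [lt_min_iff] using this
  obtain ⟨hs1, hs2, hs3, hs4, hs5, hs6⟩ := hσ
  have hIB : ∀ u ∈ Icc 0 σ, u ∈ Ico 0 B := fun u hu => ⟨hu.1, by linarith [hu.2]⟩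
  have hsub : Icc 0 σ ⊆ Ico 0 B := hIB
  have h0B : (0 : ℝ) ∈ Ico 0 B := ⟨le_rfl, hB⟩
  have hαV : MapsTo α (Icc 0 σ) V := fun u hu => hm1 ⟨hu.1, by linarith [hu.2]⟩
  have hβV : MapsTo β (Icc 0 σ) V := fun u hu => hm2 ⟨hu.1, by linarith [hu.2]⟩
  have hγV : MapsTo γ (Icc 0 σ) V := fun u hu => hm3 ⟨hu.1, by linarith [hu.2]⟩
  have hxα : ∀ u ∈ Ioc 0 σ, L.chron x (α u) := fun u hu =>
    hα0 ▸ hα.2 0 h0B u (hIB u (Ioc_subset_Icc_self hu)) hu.1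
  have hxβ : ∀ u ∈ Ioc 0 σ, L.chron x (β u) := fun u hu =>
    hβ0 ▸ hβ.2 0 h0B u (hIB u (Ioc_subset_Icc_self hu)) hu.1
  have hγx : ∀ u ∈ Ioc 0 σ, L.chron (γ u) x := fun u hu =>
    hγ0 ▸ hγ.2 0 h0B u (hIB u (Ioc_subset_Icc_self hu)) hu.1
  have hσσ : σ ∈ Ioc 0 σ := right_mem_Ioc.2 hσ0
  have hσI : σ ∈ Icc 0 σ := right_mem_Icc.2 hσ0.le
  have hfα : ContinuousOn (fun u => (L.tau x (α u)).toReal) (Icc 0 σ) :=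
    hV.continuousOn_toReal continuousOn_const (hαc.mono hsub) (fun _ _ => hxV) hαV
  have hfβ : ContinuousOn (fun u => (L.tau x (β u)).toReal) (Icc 0 σ) :=
    hV.continuousOn_toReal continuousOn_const (hβc.mono hsub) (fun _ _ => hxV) hβV
  have hfγ : ContinuousOn (fun u => (L.tau (γ u) x).toReal) (Icc 0 σ) :=
    hV.continuousOn_toReal (hγc.mono hsub) continuousOn_const hγV (fun _ _ => hxV)
  -- The whole slack goes into the second angle, as only the sum enters the lower bound for the
  -- angle of `α` and `γ`.
  obtain ⟨M, R, hM, hR, e1, e2⟩ := exists_collinear_of_past hφ (show 0 < ψ + 2 * e by linarith)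
  have hR0 : 0 < R := by linarith
  -- The scale `A` is free; it is taken so small that each curve attains its prescribed separation
  -- from `x` before the parameter `σ`.
  obtain ⟨A, hA, hA1, hA2, hA3⟩ : ∃ A : ℝ, 0 < A ∧ A < (L.tau x (α σ)).toReal ∧
      A < (L.tau x (β σ)).toReal / R ∧ A < (L.tau (γ σ) x).toReal / M := by
    have := exists_between (show (0 : ℝ) < min (L.tau x (α σ)).toReal
        (min ((L.tau x (β σ)).toReal / R) ((L.tau (γ σ) x).toReal / M)) by
      simp only [lt_min_iff]
      exact ⟨(hV.toReal_pos_iff hxV (hαV hσI)).2 (hxα σ hσσ),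
        div_pos ((hV.toReal_pos_iff hxV (hβV hσI)).2 (hxβ σ hσσ)) hR0,
        div_pos ((hV.toReal_pos_iff (hγV hσI) hxV).2 (hγx σ hσσ)) hM⟩)
    simpa only [lt_min_iff] using this
  rw [lt_div_iff₀ hR0] at hA2
  rw [lt_div_iff₀ hM] at hA3
  obtain ⟨s, hs, hsA⟩ := exists_eq_of_continuousOn hσ0.le hfα (by simp [hα0, hself])
    (show A ∈ Ioc _ _ from ⟨hA, hA1.le⟩)
  obtain ⟨r, hr, hrA⟩ := exists_eq_of_continuousOn hσ0.le hfβ (by simp [hβ0, hself])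
    (show A * R ∈ Ioc _ _ from ⟨by positivity, hA2.le⟩)
  obtain ⟨t, ht, htA⟩ := exists_eq_of_continuousOn hσ0.le hfγ (by simp [hγ0, hself])
    (show A * M ∈ Ioc _ _ from ⟨by positivity, hA3.le⟩)
  have hsV := hαV (Ioc_subset_Icc_self hs)
  have hrV := hβV (Ioc_subset_Icc_self hr)
  have htV := hγV (Ioc_subset_Icc_self ht)
  have hIcc : Icc 0 s ⊆ Icc 0 σ := Icc_subset_Icc_right hs.2
  set D := 1 + M ^ 2 + 2 * M * Real.cosh (φ + (ψ + 2 * e)) with hD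
  have hD0 : 0 < D := by
    have := Real.cosh_pos (φ + (ψ + 2 * e))
    positivity
  have hcφ := Real.one_le_cosh φ
  have eq1 : A ^ 2 + (A * R) ^ 2 - 2 * A * (A * R) * Real.cosh φ = A ^ 2 * D := by
    linear_combination A ^ 2 * e1
  have hN : A ^ 2 * D ≤ (L.tau (α s) (β r)).toReal ^ 2 := by
    rw [← eq1]
    refine le_sq_of_continuousOn_hinge (N := fun u => (L.tau (α u) (β r)).toReal)
      (f := fun u => (L.tau x (α u)).toReal) hs.1.le
      (hV.continuousOn_toReal (hαc.mono (hIcc.trans hsub)) continuousOn_const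
        (hαV.mono_left hIcc) fun _ _ => hrV) (by simpa [hα0] using hrA) (by positivity)
      (fun _ _ => ENNReal.toReal_nonneg) (fun u hu => ⟨ENNReal.toReal_nonneg, ?_⟩) ?_
      (by rw [eq1]; positivity) ?_
    · rw [← hsA]
      rcases hu.2.eq_or_lt with rfl | hus
      · exact le_rfl
      have hc2 := hα.2 u (hIB u (hIcc hu)) s (hIB s (Ioc_subset_Icc_self hs)) hus
      rcases hu.1.eq_or_lt with rfl | hu0
      · simp [hα0, hself]
      have hc1 := hxα u ⟨hu0, (hIcc hu).2⟩
      have := hV.add_le hxV (hαV (hIcc hu)) hsV (L.causal_of_chron _ _ hc1)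
        (L.causal_of_chron _ _ hc2)
      linarith [(L.tau (α u) (α s)).toReal_nonneg]
    · calc A = A * 1 * 1 := by ring
        _ ≤ A * R * Real.cosh φ := by gcongr
    · intro u hu hpos
      have huσ : u ∈ Ioc 0 σ := ⟨hu.1, hu.2.trans hs.2⟩
      have huV := hαV (Ioc_subset_Icc_self huσ)
      have hc := (hV.toReal_pos_iff huV hrV).1 hpos
      have hang := h1 u ⟨hu.1, by linarith [huσ.2]⟩ r ⟨hr.1, by linarith [hr.2]⟩
        (hV.mem_angleDomain hxV huV hrV (Or.inl (L.causal_of_chron _ _ hc)))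
      rw [← hrA]
      exact (lt_sq_of_comparisonAngle_lt_of_future hfin
        ((hV.toReal_pos_iff hxV huV).2 (hxα u huσ)) ((hV.toReal_pos_iff hxV hrV).2 (hxβ r hr)) hpos
        (hV.ofReal_toReal hxV huV) (hV.ofReal_toReal hxV hrV) (hV.ofReal_toReal huV hrV)
        hφ.le hang).le
  have hcαβ : L.chron (α s) (β r) := by
    rw [← hV.toReal_pos_iff hsV hrV]
    refine lt_of_le_of_ne ENNReal.toReal_nonneg fun h0 => ?_
    rw [← h0] at hN
    have : 0 < A ^ 2 * D := by positivity
    linarith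
  have cγx := hγx t ht
  have cγα := L.chron_trans _ _ _ cγx (hxα s hs)
  have cγβ := L.chron_trans _ _ _ cγx (hxβ r hr)
  -- The only use of the existence of the angle: `s` and `t` have already been fixed by the
  -- collinear configuration.
  have hP : A ^ 2 * D < (L.tau (γ t) (α s)).toReal ^ 2 := by
    have hang := h3 s ⟨hs.1, by linarith [hs.2]⟩ t ⟨ht.1, by linarith [ht.2]⟩
      (hV.mem_angleDomain hxV hsV htV (Or.inr (L.causal_of_chron _ _ cγα)))
    have := lt_sq_of_lt_comparisonAngle_of_past hfin
      ((hV.toReal_pos_iff hxV hsV).2 (hxα s hs)) ((hV.toReal_pos_iff htV hxV).2 cγx)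
      ((hV.toReal_pos_iff htV hsV).2 cγα) (hV.ofReal_toReal hxV hsV) (hV.ofReal_toReal htV hxV)
      (hV.ofReal_toReal htV hsV) (by linarith) hang
    rw [hsA, htA, show φ + e + (ψ + e) = φ + (ψ + 2 * e) by ring] at this
    calc A ^ 2 * D = A ^ 2 + (A * M) ^ 2 +
          2 * A * (A * M) * Real.cosh (φ + (ψ + 2 * e)) := by rw [hD]; ring
      _ < _ := this
  have hQ : (L.tau (γ t) (β r)).toReal ^ 2 ≤ A ^ 2 * (4 * D) := by
    have hang := h2 r ⟨hr.1, by linarith [hr.2]⟩ t ⟨ht.1, by linarith [ht.2]⟩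
      (hV.mem_angleDomain hxV hrV htV (Or.inr (L.causal_of_chron _ _ cγβ)))
    have := sq_lt_of_comparisonAngle_lt_of_past hfin
      ((hV.toReal_pos_iff hxV hrV).2 (hxβ r hr)) ((hV.toReal_pos_iff htV hxV).2 cγx)
      ((hV.toReal_pos_iff htV hrV).2 cγβ) (hV.ofReal_toReal hxV hrV) (hV.ofReal_toReal htV hxV)
      (hV.ofReal_toReal htV hrV) hψ.le hang
    rw [hrA, htA] at this
    have hle : Real.cosh ψ ≤ Real.cosh (ψ + 2 * e) :=
      Real.cosh_le_cosh.2 (abs_le_abs_of_nonneg hψ.le (by linarith))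
    calc _ ≤ (A * R) ^ 2 + (A * M) ^ 2 + 2 * (A * R) * (A * M) * Real.cosh ψ := this.le
      _ ≤ (A * R) ^ 2 + (A * M) ^ 2 + 2 * (A * R) * (A * M) * Real.cosh (ψ + 2 * e) := by gcongr
      _ = _ := by rw [← e2]; ring
  have htri := hV.add_le htV hsV hrV (L.causal_of_chron _ _ cγα) (L.causal_of_chron _ _ hcαβ)
  have hd : 0 ≤ √(A ^ 2 * D) := Real.sqrt_nonneg _
  have f1 : √(A ^ 2 * D) ≤ (L.tau (α s) (β r)).toReal := Real.sqrt_le_iff.2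
    ⟨ENNReal.toReal_nonneg, hN⟩
  have f2 : √(A ^ 2 * D) < (L.tau (γ t) (α s)).toReal :=
    (Real.sqrt_lt' ((hV.toReal_pos_iff htV hsV).2 cγα)).2 hP
  have f3 : (L.tau (γ t) (β r)).toReal ≤ 2 * √(A ^ 2 * D) := by
    apply le_of_sq_le_sq _ (by positivity)
    rw [mul_pow, Real.sq_sqrt (by positivity)]
    linarith
  linarith

end LorentzianPreLengthSpace

namespace LorentzianPreLengthSpace

variable {X : Type*} [MetricSpace X] {L : LorentzianPreLengthSpace X}

/-! ### The triangle inequality for two future directed curves and a past directed geodesic -/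

/-- Reversed, `β` is a realizer on some `[a, 0]`. In its prolongation `0` is an interior parameter,
so the geodesic condition gives a realizer on both sides of it. -/
theorem exists_realizer_extension (hfin : L.LocallyFiniteValued) (hpro : L.GeodesicProlongation)
    {β : ℝ → X} {B : ℝ} (hB : 0 < B) (hβ : L.IsPastGeodesic β (Ico 0 B)) :
    ∃ (c : ℝ → X) (η : ℝ), 0 < η ∧ η < B ∧ L.IsRealizer c (-η) η ∧
      ∀ t ∈ Icc 0 η, c (-t) = β t := by
  obtain ⟨a, b, hsub, hnhds, hreal⟩ := hβ.2 0 (by simpa using hB)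
  have h0 : (0 : ℝ) ∈ Icc a b := mem_of_mem_nhdsWithin (by simpa using hB) hnhds
  -- The reversed curve lives on `(-B, 0]`, so no interval in its domain extends beyond `0`.
  have hb : b = 0 := by
    have : -b ∈ Ico 0 B := hsub (right_mem_Icc.2 (h0.1.trans h0.2))
    linarith [this.1, h0.2]
  subst hb
  have ha : a < 0 := by
    refine lt_of_le_of_ne h0.1 fun h => ?_
    rw [h, Icc_self, show {t : ℝ | -t ∈ Ico 0 B} = Ioc (-B) 0 by
      ext t; simp only [mem_ofPred_eq, mem_Ico, mem_Ioc]; constructor <;> rintro ⟨h1, h2⟩ <;>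
        constructor <;> linarith, nhdsWithin_Ioc_eq_nhdsLE (by linarith)] at hnhds
    obtain ⟨u, hu, hsub'⟩ := (mem_nhdsLE_iff_exists_Ioc_subset' (neg_one_lt_zero (R := ℝ))).1 hnhds
    have hu0 : u < 0 := hu
    have : u / 2 ∈ ({0} : Set ℝ) := hsub' ⟨by linarith, by linarith⟩
    rw [mem_singleton_iff] at this
    linarith
  have haB : -a < B := (hsub (left_mem_Icc.2 ha.le)).2
  obtain ⟨a', e, c, ha', he, hc, heq⟩ := hpro a 0 _ ha
    ⟨hreal.1, fun t ht => ⟨a, 0, subset_rfl, self_mem_nhdsWithin, hreal⟩⟩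
  obtain ⟨a₁, b₁, -, hn₁, hr₁⟩ := hc.2 0 ⟨ha'.trans ha, he⟩
  rw [IsOpen.nhdsWithin_eq isOpen_Ioo ⟨ha'.trans ha, he⟩, Icc_mem_nhds_iff] at hn₁
  have hη : 0 < min (-a) (min (-a₁) b₁) :=
    lt_min (by linarith) (lt_min (by linarith [hn₁.1]) hn₁.2)
  set η := min (-a) (min (-a₁) b₁) with hηdef
  have h1 : η ≤ -a := min_le_left _ _
  have h2 : η ≤ -a₁ := (min_le_right _ _).trans (min_le_left _ _)
  have h3 : η ≤ b₁ := (min_le_right _ _).trans (min_le_right _ _)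
  refine ⟨c, η, hη, by linarith, hr₁.subinterval hfin (by linarith) (by linarith) h3, ?_⟩
  intro t ht
  have := heq (show -t ∈ Icc a 0 from ⟨by linarith [ht.2], by linarith [ht.1]⟩)
  simpa using this

/-- Here `δ` does not depend on `V`, so the small neighbourhood may be chosen afterwards; its
smallness then puts all five lengths in the range of the hinge bound. -/
theorem IsLowerComparisonNhd.exists_hinge_bound_of_isSmall {K : ℝ} {U : Set X}
    (h : L.IsLowerComparisonNhd K U) (hfin : L.LocallyFiniteValued) {φ ψ : ℝ} (hφ : 0 < φ)
    (hφψ : φ < ψ) : ∃ δ > 0, ∀ (V : Set X) (d : ℝ), L.IsSmall V d → d ≤ δ → V ⊆ U →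
      ∀ (c : ℝ → X) (η : ℝ) (y : X), L.IsRealizer c (-η) η → L.IsFutureTimelike c (Icc (-η) η) →
      MapsTo c (Icc (-η) η) V → y ∈ V → L.chron (c 0) y →
      ∀ t ∈ Ioc 0 η, L.comparisonAngle (c 0) (c (-t)) y < φ → ∀ v ∈ Ioc 0 η, ∀ n : ℝ,
      0 < n → (L.tau (c v) y = ENNReal.ofReal n ∨ L.tau y (c v) = ENNReal.ofReal n) →
      (L.tau (c 0) y).toReal ^ 2 + (L.tau (c 0) (c v)).toReal ^ 2 -
        2 * (L.tau (c 0) y).toReal * (L.tau (c 0) (c v)).toReal * Real.cosh ψ ≤ n ^ 2 := by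
  obtain ⟨δ, hδ, H⟩ := h.exists_hinge_bound hfin hφ hφψ
  refine ⟨δ, hδ, fun V d hV hd hVU c η y hc hct hcV hyV hxy t ht hang v hv n hn hntau => ?_⟩
  have hη : 0 < η := ht.1.trans_le ht.2
  have hIt : -t ∈ Icc (-η) η := ⟨by linarith [ht.2], by linarith [ht.1]⟩
  have hIv : v ∈ Icc (-η) η := ⟨by linarith [hv.1], hv.2⟩
  have hI0 : (0 : ℝ) ∈ Icc (-η) η := ⟨by linarith, hη.le⟩
  have htx : L.chron (c (-t)) (c 0) := hct.2 _ hIt _ hI0 (by linarith [ht.1])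
  have hxv : L.chron (c 0) (c v) := hct.2 _ hI0 _ hIv hv.1
  have hmem : ∀ p ∈ V, ∀ q ∈ V, L.chron p q → (L.tau p q).toReal ∈ Ioo 0 δ := fun p hp q hq hpq =>
    Ioo_subset_Ioo_right hd (hV.toReal_mem_Ioo hp hq hpq)
  have hnδ : n ∈ Ioo 0 δ := by
    rcases hntau with h' | h'
    · have := hmem _ (hcV hIv) _ hyV (chron_of_tau_eq hn h')
      rwa [h', ENNReal.toReal_ofReal hn.le] at this
    · have := hmem _ hyV _ (hcV hIv) (chron_of_tau_eq hn h')
      rwa [h', ENNReal.toReal_ofReal hn.le] at this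
  have hsub : Icc (-t) v ⊆ Icc (-η) η := Icc_subset_Icc hIt.1 hIv.2
  exact H c (-t) v y (by linarith [ht.1]) hv.1
    (hc.subinterval hfin hIt.1 (by linarith [ht.1, hv.1]) hIv.2)
    (fun u hu => hVU (hcV (hsub hu))) (hVU hyV)
    _ (hmem _ (hcV hIt) _ (hcV hI0) htx) _ (hmem _ (hcV hI0) _ (hcV hIv) hxv)
    _ (hmem _ (hcV hIt) _ hyV (L.chron_trans _ _ _ htx hxy)) _ hnδ
    _ (hmem _ (hcV hI0) _ hyV hxy) (hV.ofReal_toReal (hcV hIt) (hcV hI0))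
    (hV.ofReal_toReal (hcV hI0) (hcV hIv)) (hV.ofReal_toReal (hcV hIt) hyV)
    (hV.ofReal_toReal (hcV hI0) hyV) hntau hang

/-- If the hinges at `x` that a point `c v` of a timelike curve forms with the points of `α`, and
with `z`, have angles at most `φ` and `ψ`, then the hinge formed by the endpoint of `α` and `z` has
angle at most `φ + ψ`. -/
theorem IsSmall.le_sq_of_hinges {V : Set X} {d : ℝ} (hV : L.IsSmall V d) {x z : X} {α c : ℝ → X}
    {s η φ ψ : ℝ} (hself : L.tau x x = 0) (hs : 0 < s) (hη : 0 < η)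
    (hα : L.IsFutureTimelike α (Icc 0 s)) (hα0 : α 0 = x) (hαV : MapsTo α (Icc 0 s) V)
    (hc : L.IsFutureTimelike c (Icc 0 η)) (hc0 : c 0 = x) (hcV : MapsTo c (Icc 0 η) V)
    (hzV : z ∈ V) (hαz : L.causal (α s) z) (hφ : 0 < φ) (hψ : 0 < ψ)
    (hzη : (L.tau x z).toReal * Real.cosh ψ ≤ (L.tau x (c η)).toReal)
    (hαc : ∀ u ∈ Ioc 0 s, ∀ v ∈ Ioc 0 η, L.chron (α u) (c v) →
      (L.tau x (α u)).toReal ^ 2 + (L.tau x (c v)).toReal ^ 2 -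
        2 * (L.tau x (α u)).toReal * (L.tau x (c v)).toReal * Real.cosh φ ≤
        (L.tau (α u) (c v)).toReal ^ 2)
    (hcz : ∀ v ∈ Ioc 0 η, L.chron (c v) z →
      (L.tau x z).toReal ^ 2 + (L.tau x (c v)).toReal ^ 2 -
        2 * (L.tau x z).toReal * (L.tau x (c v)).toReal * Real.cosh ψ ≤
        (L.tau (c v) z).toReal ^ 2) :
    (L.tau x (α s)).toReal ^ 2 + (L.tau x z).toReal ^ 2 -
      2 * (L.tau x (α s)).toReal * (L.tau x z).toReal * Real.cosh (φ + ψ) ≤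
      (L.tau (α s) z).toReal ^ 2 := by
  have hmono : ∀ {f : ℝ → X} {w : ℝ}, L.IsFutureTimelike f (Icc 0 w) → f 0 = x →
      MapsTo f (Icc 0 w) V → ∀ u ∈ Icc 0 w, ∀ v ∈ Icc 0 w, u ≤ v →
      (L.tau x (f u)).toReal ≤ (L.tau x (f v)).toReal := by
    intro f w hf hf0 hfV u hu v hv huv
    have hcaus : ∀ a ∈ Icc 0 w, ∀ b ∈ Icc 0 w, a ≤ b → L.causal (f a) (f b) :=
      fun a ha b hb hab => hab.eq_or_lt.elim (fun h => h ▸ L.causal_refl _)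
        fun h => L.causal_of_chron _ _ (hf.2 a ha b hb h)
    have h0 : (0 : ℝ) ∈ Icc 0 w := ⟨le_rfl, hu.1.trans hu.2⟩
    rw [← hf0]
    linarith [hV.add_le (hfV h0) (hfV hu) (hfV hv) (hcaus 0 h0 u hu hu.1) (hcaus u hu v hv huv),
      (L.tau (f u) (f v)).toReal_nonneg]
  have hs0 : (0 : ℝ) ∈ Icc 0 s := left_mem_Icc.2 hs.le
  have hss : s ∈ Icc 0 s := right_mem_Icc.2 hs.le
  have hη0 : (0 : ℝ) ∈ Icc 0 η := left_mem_Icc.2 hη.le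
  have hxV : x ∈ V := hα0 ▸ hαV hs0
  have hxα : L.chron x (α s) := hα0 ▸ hα.2 0 hs0 s hss hs
  set A := (L.tau x (α s)).toReal with hA
  set G := (L.tau x z).toReal with hG
  have hA0 : 0 < A := (hV.toReal_pos_iff hxV (hαV hss)).2 hxα
  have hAG : A ≤ G := by
    linarith [hV.add_le hxV (hαV hss) hzV (L.causal_of_chron _ _ hxα) hαz,
      (L.tau (α s) z).toReal_nonneg]
  -- If the planar points are not timelike related, there is nothing to show.
  rcases le_or_gt (A ^ 2 + G ^ 2 - 2 * A * G * Real.cosh (φ + ψ)) 0 with hD | hD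
  · exact hD.trans (sq_nonneg _)
  obtain ⟨r, μ, hr, hμ, hμ1, h1, h2, e1, e2⟩ := exists_collinear_of_future hA0 hAG hφ hψ hD
  set D := A ^ 2 + G ^ 2 - 2 * A * G * Real.cosh (φ + ψ) with hDdef
  have hcc : ContinuousOn c (Icc 0 η) := hc.1.1.continuousOn
  obtain ⟨v, hv, hvr⟩ := exists_eq_of_continuousOn hη.le
    (hV.continuousOn_toReal continuousOn_const hcc (fun _ _ => hxV) hcV) (by simp [hc0, hself])
    (show r ∈ Ioc _ _ from ⟨hr, h2.trans hzη⟩)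
  have hvI := Ioc_subset_Icc_self hv
  have hsub : Icc 0 v ⊆ Icc 0 η := Icc_subset_Icc_right hv.2
  -- The continuity argument runs along `α` towards `c v`, and below along `c` towards `z`.
  have hN1 : μ ^ 2 * D ≤ (L.tau (α s) (c v)).toReal ^ 2 := by
    rw [← e1]
    refine le_sq_of_continuousOn_hinge (N := fun u => (L.tau (α u) (c v)).toReal)
      (f := fun u => (L.tau x (α u)).toReal) hs.le
      (hV.continuousOn_toReal hα.1.1.continuousOn continuousOn_const hαV fun _ _ => hcV hvI)
      (by simpa [hα0] using hvr) hr (fun _ _ => ENNReal.toReal_nonneg)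
      (fun u hu => ⟨ENNReal.toReal_nonneg, hmono hα hα0 hαV u hu s hss hu.2⟩) h1
      (by rw [e1]; positivity) fun u hu hpos => ?_
    rw [← hvr]
    exact hαc u hu v hv ((hV.toReal_pos_iff (hαV (Ioc_subset_Icc_self hu)) (hcV hvI)).1 hpos)
  have hμ2 : 0 < 1 - μ := sub_pos.2 hμ1
  have hN2 : (1 - μ) ^ 2 * D ≤ (L.tau (c v) z).toReal ^ 2 := by
    rw [← e2]
    refine le_sq_of_continuousOn_hinge (N := fun u => (L.tau (c u) z).toReal)
      (f := fun u => (L.tau x (c u)).toReal) hv.1.le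
      (hV.continuousOn_toReal (hcc.mono hsub) continuousOn_const (hcV.mono_left hsub)
        fun _ _ => hzV) (by rw [hc0]) (hA0.trans_le hAG) (fun _ _ => ENNReal.toReal_nonneg)
      (fun u hu => ⟨ENNReal.toReal_nonneg, hvr ▸ hmono hc hc0 hcV u (hsub hu) v hvI hu.2⟩) h2
      (by rw [e2]; positivity) fun u hu hpos => ?_
    have huI : u ∈ Ioc 0 η := ⟨hu.1, hu.2.trans hv.2⟩
    linarith [hcz u huI ((hV.toReal_pos_iff (hcV (Ioc_subset_Icc_self huI)) hzV).1 hpos)]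
  have f1 : μ * √D ≤ (L.tau (α s) (c v)).toReal := by
    refine le_of_sq_le_sq ?_ ENNReal.toReal_nonneg
    rwa [mul_pow, Real.sq_sqrt hD.le]
  have f2 : (1 - μ) * √D ≤ (L.tau (c v) z).toReal := by
    refine le_of_sq_le_sq ?_ ENNReal.toReal_nonneg
    rwa [mul_pow, Real.sq_sqrt hD.le]
  have hDs := Real.sqrt_pos.2 hD
  have c1 := (hV.toReal_pos_iff (hαV hss) (hcV hvI)).1 ((mul_pos hμ hDs).trans_le f1)
  have c2 := (hV.toReal_pos_iff (hcV hvI) hzV).1 ((mul_pos hμ2 hDs).trans_le f2)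
  have htri := hV.add_le (hαV hss) (hcV hvI) hzV (L.causal_of_chron _ _ c1)
    (L.causal_of_chron _ _ c2)
  calc D = (√D) ^ 2 := (Real.sq_sqrt hD.le).symm
    _ ≤ _ := pow_le_pow_left₀ hDs.le (by linarith) 2

theorem upperAngle_le_add_of_pastGeodesic (hfin : L.LocallyFiniteValued)
    (hcont : L.LocallyContinuous) (hcurv : L.TimelikeCurvatureBoundedBelow)
    (hpro : L.GeodesicProlongation) {B : ℝ} (hB : 0 < B) {x : X} {α β γ : ℝ → X} (hα0 : α 0 = x)
    (hβ0 : β 0 = x) (hγ0 : γ 0 = x) (hα : L.IsFutureTimelike α (Ico 0 B))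
    (hγ : L.IsFutureTimelike γ (Ico 0 B)) (hβ : L.IsPastTimelike β (Ico 0 B))
    (hβg : L.IsPastGeodesic β (Ico 0 B)) :
    L.upperAngle x α γ ≤ L.upperAngle x α β + L.upperAngle x β γ := by
  by_contra! hlt
  obtain ⟨φ, ψ, e, hφ, hψ, he, hαβ, hβγ, hαγ⟩ := ENNReal.exists_real_add_lt hlt
  obtain ⟨δ₁, hδ₁, h1⟩ := comparisonAngle_lt_of_upperAngle_lt hαβ
  obtain ⟨δ₂, hδ₂, h2⟩ := comparisonAngle_lt_of_upperAngle_lt hβγ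
  have hself := tau_self_eq_zero hfin x
  obtain ⟨K, hK⟩ := hcurv
  obtain ⟨U, hxU, hU⟩ := hK x
  obtain ⟨ε₁, hε₁, H1⟩ := hU.exists_hinge_bound_of_isSmall hfin hφ (lt_add_of_pos_right φ he)
  obtain ⟨ε₂, hε₂, H2⟩ := hU.exists_hinge_bound_of_isSmall hfin hψ (lt_add_of_pos_right ψ he)
  obtain ⟨V₀, hV₀o, hxV₀, hV₀⟩ := exists_isSmall hfin hcont x (lt_min hε₁ hε₂)
  have hVo : IsOpen (V₀ ∩ U) := hV₀o.inter hU.1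
  have hxV : x ∈ V₀ ∩ U := ⟨hxV₀, hxU⟩
  have hVU : V₀ ∩ U ⊆ U := inter_subset_right
  have hV := hV₀.mono (inter_subset_left (t := U))
  generalize V₀ ∩ U = V at hVo hxV hVU hV
  obtain ⟨c, η₀, hη₀, hη₀B, hc₀, hcβ₀⟩ := exists_realizer_extension hfin hpro hB hβg
  have hc0 : c 0 = x := by simpa [hβ0] using hcβ₀ 0 ⟨le_rfl, hη₀.le⟩
  obtain ⟨η, hη, hηη₀, hcV⟩ : ∃ η > 0, η ≤ η₀ ∧ MapsTo c (Icc (-η) η) V := by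
    have h : c ⁻¹' V ∈ 𝓝 (0 : ℝ) :=
      (hc₀.1.1.1.continuousOn.continuousAt (Icc_mem_nhds (neg_lt_zero.2 hη₀) hη₀)).preimage_mem_nhds
        (hVo.mem_nhds (hc0 ▸ hxV))
    obtain ⟨η, hη, hsub⟩ := Metric.nhds_basis_closedBall.mem_iff.1 h
    rw [Real.closedBall_eq_Icc, zero_sub, zero_add] at hsub
    exact ⟨min η η₀, lt_min hη hη₀, min_le_right _ _, fun u hu =>
      hsub ⟨by linarith [hu.1, min_le_left η η₀], hu.2.trans (min_le_left _ _)⟩⟩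
  have hc : L.IsRealizer c (-η) η := hc₀.subinterval hfin (by linarith) (by linarith) hηη₀
  have hcβ : ∀ t ∈ Icc 0 η, c (-t) = β t := fun t ht => hcβ₀ t ⟨ht.1, ht.2.trans hηη₀⟩
  have hIη : η ∈ Icc (-η) η := ⟨by linarith, le_rfl⟩
  have hI0 : (0 : ℝ) ∈ Icc (-η) η := ⟨by linarith, hη.le⟩
  have hIn : -η ∈ Icc (-η) η := ⟨le_rfl, by linarith⟩
  have h0B : (0 : ℝ) ∈ Ico 0 B := ⟨le_rfl, hB⟩
  have hβx : ∀ t ∈ Ioc 0 η, L.chron (β t) x := fun t ht =>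
    hβ0 ▸ hβ.2 0 h0B t ⟨ht.1.le, by linarith [ht.2]⟩ ht.1
  -- The prolongation is only causal a priori, but its endpoints are timelike related because of its
  -- past half, and in `U` realizers between such points are timelike.
  have hct : L.IsFutureTimelike c (Icc (-η) η) := by
    refine (hU.2.2.2.1 (c (-η)) (hVU (hcV hIn)) (c η) (hVU (hcV hIη)) ?_).2 (-η) η c (by linarith)
      hc (fun u hu => hVU (hcV hu)) rfl rfl
    refine chron_of_chron_of_causal ?_ (hc.1.causal_of_le hI0 hIη hη.le)
    rw [hcβ η ⟨hη.le, le_rfl⟩, hc0]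
    exact hβx η ⟨hη, le_rfl⟩
  have hsub : Icc 0 η ⊆ Icc (-η) η := Icc_subset_Icc_left (by linarith)
  have hct' : L.IsFutureTimelike c (Icc 0 η) :=
    ⟨hct.1.mono hsub, fun s hs t ht => hct.2 s (hsub hs) t (hsub ht)⟩
  -- A single point of `β` is enough: the hinge bound transfers its angle to every point of the
  -- future half of `c`.
  obtain ⟨t₀, ht₀, ht₀'⟩ : ∃ t : ℝ, 0 < t ∧ t < η ∧ t < δ₁ ∧ t < δ₂ := by
    have := exists_between (show (0 : ℝ) < min η (min δ₁ δ₂) from lt_min hη (lt_min hδ₁ hδ₂))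
    simpa only [lt_min_iff] using this
  obtain ⟨ht₀η, ht₀1, ht₀2⟩ := ht₀'
  have ht₀I : t₀ ∈ Ioc 0 η := ⟨ht₀, ht₀η.le⟩
  have hct₀ := hcβ t₀ ⟨ht₀.le, ht₀η.le⟩
  have hβt₀V : β t₀ ∈ V := hct₀ ▸ hcV ⟨by linarith, by linarith⟩
  have hτη : 0 < (L.tau x (c η)).toReal := (hV.toReal_pos_iff hxV (hcV hIη)).2
    (hc0 ▸ hct.2 0 hI0 η hIη hη)
  set C := Real.cosh (φ + e + (ψ + e)) with hC
  have hC0 : 0 < C := Real.cosh_pos _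
  -- Points in `W` are so close to `x` that `c` reaches the distance at which the planar segment
  -- crosses the middle ray.
  obtain ⟨W, hWo, hxW, hW⟩ := exists_isSmall hfin hcont x (div_pos hτη hC0)
  have hWη : ∀ z ∈ W, ∀ ω, 0 ≤ ω → ω ≤ φ + e + (ψ + e) →
      (L.tau x z).toReal * Real.cosh ω ≤ (L.tau x (c η)).toReal := by
    intro z hz ω hω hω'
    have hz' : (L.tau x z).toReal ≤ (L.tau x (c η)).toReal / C :=
      ENNReal.toReal_le_of_le_ofReal (by positivity) (hW.tau_lt x hxW z hz).le
    have hωC : Real.cosh ω ≤ C := Real.cosh_le_cosh.2 (abs_le_abs_of_nonneg hω hω')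
    calc _ ≤ (L.tau x (c η)).toReal / C * C := by gcongr
      _ = _ := div_mul_cancel₀ _ hC0.ne'
  have hαc : ContinuousOn α (Ico 0 B) := hα.1.1.continuousOn
  have hγc : ContinuousOn γ (Ico 0 B) := hγ.1.1.continuousOn
  obtain ⟨σ₁, hσ₁, hσ₁B, hm1⟩ := exists_mapsTo_Icc hB hαc (hVo.inter hWo) (hα0 ▸ ⟨hxV, hxW⟩)
  obtain ⟨σ₂, hσ₂, hσ₂B, hm2⟩ := exists_mapsTo_Icc hB hγc (hVo.inter hWo) (hγ0 ▸ ⟨hxV, hxW⟩)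
  obtain ⟨s, hs, t, ht, hdom, hang⟩ := exists_lt_comparisonAngle_of_lt_upperAngle hαγ
    (show (0 : ℝ) < min δ₁ (min δ₂ (min σ₁ σ₂)) from
      lt_min hδ₁ (lt_min hδ₂ (lt_min hσ₁ hσ₂)))
  simp only [mem_Ioo, lt_min_iff] at hs ht
  obtain ⟨hs0, hs1, -, hs3, -⟩ := hs
  obtain ⟨ht0, -, ht2, -, ht4⟩ := ht
  have hαV : MapsTo α (Icc 0 s) V := fun u hu => (hm1 ⟨hu.1, by linarith [hu.2]⟩).1
  have hγV : MapsTo γ (Icc 0 t) V := fun u hu => (hm2 ⟨hu.1, by linarith [hu.2]⟩).1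
  have hsV := hαV (right_mem_Icc.2 hs0.le)
  have htV := hγV (right_mem_Icc.2 ht0.le)
  have hsW := (hm1 ⟨hs0.le, hs3.le⟩).2
  have htW := (hm2 ⟨ht0.le, ht4.le⟩).2
  have hsubα : Icc 0 s ⊆ Ico 0 B := fun u hu => ⟨hu.1, by linarith [hu.2]⟩
  have hsubγ : Icc 0 t ⊆ Ico 0 B := fun u hu => ⟨hu.1, by linarith [hu.2]⟩
  have hα' : L.IsFutureTimelike α (Icc 0 s) :=
    ⟨hα.1.mono hsubα, fun u hu v hv => hα.2 u (hsubα hu) v (hsubα hv)⟩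
  have hγ' : L.IsFutureTimelike γ (Icc 0 t) :=
    ⟨hγ.1.mono hsubγ, fun u hu v hv => hγ.2 u (hsubγ hu) v (hsubγ hv)⟩
  have hxα : ∀ u ∈ Ioc 0 s, L.chron x (α u) := fun u hu =>
    hα0 ▸ hα'.2 0 (left_mem_Icc.2 hs0.le) u (Ioc_subset_Icc_self hu) hu.1
  have hxγ : ∀ u ∈ Ioc 0 t, L.chron x (γ u) := fun u hu =>
    hγ0 ▸ hγ'.2 0 (left_mem_Icc.2 ht0.le) u (Ioc_subset_Icc_self hu) hu.1
  have Hα : ∀ u ∈ Ioc 0 s, ∀ v ∈ Ioc 0 η, ∀ n : ℝ, 0 < n →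
      (L.tau (c v) (α u) = ENNReal.ofReal n ∨ L.tau (α u) (c v) = ENNReal.ofReal n) →
      (L.tau x (α u)).toReal ^ 2 + (L.tau x (c v)).toReal ^ 2 -
        2 * (L.tau x (α u)).toReal * (L.tau x (c v)).toReal * Real.cosh (φ + e) ≤ n ^ 2 := by
    intro u hu
    have huV := hαV (Ioc_subset_Icc_self hu)
    have hangle : L.comparisonAngle x (c (-t₀)) (α u) < φ := by
      rw [comparisonAngle_comm, hct₀]
      exact h1 u ⟨hu.1, by linarith [hu.2]⟩ t₀ ⟨ht₀, ht₀1⟩ (hV.mem_angleDomain hxV huV hβt₀V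
        (Or.inr (L.causal_of_chron _ _ (L.chron_trans _ _ _ (hβx t₀ ht₀I) (hxα u hu)))))
    have := H1 V _ hV (min_le_left _ _) hVU c η (α u) hc hct hcV huV (hc0 ▸ hxα u hu) t₀ ht₀I
      (hc0 ▸ hangle)
    rwa [hc0] at this
  have Hγ : ∀ u ∈ Ioc 0 t, ∀ v ∈ Ioc 0 η, ∀ n : ℝ, 0 < n →
      (L.tau (c v) (γ u) = ENNReal.ofReal n ∨ L.tau (γ u) (c v) = ENNReal.ofReal n) →
      (L.tau x (γ u)).toReal ^ 2 + (L.tau x (c v)).toReal ^ 2 -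
        2 * (L.tau x (γ u)).toReal * (L.tau x (c v)).toReal * Real.cosh (ψ + e) ≤ n ^ 2 := by
    intro u hu
    have huV := hγV (Ioc_subset_Icc_self hu)
    have hangle : L.comparisonAngle x (c (-t₀)) (γ u) < ψ := by
      rw [hct₀]
      exact h2 t₀ ⟨ht₀, ht₀2⟩ u ⟨hu.1, by linarith [hu.2]⟩ (hV.mem_angleDomain hxV hβt₀V huV
        (Or.inl (L.causal_of_chron _ _ (L.chron_trans _ _ _ (hβx t₀ ht₀I) (hxγ u hu)))))
    have := H2 V _ hV (min_le_right _ _) hVU c η (γ u) hc hct hcV huV (hc0 ▸ hxγ u hu) t₀ ht₀I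
      (hc0 ▸ hangle)
    rwa [hc0] at this
  have hss : s ∈ Ioc 0 s := right_mem_Ioc.2 hs0
  have htt : t ∈ Ioc 0 t := right_mem_Ioc.2 ht0
  have hcV' := hcV.mono_left hsub
  have hpos : ∀ {p q : X}, p ∈ V → q ∈ V → L.chron p q → 0 < (L.tau p q).toReal :=
    fun hp hq => (hV.toReal_pos_iff hp hq).2
  -- The crossing argument needs the earlier point first; in the other causal order `α` and `γ`
  -- exchange roles.
  rcases hdom.1 with hst | hst
  · have hle := hV.le_sq_of_hinges hself hs0 hη hα' hα0 hαV hct' hc0 hcV' htV hst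
      (show 0 < φ + e by linarith) (show 0 < ψ + e by linarith)
      (hWη _ htW _ (by linarith) (by linarith))
      (fun u hu v hv huv => Hα u hu v hv _
        (hpos (hαV (Ioc_subset_Icc_self hu)) (hcV' (Ioc_subset_Icc_self hv)) huv)
        (Or.inr (hV.ofReal_toReal (hαV (Ioc_subset_Icc_self hu)) (hcV' (Ioc_subset_Icc_self hv)))))
      (fun v hv hvz => Hγ t htt v hv _ (hpos (hcV' (Ioc_subset_Icc_self hv)) htV hvz)
        (Or.inl (hV.ofReal_toReal (hcV' (Ioc_subset_Icc_self hv)) htV)))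
    exact hle.not_gt (sq_lt_of_lt_comparisonAngle_of_future (hpos hxV hsV (hxα s hss))
      (hpos hxV htV (hxγ t htt)) ENNReal.toReal_nonneg (hV.ofReal_toReal hxV hsV)
      (hV.ofReal_toReal hxV htV) hst (hV.ofReal_toReal hsV htV) (by linarith) hang)
  · rw [comparisonAngle_comm, add_comm (φ + e)] at hang
    have hle := hV.le_sq_of_hinges hself ht0 hη hγ' hγ0 hγV hct' hc0 hcV' hsV hst
      (show 0 < ψ + e by linarith) (show 0 < φ + e by linarith)
      (hWη _ hsW _ (by linarith) (by linarith))
      (fun u hu v hv huv => Hγ u hu v hv _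
        (hpos (hγV (Ioc_subset_Icc_self hu)) (hcV' (Ioc_subset_Icc_self hv)) huv)
        (Or.inr (hV.ofReal_toReal (hγV (Ioc_subset_Icc_self hu)) (hcV' (Ioc_subset_Icc_self hv)))))
      (fun v hv hvz => Hα s hss v hv _ (hpos (hcV' (Ioc_subset_Icc_self hv)) hsV hvz)
        (Or.inl (hV.ofReal_toReal (hcV' (Ioc_subset_Icc_self hv)) hsV)))
    exact hle.not_gt (sq_lt_of_lt_comparisonAngle_of_future (hpos hxV htV (hxγ t htt))
      (hpos hxV hsV (hxα s hss)) ENNReal.toReal_nonneg (hV.ofReal_toReal hxV htV)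
      (hV.ofReal_toReal hxV hsV) hst (hV.ofReal_toReal htV hsV) (by linarith) hang)

end LorentzianPreLengthSpace

theorem theorem4p5 {X : Type*} [MetricSpace X] (L : LorentzianPreLengthSpace X)
    (hsc : L.StronglyCausal) (hfin : L.LocallyFiniteValued) (hcont : L.LocallyContinuous)
    (B : ℝ) (hB : 0 < B) (x : X) (α β γ : ℝ → X) (hα : α 0 = x) (hβ : β 0 = x) (hγ : γ 0 = x) :
    (L.IsFutureTimelike α (Ico 0 B) → L.IsFutureTimelike β (Ico 0 B) →
      L.IsPastTimelike γ (Ico 0 B) → L.AngleExists x α γ →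
      L.upperAngle x α γ ≤ L.upperAngle x α β + L.upperAngle x β γ) ∧
    (L.LocallyCausallyClosed → L.TimelikeCurvatureBoundedBelow → L.GeodesicProlongation →
      L.IsFutureTimelike α (Ico 0 B) → L.IsFutureTimelike γ (Ico 0 B) →
      L.IsPastTimelike β (Ico 0 B) → L.IsPastGeodesic β (Ico 0 B) →
      L.upperAngle x α γ ≤ L.upperAngle x α β + L.upperAngle x β γ) :=
  ⟨fun h1 h2 h3 h4 => LorentzianPreLengthSpace.upperAngle_le_add_of_past hfin hcont hB hα hβ hγ
    h1 h2 h3 h4, fun _ h1 h2 h3 h4 h5 h6 =>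
    LorentzianPreLengthSpace.upperAngle_le_add_of_pastGeodesic hfin hcont h1 h2 hB hα hβ hγ
      h3 h4 h5 h6⟩
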